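/- **Notation.** Let $d\ge 1$. For $n\in\mathbb Z^d$ put $|n|=\sum_j|n_j|$, for $x\in\mathbb R$ let $\|x\|_{\mathbb R/\mathbb Z}$ be the distance to the nearest integer, and let $R_x=\begin{pmatrix}\cos2\pi x&-\sin2\pi x\\ \sin2\pi x&\cos2\pi x\end{pmatrix}$, $M=\frac1{2i}\begin{pmatrix}1&-i\\1&i\end{pmatrix}$. For $h>0$ let $C^\omega_h(\mathbb T^d,*)$ be the set of analytic maps $F:\mathbb T^d=\mathbb R^d/\mathbb Z^d\to *$ that extend to bounded analytic functions on $\{\theta\in\mathbb C^d:|\mathrm{Im}\,\theta_j|<h\ \forall j\}$, with $\|F\|_h$ the supremum of the Euclidean operator norm $\|F(\theta)\|$ on this set. A $PSL(2,\mathbb R)$-valued map on $\mathbb T^d$ is given by a matrix-valued lift that is $\mathbb Z^d$-periodic up to sign. Its degree is $n\in\mathbb Z^d$ if it is homotopic, as a map $\mathbb T^d\to PSL(2,\mathbb R)$, to $\theta\mapsto R_{\langle n,\theta\rangle/2}$. Let $\alpha\in\mathbb R^d$, $0<h'<h$, $V\in C^\omega_h(\mathbb T^d,\mathbb R)$ with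 Fourier coefficients $V_k$ $(k\in\mathbb Z^d)$, $\lambda\in\mathbb R\setminus\{0\}$ and $E\in\mathbb R$. Let $$S_E^{\lambda^{-1}V}(\theta)=\begin{pmatrix}E-\lambda^{-1}V(\theta)&-1\\1&0\end{pmatrix}$$ and let $\rho(E)$ be the fibered rotation number of the cocycle $(\alpha,S_E^{\lambda^{-1}V})$. That is, $\rho(E)=\int\psi\,d\mu \bmod \mathbb Z$, where $\psi:\mathbb T^d\times\mathbb T\to\mathbb R$ is a continuous function such that $S_E^{\lambda^{-1}V}(x)$ maps the direction of angle $2\pi y$ to the direction of angle $2\pi(y+\psi(x,y))$, and $\mu$ is a probability measure on $\mathbb T^d\times\mathbb T$ that is invariant under $(x,y)\mapsto(x+\alpha,y+\psi(x,y))$ and projects to Lebesgue measure on $\mathbb T^d$. Let $L_{V,\lambda,\alpha,\rho(E)}$ be the operator on $\ell^2(\mathbb Z^d)$ given by $$(L_{V,\lambda,\alpha,\rho(E)}u)_n=\sum_{k\in\mathbb Z^d}V_ku_{n-k}+2\lambda\cos2\pi(\rho(E)+\langle n,\alpha\rangle)\,u_n .$$ **Proposition.** Assume that $\rho(E)$ is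 not rational with respect to $\alpha$, i.e. $2\rho(E)\ne\langle k,\alpha\rangle \bmod\mathbb Z$ for every $k\in\mathbb Z^d$, and that there are $B\in C^\omega_{h'}(\mathbb T^d,PSL(2,\mathbb R))$, $A\in SL(2,\mathbb R)$, $t\in\mathbb R$ and $\nu\in\mathbb C$ such that $$B^{-1}(\theta+\alpha)\,S_E^{\lambda^{-1}V}(\theta)\,B(\theta)=A=M^{-1}\exp\begin{pmatrix}it&\nu\\ \bar\nu&-it\end{pmatrix}M,$$ where the first equality is in $PSL(2,\mathbb R)$. Assume moreover that $B(\theta)=\tilde B(\theta)R_{\langle\ell,\theta\rangle/2}e^{Y(\theta)}$ with $\ell\in\mathbb Z^d$, $\tilde B\in C^\omega_{h'}(\mathbb T^d,PSL(2,\mathbb R))$ of degree $\ell_0$, and $Y\in C^\omega_{h'}(\mathbb T^d,sl(2,\mathbb R))$ with $\|Y\|_{h'}\le\frac12$. Put $$C=8\|\tilde B\|_{h'}^4,\qquad C_{|\ell|}=\min\Big\{1,\ \|Y\|_{h'}+\frac{2|\nu|}{\|2\rho(E)-\langle\ell,\alpha\rangle-\langle\ell_0,\alpha\rangle\|_{\mathbb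 R/\mathbb Z}}\Big\}.$$ Then $L_{V,\lambda,\alpha,\rho(E)}$ has a $(2\pi h',\ell,C,C_{|\ell|})$-good or a $(2\pi h',-\ell,C,C_{|\ell|})$-good eigenfunction with eigenvalue $\lambda E$: for $\ell'=\ell$ or for $\ell'=-\ell$ there is $u\in\ell^2(\mathbb Z^d)$ with $\sum_n|u(n)|^2=1$, $L_{V,\lambda,\alpha,\rho(E)}u=\lambda E\,u$ and $$|u(n)|\le C\big(e^{-2\pi h'|n|}+C_{|\ell|}\,e^{-2\pi h'|n+\ell'|}\big)\qquad\text{for all }n\in\mathbb Z^d .$$ -/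

import Mathlib

namespace QPCocycle

open MeasureTheory

noncomputable section

/-- Points of `ℝ^d` viewed in `ℂ^d`. -/
def toC {d : ℕ} (x : Fin d → ℝ) : Fin d → ℂ := fun j => (x j : ℂ)

/-- The pairing `⟨k, x⟩ = ∑ j, k_j x_j` of an integer vector with a real vector. -/
def pair {d : ℕ} (k : Fin d → ℤ) (x : Fin d → ℝ) : ℝ := ∑ j, (k j : ℝ) * x j

/-- The pairing `⟨k, z⟩ = ∑ j, k_j z_j` of an integer vector with a complex vector. -/
def pairC {d : ℕ} (k : Fin d → ℤ) (z : Fin d → ℂ) : ℂ := ∑ j, (k j : ℂ) * z j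

/-- The length `|n| = ∑ j, |n_j|` of an integer vector. -/
def len {d : ℕ} (n : Fin d → ℤ) : ℝ := ∑ j, |(n j : ℝ)|

/-- The distance `‖x‖_{ℝ/ℤ}` of a real number to the nearest integer. -/
def distZ (x : ℝ) : ℝ := |x - round x|

/-- The strip `{z ∈ ℂ^d : |Im z_j| < h for all j}`. -/
def strip (d : ℕ) (h : ℝ) : Set (Fin d → ℂ) := {z | ∀ j, |(z j).im| < h}

/-- The operator norm of a complex `2 × 2` matrix for the Euclidean norm of `ℂ²`. -/
def opNorm (A : Matrix (Fin 2) (Fin 2) ℂ) : ℝ :=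
  ‖Matrix.toEuclideanCLM (n := Fin 2) (𝕜 := ℂ) A‖

/-- `‖F‖_h`, the supremum over the strip of width `h` of the operator norm of `F`. It is used only
for functions that are bounded on the strip. -/
def stripNorm {d : ℕ} (h : ℝ) (F : (Fin d → ℂ) → Matrix (Fin 2) (Fin 2) ℂ) : ℝ :=
  sSup ((fun z => opNorm (F z)) '' strip d h)

/-- A real matrix viewed as a complex matrix. -/
def matC (P : Matrix (Fin 2) (Fin 2) ℝ) : Matrix (Fin 2) (Fin 2) ℂ := P.map (fun x => (x : ℂ))

/-- `V ∈ C_h^ω(𝕋^d, ℝ)`: bounded and analytic on the strip of width `h`, `1`-periodic in every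
coordinate, and real on `ℝ^d`. -/
structure IsAnalyticReal {d : ℕ} (h : ℝ) (V : (Fin d → ℂ) → ℂ) : Prop where
  analytic : AnalyticOnNhd ℂ V (strip d h)
  bounded : BddAbove ((fun z => ‖V z‖) '' strip d h)
  periodic : ∀ j, ∀ z ∈ strip d h, V (z + Pi.single j 1) = V z
  real : ∀ x : Fin d → ℝ, (V (toC x)).im = 0

/-- `Y ∈ C_h^ω(𝕋^d, sl(2,ℝ))`: bounded and analytic on the strip of width `h`, `1`-periodic in
every coordinate, with values on `ℝ^d` in the real trace-free matrices. -/
structure IsAnalyticSl {d : ℕ} (h : ℝ) (Y : (Fin d → ℂ) → Matrix (Fin 2) (Fin 2) ℂ) : Prop where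
  analytic : ∀ a b, AnalyticOnNhd ℂ (fun z => Y z a b) (strip d h)
  bounded : BddAbove ((fun z => opNorm (Y z)) '' strip d h)
  periodic : ∀ j, ∀ z ∈ strip d h, Y (z + Pi.single j 1) = Y z
  real : ∀ x : Fin d → ℝ, ∃ P : Matrix (Fin 2) (Fin 2) ℝ, P.trace = 0 ∧ Y (toC x) = matC P

/-- `B ∈ C_h^ω(𝕋^d, PSL(2,ℝ))`, given by a lift to matrices: bounded and analytic on the strip of
width `h`, with values on `ℝ^d` in `SL(2,ℝ)`, and `1`-periodic in every coordinate up to a sign.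
(The strip is connected, so the sign in each coordinate does not depend on the point.) -/
structure IsAnalyticPSL {d : ℕ} (h : ℝ) (B : (Fin d → ℂ) → Matrix (Fin 2) (Fin 2) ℂ) : Prop where
  analytic : ∀ a b, AnalyticOnNhd ℂ (fun z => B z a b) (strip d h)
  bounded : BddAbove ((fun z => opNorm (B z)) '' strip d h)
  periodic : ∀ j, (∀ z ∈ strip d h, B (z + Pi.single j 1) = B z) ∨
    (∀ z ∈ strip d h, B (z + Pi.single j 1) = -B z)
  real : ∀ x : Fin d → ℝ, ∃ P : Matrix (Fin 2) (Fin 2) ℝ, P.det = 1 ∧ B (toC x) = matC P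

/-- The rotation `R_z`, by the angle `2πz`, for real or complex `z`. -/
def rot (z : ℂ) : Matrix (Fin 2) (Fin 2) ℂ :=
  !![Complex.cos (2 * Real.pi * z), -Complex.sin (2 * Real.pi * z);
     Complex.sin (2 * Real.pi * z), Complex.cos (2 * Real.pi * z)]

/-- `deg B = n`: the map `B : 𝕋^d → PSL(2,ℝ)` is homotopic to `θ ↦ R_{⟨n,θ⟩/2}`. The homotopy is
given by a lift `H` to `SL(2,ℝ)`-valued maps on `ℝ^d` that are periodic up to sign (a sign that is
constant by connectedness). -/
def HasDegree {d : ℕ} (B : (Fin d → ℂ) → Matrix (Fin 2) (Fin 2) ℂ) (n : Fin d → ℤ) : Prop :=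
  ∃ H : unitInterval × (Fin d → ℝ) → Matrix (Fin 2) (Fin 2) ℝ,
    Continuous H ∧
    (∀ p, (H p).det = 1) ∧
    (∀ j, (∀ s x, H (s, x + Pi.single j 1) = H (s, x)) ∨
      (∀ s x, H (s, x + Pi.single j 1) = -H (s, x))) ∧
    (∀ x, matC (H (0, x)) = B (toC x)) ∧
    (∀ x, matC (H (1, x)) = rot ((pair n x / 2 : ℝ) : ℂ))

/-- The unit vector with angle `2πy`. -/
def unitVec (y : ℝ) : Fin 2 → ℂ :=
  ![((Real.cos (2 * Real.pi * y) : ℝ) : ℂ), ((Real.sin (2 * Real.pi * y) : ℝ) : ℂ)]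

/-- The class in `𝕋^d` of a point of `ℝ^d`. -/
def toTorus {d : ℕ} (x : Fin d → ℝ) : UnitAddTorus (Fin d) := fun j => ((x j : ℝ) : UnitAddCircle)

/-- `ψ : 𝕋^d × 𝕋 → ℝ` is a lift of `A : ℝ^d → SL(2,ℝ)`: it is continuous, and `A(x)` maps the
direction with angle `2πy` to the direction with angle `2π(y + ψ(x, y))`. -/
def IsLift {d : ℕ} (A : (Fin d → ℝ) → Matrix (Fin 2) (Fin 2) ℂ)
    (ψ : UnitAddTorus (Fin d) × UnitAddCircle → ℝ) : Prop :=
  Continuous ψ ∧ ∀ (x : Fin d → ℝ) (y : ℝ), ∃ r : ℝ, 0 < r ∧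
    (A x).mulVec (unitVec y) =
      (r : ℂ) • unitVec (y + ψ (toTorus x, (y : UnitAddCircle)))

/-- The projective skew product `(x, y) ↦ (x + α, y + ψ(x, y))` on `𝕋^d × 𝕋`. -/
def skew {d : ℕ} (α : Fin d → ℝ) (ψ : UnitAddTorus (Fin d) × UnitAddCircle → ℝ)
    (p : UnitAddTorus (Fin d) × UnitAddCircle) : UnitAddTorus (Fin d) × UnitAddCircle :=
  (p.1 + toTorus α, p.2 + ((ψ p : ℝ) : UnitAddCircle))

/-- The real number `ρ` represents the fibered rotation number of the cocycle `(α, A)`: modulo `ℤ`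
it is the integral of a lift `ψ` against a probability measure on `𝕋^d × 𝕋` that is invariant under
the projective skew product and projects to Lebesgue measure on `𝕋^d`. -/
def IsFiberedRotationNumber {d : ℕ} (α : Fin d → ℝ)
    (A : (Fin d → ℝ) → Matrix (Fin 2) (Fin 2) ℂ) (ρ : ℝ) : Prop :=
  ∃ (ψ : UnitAddTorus (Fin d) × UnitAddCircle → ℝ)
    (μ : Measure (UnitAddTorus (Fin d) × UnitAddCircle)) (m : ℤ),
    IsLift A ψ ∧ IsProbabilityMeasure μ ∧ MeasurePreserving (skew α ψ) μ μ ∧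
    μ.map Prod.fst = volume ∧ ρ = ∫ p, ψ p ∂μ + m

/-- `ρ` is rational with respect to `α`: `2ρ = ⟨k, α⟩` modulo `ℤ` for some `k ∈ ℤ^d`. -/
def IsRationalWrt {d : ℕ} (α : Fin d → ℝ) (ρ : ℝ) : Prop :=
  ∃ (k : Fin d → ℤ) (m : ℤ), 2 * ρ = pair k α + m

/-- The Schrödinger cocycle map `S_E^{λ⁻¹V}(θ)` at real phases `θ`. -/
def schrodinger {d : ℕ} (V : (Fin d → ℂ) → ℂ) (lam E : ℝ) (θ : Fin d → ℝ) :
    Matrix (Fin 2) (Fin 2) ℂ :=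
  !![(E : ℂ) - (lam : ℂ)⁻¹ * V (toC θ), -1; 1, 0]

/-- The matrix `M = (1 / 2i) (1, -i; 1, i)`. -/
def cayleyM : Matrix (Fin 2) (Fin 2) ℂ :=
  (1 / (2 * Complex.I)) • !![1, -Complex.I; 1, Complex.I]

/-- The element `(it, ν; ν̄, -it)` of `su(1,1)`. -/
def su11 (t : ℝ) (ν : ℂ) : Matrix (Fin 2) (Fin 2) ℂ :=
  !![Complex.I * t, ν; (starRingEnd ℂ) ν, -(Complex.I * t)]

/-- The Fourier coefficient `V_k = ∫_{[0,1]^d} V(x) e^{-2πi⟨k,x⟩} dx`. -/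
def fourierCoef {d : ℕ} (V : (Fin d → ℂ) → ℂ) (k : Fin d → ℤ) : ℂ :=
  ∫ x in Set.Icc (0 : Fin d → ℝ) 1,
    Complex.exp (-(2 * Real.pi * Complex.I * (pair k x : ℝ))) * V (toC x)

/-- The long-range operator
`(L_{V,λ,α,ρ} u)_n = ∑_k V_k u_{n-k} + 2λ cos(2π(ρ + ⟨n,α⟩)) u_n`
on `ℓ²(ℤ^d)`. For analytic `V` the coefficients `V_k` are absolutely summable, so the series
converges absolutely. -/
def longRange {d : ℕ} (V : (Fin d → ℂ) → ℂ) (lam : ℝ) (α : Fin d → ℝ) (ρ : ℝ)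
    (u : lp (fun _ : Fin d → ℤ => ℂ) 2) (n : Fin d → ℤ) : ℂ :=
  (∑' k : Fin d → ℤ, fourierCoef V k * u (n - k)) +
    2 * (lam : ℂ) * ((Real.cos (2 * Real.pi * (ρ + pair n α)) : ℝ) : ℂ) * u n

/-- `u ∈ ℓ²(ℤ^d)` is a normalized eigenfunction of the long-range operator with eigenvalue `e`. -/
def IsNormalizedEigenfunction {d : ℕ} (V : (Fin d → ℂ) → ℂ) (lam : ℝ) (α : Fin d → ℝ) (ρ e : ℝ)
    (u : lp (fun _ : Fin d → ℤ => ℂ) 2) : Prop :=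
  ‖u‖ = 1 ∧ ∀ n, longRange V lam α ρ u n = (e : ℂ) * u n

/-- The bound `|u(n)| ≤ C (e^{-γ|n|} + C' e^{-γ|n+ℓ|})` for all `n`, which makes a normalized
eigenfunction `u` a `(γ, ℓ, C, C')`-good one. -/
def IsGood {d : ℕ} (γ : ℝ) (l : Fin d → ℤ) (C C' : ℝ)
    (u : lp (fun _ : Fin d → ℤ => ℂ) 2) : Prop :=
  ∀ n, ‖u n‖ ≤ C * (Real.exp (-γ * len n) + C' * Real.exp (-γ * len (n + l)))

/-- The long-range operator has a `(γ, ℓ, C, C')`-good eigenfunction for the eigenvalue `e`. -/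
def HasGoodEigenfunction {d : ℕ} (V : (Fin d → ℂ) → ℂ) (lam : ℝ) (α : Fin d → ℝ) (ρ e : ℝ)
    (γ : ℝ) (l : Fin d → ℤ) (C C' : ℝ) : Prop :=
  ∃ u, IsNormalizedEigenfunction V lam α ρ e u ∧ IsGood γ l C C' u

end

end QPCocycle

/-!
The eigenfunction is obtained by Aubry duality. If `v` is an eigenvector of the constant matrix `A`
with eigenvalue `e^{iφ}`, then `b(θ) = B(θ) v` is a Bloch wave of the Schrödinger cocycle, and the
Fourier coefficients of its first component, after removal of the factor `e^{πi⟨l + l₀, θ⟩}` that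
makes `b` periodic, solve the dual eigenvalue equation (`longRange_eq_of_bloch`).

*The eigenvalue.* `A` is the exponential of a matrix in `sl(2,ℝ)` of determinant `t² - |ν|²`. If
this is not positive, `A` has a real eigendirection, and the rotation number is rational with
respect to `α` (`rotationNumber_of_real_eigenvector`). So `A` is elliptic, and
`2ρ - ⟨l + l₀, α⟩ = φ/π` modulo `ℤ` (`rotationNumber_of_elliptic`). Both results come from one
computation, `IsDirLog.integral_lift`: conjugation by `B`, which has degree `l + l₀`, lifts to
a continuous logarithm on directions; along the skew product the angles in the conjugated frame grow
by `φ` plus a coboundary, and invariant measures do not see coboundaries. The computation also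
identifies the sign of the conjugated cocycle, which is only given in `PSL(2,ℝ)`; hence the Floquet
exponent of `b` is `ρ - ⟨l + l₀, α⟩/2` itself, and the dual operator is the one with phase `ρ`.

*The two peaks.* Decompose `e^{Y} v` along the eigenvectors `(1, -i)` and `(1, i)` of the rotations.
The factor `R_{⟨l,θ⟩/2}` multiplies them by `e^{±πi⟨l,θ⟩}`, so the first component gives Fourier
coefficients centred at `0`, the second one at `-l`, each decaying by a shift of the contour
(`norm_mFourierCoeff_le`, `exists_component`). The normalization by `e^{-πi⟨l₀,θ⟩}` costs
`e^{πh'|l₀|}` on the strip, which is at most `‖B̃‖`: the growth of an analytic function is bounded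
below by its winding number (`exp_le_of_winding`, `exp_le_stripNorm`). The sign of `φ` is chosen such
that `v` is nearly parallel to `(1, -i)`, and then the second component has relative size
`‖Y‖ + |ν| / (2|φ|)` (`exists_elliptic_data`, `norm_projNeg_exp_le`), where `|φ|/π` is at least the
distance of `2ρ - ⟨l + l₀, α⟩` to the integers.

*The lower bound.* The second row of the cocycle makes the two components of `b` translates of each
other up to a phase, so the first one carries half of the `L²` mass of `b`, while
`|v| ≤ ‖B(θ)‖ |b(θ)|` as `det B = 1` (`le_norm_sq_toLp`, `norm_le_opNorm_mul_of_det_eq_one`).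
With this choice of `φ` the peaks are always at `0` and `-l`.
-/

namespace QPCocycle

open MeasureTheory

/-! ### Continuous logarithms -/

theorem exists_int_eq_const {X : Type*} [TopologicalSpace X] [PreconnectedSpace X] [Nonempty X]
    {g : X → ℝ} (hg : Continuous g) (h : ∀ x, ∃ m : ℤ, g x = m) : ∃ m : ℤ, ∀ x, g x = m := by
  choose m hm using h
  have hm' : Continuous m := by
    rw [Int.isClosedEmbedding_coe_real.isEmbedding.continuous_iff]
    have : ((fun k : ℤ => (k : ℝ)) ∘ m) = g := by ext x; simp [hm]
    exact this ▸ hg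
  obtain ⟨x₀⟩ := ‹Nonempty X›
  exact ⟨m x₀, fun x => by rw [hm x, PreconnectedSpace.constant ‹_› hm' (x := x) (y := x₀)]⟩

/-- Continuous logarithms of `1` that vanish at one point vanish identically. -/
theorem eq_zero_of_exp_eq_one {X : Type*} [TopologicalSpace X] [PreconnectedSpace X]
    {g : X → ℂ} (hg : Continuous g) (h : ∀ x, Complex.exp (g x) = 1) {x₀ : X} (h₀ : g x₀ = 0)
    (x : X) : g x = 0 := by
  have : Nonempty X := ⟨x₀⟩
  have hpi : (2 * Real.pi * Complex.I) ≠ 0 := Complex.two_pi_I_ne_zero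
  obtain ⟨m, hm⟩ := exists_int_eq_const (g := fun x => (g x / (2 * Real.pi * Complex.I)).re)
    (by fun_prop) (fun x => by
      obtain ⟨m, hm⟩ := Complex.exp_eq_one_iff.1 (h x)
      exact ⟨m, by simp only [hm]; rw [mul_div_cancel_right₀ _ hpi]; simp⟩)
  obtain ⟨k, hk⟩ := Complex.exp_eq_one_iff.1 (h x)
  have h1 := hm x
  have h2 := hm x₀
  simp only [hk, h₀] at h1 h2
  rw [mul_div_cancel_right₀ _ hpi] at h1
  have h3 : (k : ℝ) = 0 := by
    rw [← h2] at h1; simpa using h1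
  rw [hk]; norm_cast at h3; simp [h3]

/-- If a homotopy of nowhere vanishing functions ends at a function with a continuous logarithm
`c₁`, then its initial function has a continuous logarithm as well, and that logarithm inherits the
additive quasi-periods of `c₁` under every map which multiplies the homotopy by a constant. -/
theorem exists_log_of_homotopy {X : Type*} [TopologicalSpace X] {Q : unitInterval × X → ℂ}
    (hQ : Continuous Q) (hne : ∀ p, Q p ≠ 0) {c₁ : X → ℂ} (hc₁ : Continuous c₁)
    (h₁ : ∀ x, Complex.exp (c₁ x) = Q (1, x)) :
    ∃ c : X → ℂ, Continuous c ∧ (∀ x, Complex.exp (c x) = Q (0, x)) ∧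
      ∀ (T : X → X) (ε a : ℂ), (∀ s x, Q (s, T x) = ε * Q (s, x)) →
        (∀ x, c₁ (T x) = c₁ x + a) → ∀ x, c (T x) = c x + a := by
  let H : C(unitInterval × X, {z : ℂ // z ≠ 0}) :=
    ⟨fun p => ⟨Q (unitInterval.symm p.1, p.2), hne _⟩, by
      refine Continuous.subtype_mk ?_ _
      exact hQ.comp ((unitInterval.continuous_symm.comp continuous_fst).prodMk continuous_snd)⟩
  have H0 : ∀ x, H (0, x) = (⟨_, (c₁ x).exp_ne_zero⟩ : {z : ℂ // z ≠ 0}) := fun x => by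
    simp [H, h₁]
  let L := Complex.isCoveringMap_exp.liftHomotopy H ⟨c₁, hc₁⟩ H0
  have hL : ∀ s x, Complex.exp (L (s, x)) = Q (unitInterval.symm s, x) := fun s x => by
    have := congr_fun (Complex.isCoveringMap_exp.liftHomotopy_lifts H ⟨c₁, hc₁⟩ H0) (s, x)
    exact congr_arg Subtype.val this
  have hL0 : ∀ x, L (0, x) = c₁ x := fun x =>
    Complex.isCoveringMap_exp.liftHomotopy_zero H ⟨c₁, hc₁⟩ H0 x
  refine ⟨fun x => L (1, x), by fun_prop, fun x => by simp [hL], ?_⟩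
  intro T ε a hT hc x
  have hε : Complex.exp a = ε := by
    have := h₁ (T x)
    rw [hT, hc, Complex.exp_add, h₁, mul_comm] at this
    exact mul_right_cancel₀ (hne _) this
  have := eq_zero_of_exp_eq_one (g := fun s => L (s, T x) - L (s, x) - a) (by fun_prop)
    (fun s => by
      rw [Complex.exp_sub, Complex.exp_sub, hL, hL, hε, hT, div_div, mul_comm]
      exact div_self (mul_ne_zero (hne _) (hε ▸ Complex.exp_ne_zero a)))
    (x₀ := 0) (by simp [hL0, hc]) 1
  linear_combination this

/-! ### Periodic functions and the torus -/

theorem periodic_int_vec {d : ℕ} {E : Type*} {f : (Fin d → ℝ) → E}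
    (hf : ∀ j x, f (x + Pi.single j 1) = f x) (k : Fin d → ℤ) (x : Fin d → ℝ) :
    f (x + fun j => (k j : ℝ)) = f x := by
  let P : AddSubgroup (Fin d → ℝ) :=
    { carrier := {c | ∀ x, f (x + c) = f x}
      zero_mem' := fun x => by simp
      add_mem' := fun {a b} ha hb x => by rw [← add_assoc, hb, ha]
      neg_mem' := fun {a} ha x => by simpa using (ha (x + -a)).symm }
  have : (fun j => (k j : ℝ)) = ∑ j, k j • (Pi.single j 1 : Fin d → ℝ) := by
    ext i; simp [Finset.sum_apply, Pi.single_apply]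
  rw [this]
  exact (P.sum_mem fun j _ => P.zsmul_mem (fun x => hf j x) (k j)) x

theorem coe_unitAddCircle_eq_iff {x y : ℝ} :
    (x : UnitAddCircle) = (y : UnitAddCircle) ↔ ∃ k : ℤ, y = x + k := by
  rw [eq_comm, ← sub_eq_zero, ← AddCircle.coe_sub, AddCircle.coe_eq_zero_iff]
  simp only [zsmul_eq_mul, mul_one]
  exact exists_congr fun k => ⟨fun h => by linarith, fun h => by linarith⟩

theorem toTorus_eq_iff {d : ℕ} {x y : Fin d → ℝ} :
    toTorus x = toTorus y ↔ ∃ k : Fin d → ℤ, y = x + fun j => (k j : ℝ) := by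
  simp only [toTorus, funext_iff, coe_unitAddCircle_eq_iff, Pi.add_apply]
  exact Classical.skolem

theorem isOpenQuotientMap_toTorus (d : ℕ) : IsOpenQuotientMap (toTorus (d := d)) :=
  IsOpenQuotientMap.piMap (f := fun (_ : Fin d) (x : ℝ) => (x : UnitAddCircle))
    fun _ => QuotientAddGroup.isOpenQuotientMap_mk

/-- Continuous functions on `ℝ^d` that are `1`-periodic in every coordinate descend to the torus. -/
theorem exists_descent {d : ℕ} {E : Type*} [TopologicalSpace E] {f : (Fin d → ℝ) → E}
    (hf : Continuous f) (hper : ∀ j x, f (x + Pi.single j 1) = f x) :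
    ∃ g : C(UnitAddTorus (Fin d), E), ∀ x, g (toTorus x) = f x := by
  have hq : Topology.IsQuotientMap (⟨toTorus, (isOpenQuotientMap_toTorus d).continuous⟩ :
    C(Fin d → ℝ, UnitAddTorus (Fin d))) := (isOpenQuotientMap_toTorus d).isQuotientMap
  have hfac : Function.FactorsThrough f toTorus := fun a b hab => by
    obtain ⟨k, rfl⟩ := toTorus_eq_iff.1 hab
    exact (periodic_int_vec hper k a).symm
  exact ⟨hq.lift ⟨f, hf⟩ hfac, fun x => DFunLike.congr_fun (hq.lift_comp ⟨f, hf⟩ hfac) x⟩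

theorem exists_descent_prod {d : ℕ} {E : Type*} [TopologicalSpace E] {f : (Fin d → ℝ) × ℝ → E}
    (hf : Continuous f) (hper : ∀ j x y, f (x + Pi.single j 1, y) = f (x, y))
    (hper' : ∀ x y, f (x, y + 1) = f (x, y)) :
    ∃ g : C(UnitAddTorus (Fin d) × UnitAddCircle, E), ∀ x (y : ℝ), g (toTorus x, y) = f (x, y) := by
  have hπ := (isOpenQuotientMap_toTorus d).prodMap
    (QuotientAddGroup.isOpenQuotientMap_mk (N := AddSubgroup.zmultiples (1 : ℝ)))
  have hq : Topology.IsQuotientMap (⟨_, hπ.continuous⟩ :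
    C((Fin d → ℝ) × ℝ, UnitAddTorus (Fin d) × UnitAddCircle)) := hπ.isQuotientMap
  have hfac : Function.FactorsThrough f (Prod.map toTorus QuotientAddGroup.mk) :=
      fun a b hab => by
    obtain ⟨x, y⟩ := a
    obtain ⟨x', y'⟩ := b
    have h1 : toTorus x = toTorus x' := congr_arg Prod.fst hab
    have h2 : (y : UnitAddCircle) = y' := congr_arg Prod.snd hab
    obtain ⟨k, rfl⟩ := toTorus_eq_iff.1 h1
    obtain ⟨m, rfl⟩ := coe_unitAddCircle_eq_iff.1 h2
    have h3 : Function.Periodic (fun y => f (x, y)) 1 := fun y => hper' x y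
    have h4 := h3.int_mul m y
    simp only [mul_one] at h4
    exact ((periodic_int_vec (f := fun x => f (x, y + m)) (fun j x => hper j x _) k x).trans h4).symm
  exact ⟨hq.lift ⟨f, hf⟩ hfac, fun x y =>
    DFunLike.congr_fun (hq.lift_comp ⟨f, hf⟩ hfac) (x, y)⟩

/-- The Haar probability measure on the circle, as the reference measure of `UnitAddCircle`; it is
the choice that Mathlib makes for Fourier series on `UnitAddTorus`. -/
noncomputable local instance : MeasureSpace UnitAddCircle := ⟨AddCircle.haarAddCircle⟩

local instance : Measure.IsAddHaarMeasure (volume : Measure UnitAddCircle) :=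
  inferInstanceAs (Measure.IsAddHaarMeasure AddCircle.haarAddCircle)

local instance : IsProbabilityMeasure (volume : Measure UnitAddCircle) :=
  inferInstanceAs (IsProbabilityMeasure AddCircle.haarAddCircle)

theorem torus_integral_eq {d : ℕ} {E : Type*} [NormedAddCommGroup E] [NormedSpace ℝ E]
    (f : UnitAddTorus (Fin d) → E) :
    ∫ x, f x = ∫ x in Set.Icc (0 : Fin d → ℝ) 1, f (toTorus x) := by
  have h1 := UnitAddTorus.integral_preimage f (0 : Fin d → ℝ)
  have h2 : {x : Fin d → ℝ | ∀ i, x i ∈ Set.Ioc ((0 : Fin d → ℝ) i) ((0 : Fin d → ℝ) i + 1)} =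
      Set.univ.pi fun i => Set.Ioc ((0 : Fin d → ℝ) i) ((1 : Fin d → ℝ) i) := by
    ext x; simp
  rw [h2] at h1
  exact h1.trans (setIntegral_congr_set Measure.univ_pi_Ioc_ae_eq_Icc)

theorem mFourier_toTorus {d : ℕ} (k : Fin d → ℤ) (x : Fin d → ℝ) :
    UnitAddTorus.mFourier k (toTorus x) = Complex.exp (2 * Real.pi * Complex.I * (pair k x : ℝ)) := by
  simp only [UnitAddTorus.mFourier, toTorus, ContinuousMap.coe_mk, fourier_coe_apply]
  rw [← Complex.exp_sum]
  congr 1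
  simp only [pair, Complex.ofReal_sum, Finset.mul_sum]
  refine Finset.sum_congr rfl fun i _ => ?_
  push_cast; ring

theorem fourierCoef_eq {d : ℕ} {V : (Fin d → ℂ) → ℂ} {g : UnitAddTorus (Fin d) → ℂ}
    (hg : ∀ x, g (toTorus x) = V (toC x)) (k : Fin d → ℤ) :
    fourierCoef V k = UnitAddTorus.mFourierCoeff g k := by
  rw [UnitAddTorus.mFourierCoeff, torus_integral_eq, fourierCoef]
  congr 1; ext x
  rw [mFourier_toTorus, hg, smul_eq_mul]
  congr 2
  simp [pair, Finset.sum_neg_distrib]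

/-! ### Winding numbers and growth on a strip -/

theorem hasDerivAt_integral_of_continuousOn_strip {F F' : ℝ → ℝ → ℝ} {h : ℝ}
    (hF : ∀ y, |y| < h → Continuous (F y))
    (hF' : ContinuousOn (Function.uncurry F') ({y | |y| < h} ×ˢ Set.univ))
    (hd : ∀ y x, |y| < h → HasDerivAt (fun y => F y x) (F' y x) y) {y : ℝ} (hy : |y| < h) :
    HasDerivAt (fun y => ∫ x in (0 : ℝ)..1, F y x) (∫ x in (0 : ℝ)..1, F' y x) y := by
  have hopen : IsOpen {y : ℝ | |y| < h} := isOpen_lt continuous_abs continuous_const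
  obtain ⟨δ, hδ, hball⟩ := Metric.nhds_basis_closedBall.mem_iff.1 (hopen.mem_nhds hy)
  obtain ⟨C, hC⟩ := ((isCompact_closedBall y δ).prod (isCompact_Icc (a := (0 : ℝ)) (b := 1))
    ).exists_bound_of_continuousOn (hF'.mono (Set.prod_mono hball (Set.subset_univ _)))
  have hF'c : ∀ y, |y| < h → Continuous (F' y) := fun y hy =>
    (hF'.comp_continuous (f := fun x => (y, x)) (by fun_prop) fun x => ⟨hy, trivial⟩)
  refine (intervalIntegral.hasDerivAt_integral_of_dominated_loc_of_deriv_le (F := F) (F' := F')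
    (bound := fun _ => C)
    (Metric.closedBall_mem_nhds y hδ) ?_ ((hF y hy).intervalIntegrable _ _)
    ((hF'c y hy).aestronglyMeasurable) ?_ (by simp) ?_).2
  · filter_upwards [hopen.mem_nhds hy] with z hz
    exact (hF z hz).aestronglyMeasurable
  · refine Filter.Eventually.of_forall fun x hx z hz => hC (z, x) ⟨hz, ?_⟩
    rw [Set.uIoc_of_le zero_le_one] at hx
    exact Set.Ioc_subset_Icc_self hx
  · exact Filter.Eventually.of_forall fun x _ z hz => hd z x (hball hz)

theorem sq_norm_re_im (z : ℂ) : ‖z‖ ^ 2 = z.re ^ 2 + z.im ^ 2 := by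
  rw [Complex.sq_norm, Complex.normSq_apply]; ring

section Jensen

variable {f : ℂ → ℂ} {h : ℝ}

theorem isOpen_strip1 (h : ℝ) : IsOpen {z : ℂ | |z.im| < h} :=
  isOpen_lt (by fun_prop) continuous_const

theorem hasDerivAt_vertical {g : ℂ → ℂ} (hg : DifferentiableOn ℂ g {z | |z.im| < h}) {x y : ℝ}
    (hy : |y| < h) :
    HasDerivAt (fun y : ℝ => (g (x + y * Complex.I)).re) (-(deriv g (x + y * Complex.I)).im) y ∧
    HasDerivAt (fun y : ℝ => (g (x + y * Complex.I)).im) ((deriv g (x + y * Complex.I)).re) y := by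
  have h1 : HasDerivAt g (deriv g (x + y * Complex.I)) (x + y * Complex.I) :=
    (hg.differentiableAt ((isOpen_strip1 h).mem_nhds (by simpa using hy))).hasDerivAt
  have h2 : HasDerivAt (fun y : ℝ => (x : ℂ) + y * Complex.I) Complex.I y := by
    simpa using ((Complex.ofRealCLM.hasDerivAt (x := y)).mul_const Complex.I).const_add (x : ℂ)
  have h3 := h1.comp y h2
  refine ⟨?_, ?_⟩
  · simpa [Function.comp_def] using Complex.reCLM.hasFDerivAt.comp_hasDerivAt y h3
  · simpa [Function.comp_def] using Complex.imCLM.hasFDerivAt.comp_hasDerivAt y h3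

theorem hasDerivAt_horizontal {g : ℂ → ℂ} (hg : DifferentiableOn ℂ g {z | |z.im| < h}) {x y : ℝ}
    (hy : |y| < h) :
    HasDerivAt (fun x : ℝ => (g (x + y * Complex.I)).re) ((deriv g (x + y * Complex.I)).re) x ∧
    HasDerivAt (fun x : ℝ => (g (x + y * Complex.I)).im) ((deriv g (x + y * Complex.I)).im) x := by
  have h1 : HasDerivAt g (deriv g (x + y * Complex.I)) (x + y * Complex.I) :=
    (hg.differentiableAt ((isOpen_strip1 h).mem_nhds (by simpa using hy))).hasDerivAt
  have h2 : HasDerivAt (fun x : ℝ => (x : ℂ) + y * Complex.I) 1 x := by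
    simpa using (Complex.ofRealCLM.hasDerivAt (x := x)).add_const (y * Complex.I)
  have h3 := h1.comp x h2
  refine ⟨?_, ?_⟩
  · simpa [Function.comp_def] using Complex.reCLM.hasFDerivAt.comp_hasDerivAt x h3
  · simpa [Function.comp_def] using Complex.imCLM.hasFDerivAt.comp_hasDerivAt x h3

theorem continuousOn_strip_comp {g : ℂ → ℂ} (hg : ContinuousOn g {z | |z.im| < h}) :
    ContinuousOn (fun p : ℝ × ℝ => g (p.2 + p.1 * Complex.I)) ({y | |y| < h} ×ˢ Set.univ) :=
  hg.comp (by fun_prop) fun p hp => by simpa using hp.1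

/-- A continuous logarithm of a differentiable function is differentiable. -/
theorem hasDerivAt_of_exp_eq {c g : ℝ → ℂ} (hc : Continuous c) (hcg : ∀ x, Complex.exp (c x) = g x)
    {x : ℝ} {g' : ℂ} (hg : HasDerivAt g g' x) : HasDerivAt c (g' / g x) x := by
  have hg0 : g x ≠ 0 := hcg x ▸ Complex.exp_ne_zero _
  have h1 : HasDerivAt (fun y => c x + Complex.log (g y / g x)) (g' / g x) x := by
    have h2 := (hg.div_const (g x)).clog_real (by rw [div_self hg0]; exact Complex.one_mem_slitPlane)
    rw [div_self hg0, div_one] at h2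
    exact h2.const_add _
  refine h1.congr_of_eventuallyEq ?_
  have h3 : Filter.Tendsto (fun y => (c y - c x).im) (nhds x) (nhds 0) := by
    have : Continuous fun y => (c y - c x).im := by fun_prop
    simpa using this.tendsto x
  filter_upwards [h3.eventually (Ioo_mem_nhds (neg_lt_zero.2 Real.pi_pos) Real.pi_pos)] with y hy
  rw [← hcg y, ← hcg x, ← Complex.exp_sub, Complex.log_exp hy.1 hy.2.le]
  ring

/-- The growth of an analytic function on a strip is bounded from below by its winding number:
the regularized means `y ↦ ∫₀¹ log (|f (x + iy)|² + ε) / 2 dx` are convex, because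
`log (|f|² + ε)` is subharmonic and `|f|` is periodic, and for `ε → 0` their slope at `0`
tends to `-Im ∫ f' / f`. -/
theorem exp_le_of_winding {K N : ℝ} {σ : ℂ} (hh : 0 < h)
    (hf : DifferentiableOn ℂ f {z | |z.im| < h}) (hσ : ‖σ‖ = 1)
    (hper : ∀ z : ℂ, |z.im| < h → f (z + 1) = σ * f z)
    (hK : ∀ z : ℂ, |z.im| < h → ‖f z‖ ≤ K) (h1 : ∀ x : ℝ, 1 ≤ ‖f x‖)
    {c : ℝ → ℂ} (hc : Continuous c) (hcf : ∀ x : ℝ, Complex.exp (c x) = f x)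
    (hcN : (c 1 - c 0).im = -N) : Real.exp (N * h) ≤ K := by
  set S : Set ℂ := {z | |z.im| < h} with hS
  have hSo : IsOpen S := isOpen_strip1 h
  have hf1 : DifferentiableOn ℂ (deriv f) S := hf.deriv hSo
  have hf2 : ContinuousOn (deriv (deriv f)) S := (hf1.deriv hSo).continuousOn
  have hper1 : ∀ z : ℂ, |z.im| < h → deriv f (z + 1) = σ * deriv f z := fun z hz => by
    rw [← deriv_comp_add_const, ← deriv_const_mul_field]
    refine Filter.EventuallyEq.deriv_eq ?_
    filter_upwards [hSo.mem_nhds hz] with w hw using hper w hw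
  -- the real and imaginary parts of `f`, `f'`, `f''` along the strip
  let u := fun y x : ℝ => (f (x + y * Complex.I)).re
  let v := fun y x : ℝ => (f (x + y * Complex.I)).im
  let p := fun y x : ℝ => (deriv f (x + y * Complex.I)).re
  let q := fun y x : ℝ => (deriv f (x + y * Complex.I)).im
  let r := fun y x : ℝ => (deriv (deriv f) (x + y * Complex.I)).re
  let s := fun y x : ℝ => (deriv (deriv f) (x + y * Complex.I)).im
  have cu : ContinuousOn (Function.uncurry u) ({y | |y| < h} ×ˢ Set.univ) :=
    Complex.continuous_re.comp_continuousOn (continuousOn_strip_comp hf.continuousOn)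
  have cv : ContinuousOn (Function.uncurry v) ({y | |y| < h} ×ˢ Set.univ) :=
    Complex.continuous_im.comp_continuousOn (continuousOn_strip_comp hf.continuousOn)
  have cp : ContinuousOn (Function.uncurry p) ({y | |y| < h} ×ˢ Set.univ) :=
    Complex.continuous_re.comp_continuousOn (continuousOn_strip_comp hf1.continuousOn)
  have cq : ContinuousOn (Function.uncurry q) ({y | |y| < h} ×ˢ Set.univ) :=
    Complex.continuous_im.comp_continuousOn (continuousOn_strip_comp hf1.continuousOn)
  have cr : ContinuousOn (Function.uncurry r) ({y | |y| < h} ×ˢ Set.univ) :=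
    Complex.continuous_re.comp_continuousOn (continuousOn_strip_comp hf2)
  have cs : ContinuousOn (Function.uncurry s) ({y | |y| < h} ×ˢ Set.univ) :=
    Complex.continuous_im.comp_continuousOn (continuousOn_strip_comp hf2)
  have slice : ∀ {g : ℝ → ℝ → ℝ}, ContinuousOn (Function.uncurry g) ({y | |y| < h} ×ˢ Set.univ) →
      ∀ y, |y| < h → Continuous (g y) := fun hg y hy =>
    hg.comp_continuous (f := fun x => (y, x)) (by fun_prop) fun x => ⟨hy, trivial⟩
  have key : ∀ ε : ℝ, 0 < ε → ∀ y, 0 < y → y < h →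
      y * (∫ x in (0 : ℝ)..1, (-(u 0 x * q 0 x) + v 0 x * p 0 x) / (u 0 x ^ 2 + v 0 x ^ 2 + ε)) ≤
        Real.log (K ^ 2 + ε) / 2 := by
    intro ε hε y hy0 hyh
    let W := fun y x : ℝ => u y x ^ 2 + v y x ^ 2 + ε
    have hW : ∀ y x, 0 < W y x := fun y x => by positivity
    have hW0 : ∀ y x, W y x ≠ 0 := fun y x => (hW y x).ne'
    let U := fun y x : ℝ => Real.log (W y x) / 2
    let D := fun y x : ℝ => (-(u y x * q y x) + v y x * p y x) / W y x
    let D2 := fun y x : ℝ => ((q y x ^ 2 - u y x * r y x + p y x ^ 2 - v y x * s y x) * W y x -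
      (-(u y x * q y x) + v y x * p y x) * (2 * (-(u y x * q y x) + v y x * p y x))) / W y x ^ 2
    let X := fun y x : ℝ => (u y x * p y x + v y x * q y x) / W y x
    let X2 := fun y x : ℝ => ((p y x ^ 2 + u y x * r y x + q y x ^ 2 + v y x * s y x) * W y x -
      (u y x * p y x + v y x * q y x) * (2 * (u y x * p y x + v y x * q y x))) / W y x ^ 2
    have cW : ContinuousOn (Function.uncurry W) ({y | |y| < h} ×ˢ Set.univ) :=
      ((cu.pow 2).add (cv.pow 2)).add continuousOn_const
    have cU : ContinuousOn (Function.uncurry U) ({y | |y| < h} ×ˢ Set.univ) :=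
      (cW.log fun z _ => hW0 z.1 z.2).div_const 2
    have cD : ContinuousOn (Function.uncurry D) ({y | |y| < h} ×ˢ Set.univ) :=
      ((cu.mul cq).neg.add (cv.mul cp)).div cW fun z _ => hW0 z.1 z.2
    have cD2 : ContinuousOn (Function.uncurry D2) ({y | |y| < h} ×ˢ Set.univ) :=
      (((((cq.pow 2).sub (cu.mul cr)).add (cp.pow 2)).sub (cv.mul cs)).mul cW |>.sub
        (((cu.mul cq).neg.add (cv.mul cp)).mul
          (continuousOn_const.mul ((cu.mul cq).neg.add (cv.mul cp))))).div (cW.pow 2)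
        fun z _ => pow_ne_zero 2 (hW0 z.1 z.2)
    have cX2 : ContinuousOn (Function.uncurry X2) ({y | |y| < h} ×ˢ Set.univ) :=
      (((((cp.pow 2).add (cu.mul cr)).add (cq.pow 2)).add (cv.mul cs)).mul cW |>.sub
        (((cu.mul cp).add (cv.mul cq)).mul
          (continuousOn_const.mul ((cu.mul cp).add (cv.mul cq))))).div (cW.pow 2)
        fun z _ => pow_ne_zero 2 (hW0 z.1 z.2)
    have dU : ∀ y x, |y| < h → HasDerivAt (fun y => U y x) (D y x) y := fun y x hy => by
      obtain ⟨du, dv⟩ := hasDerivAt_vertical hf (x := x) hy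
      convert! ((((du.pow 2).add (dv.pow 2)).add_const ε).log (hW0 y x)).div_const 2 using 1
      simp only [D, W, u, v, p, q]
      simp; ring
    have dD : ∀ y x, |y| < h → HasDerivAt (fun y => D y x) (D2 y x) y := fun y x hy => by
      obtain ⟨du, dv⟩ := hasDerivAt_vertical hf (x := x) hy
      obtain ⟨dp, dq⟩ := hasDerivAt_vertical hf1 (x := x) hy
      convert! ((du.mul dq).neg.add (dv.mul dp)).div (((du.pow 2).add (dv.pow 2)).add_const ε)
        (hW0 y x) using 1
      simp only [D2, W, u, v, p, q, r, s]
      simp; ring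
    have dX : ∀ y x, |y| < h → HasDerivAt (X y) (X2 y x) x := fun y x hy => by
      obtain ⟨du, dv⟩ := hasDerivAt_horizontal hf (x := x) hy
      obtain ⟨dp, dq⟩ := hasDerivAt_horizontal hf1 (x := x) hy
      convert! ((du.mul dp).add (dv.mul dq)).div (((du.pow 2).add (dv.pow 2)).add_const ε)
        (hW0 y x) using 1
      simp only [X2, W, u, v, p, q, r, s]
      simp; ring
    have hX01 : ∀ y, |y| < h → X y 1 = X y 0 := fun y hy => by
      have e : ((1 : ℝ) : ℂ) + y * Complex.I = ((0 : ℝ) : ℂ) + y * Complex.I + 1 := by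
        push_cast; ring
      have hz : |(((0 : ℝ) : ℂ) + y * Complex.I).im| < h := by simpa using hy
      have e0 := hper _ hz
      have e1 := hper1 _ hz
      have hn : σ.re ^ 2 + σ.im ^ 2 = 1 := by
        rw [← sq_norm_re_im, hσ]; norm_num
      simp only [X, W, u, v, p, q, e, e0, e1, Complex.mul_re, Complex.mul_im]
      congr 1
      · linear_combination (((f (((0 : ℝ) : ℂ) + y * Complex.I)).re *
          (deriv f (((0 : ℝ) : ℂ) + y * Complex.I)).re) + (f (((0 : ℝ) : ℂ) + y * Complex.I)).im *
          (deriv f (((0 : ℝ) : ℂ) + y * Complex.I)).im) * hn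
      · linear_combination ((f (((0 : ℝ) : ℂ) + y * Complex.I)).re ^ 2 +
          (f (((0 : ℝ) : ℂ) + y * Complex.I)).im ^ 2) * hn
    have hpos : ∀ y, |y| < h → 0 ≤ ∫ x in (0 : ℝ)..1, D2 y x := fun y hy => by
      have h0 : ∫ x in (0 : ℝ)..1, X2 y x = 0 := by
        rw [intervalIntegral.integral_eq_sub_of_hasDerivAt (fun x _ => dX y x hy)
          ((slice cX2 y hy).intervalIntegrable _ _), hX01 y hy, sub_self]
      have h2 : 0 ≤ ∫ x in (0 : ℝ)..1, (D2 y x + X2 y x) := by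
        refine intervalIntegral.integral_nonneg zero_le_one fun x _ => ?_
        have : D2 y x + X2 y x = 2 * ε * (p y x ^ 2 + q y x ^ 2) / W y x ^ 2 := by
          simp only [D2, X2, W]; rw [← add_div]; congr 1; ring
        rw [this]; positivity
      rwa [intervalIntegral.integral_add ((slice cD2 y hy).intervalIntegrable _ _)
        ((slice cX2 y hy).intervalIntegrable _ _), h0, add_zero] at h2
    have hφ : ∀ y, |y| < h → HasDerivAt (fun y => ∫ x in (0 : ℝ)..1, U y x)
        (∫ x in (0 : ℝ)..1, D y x) y := fun y hy =>
      hasDerivAt_integral_of_continuousOn_strip (slice cU) cD dU hy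
    have hφ' : ∀ y, |y| < h → HasDerivAt (fun y => ∫ x in (0 : ℝ)..1, D y x)
        (∫ x in (0 : ℝ)..1, D2 y x) y := fun y hy =>
      hasDerivAt_integral_of_continuousOn_strip (slice cD) cD2 dD hy
    have hmem : ∀ {y}, y ∈ interior (Set.Ioo (-h) h) → |y| < h := fun hy =>
      abs_lt.2 (Set.mem_Ioo.1 (interior_subset hy))
    have hconv : ConvexOn ℝ (Set.Ioo (-h) h) fun y => ∫ x in (0 : ℝ)..1, U y x :=
      convexOn_of_hasDerivWithinAt2_nonneg (convex_Ioo _ _)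
        (fun y hy => (hφ y (abs_lt.2 hy)).continuousAt.continuousWithinAt)
        (fun y hy => (hφ y (hmem hy)).hasDerivWithinAt)
        (fun y hy => (hφ' y (hmem hy)).hasDerivWithinAt)
        (fun y hy => hpos y (hmem hy))
    have hslope := hconv.le_slope_of_hasDerivAt (x := 0) (y := y) ⟨by linarith, hh⟩
      ⟨by linarith, hyh⟩ hy0 (hφ 0 (by simpa using hh))
    have hyh' : |y| < h := by rwa [abs_of_pos hy0]
    rw [slope_def_field, sub_zero, le_div_iff₀ hy0] at hslope
    have hU0 : 0 ≤ ∫ x in (0 : ℝ)..1, U 0 x := by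
      refine intervalIntegral.integral_nonneg zero_le_one fun x _ => ?_
      have := h1 x
      have h3 : 1 ≤ W 0 x := by
        have e : u 0 x ^ 2 + v 0 x ^ 2 = ‖f x‖ ^ 2 := by
          simp only [u, v]; rw [sq_norm_re_im]; simp
        simp only [W, e]; nlinarith
      exact div_nonneg (Real.log_nonneg h3) (by norm_num)
    have hUy : ∫ x in (0 : ℝ)..1, U y x ≤ Real.log (K ^ 2 + ε) / 2 := by
      have : ∫ x in (0 : ℝ)..1, U y x ≤ ∫ x in (0 : ℝ)..1, Real.log (K ^ 2 + ε) / 2 := by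
        refine intervalIntegral.integral_mono_on zero_le_one
          ((slice cU y hyh').intervalIntegrable _ _) (by simp) fun x _ => ?_
        have hk := hK (x + y * Complex.I) (by simpa using hyh')
        have e : u y x ^ 2 + v y x ^ 2 = ‖f (x + y * Complex.I)‖ ^ 2 := by
          simp only [u, v]; rw [sq_norm_re_im]
        simp only [U, W]
        gcongr
        rw [e]; gcongr
      simpa using this
    calc _ = (∫ x in (0 : ℝ)..1, D 0 x) * y := mul_comm _ _
      _ ≤ _ := by linarith
  have hq : ∀ x, u 0 x ^ 2 + v 0 x ^ 2 = ‖f x‖ ^ 2 := fun x => by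
    simp only [u, v]; rw [sq_norm_re_im]; simp
  have hq1 : ∀ x, 1 ≤ u 0 x ^ 2 + v 0 x ^ 2 := fun x => by
    rw [hq]; nlinarith [h1 x]
  let D0 := fun x : ℝ => (-(u 0 x * q 0 x) + v 0 x * p 0 x) / (u 0 x ^ 2 + v 0 x ^ 2)
  have h00 : |(0 : ℝ)| < h := by simpa using hh
  have cD0 : Continuous D0 := by
    have c1 := slice cu 0 h00
    have c2 := slice cv 0 h00
    have c3 := slice cp 0 h00
    have c4 := slice cq 0 h00
    exact (by fun_prop : Continuous fun x : ℝ => -(u 0 x * q 0 x) + v 0 x * p 0 x).div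
      (by fun_prop) fun x => by linarith [hq1 x]
  have hD0 : ∫ x in (0 : ℝ)..1, D0 x = N := by
    have hd : ∀ x : ℝ, HasDerivAt (fun x => -(c x).im) (D0 x) x := fun x => by
      have hfx : HasDerivAt (fun x : ℝ => f x) (deriv f x) x :=
        ((hf.differentiableAt (hSo.mem_nhds (by simpa [hS] using hh))).hasDerivAt).comp_ofReal
      have h3 := (Complex.imCLM.hasFDerivAt.comp_hasDerivAt x
        (hasDerivAt_of_exp_eq hc hcf hfx)).neg
      convert! h3 using 1
      simp only [D0, hq, u, v, p, q, Complex.imCLM_apply, Complex.div_im, ← Complex.sq_norm]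
      simp
      ring
    rw [intervalIntegral.integral_eq_sub_of_hasDerivAt (fun x _ => hd x)
      (cD0.intervalIntegrable _ _)]
    rw [Complex.sub_im] at hcN; linarith
  obtain ⟨C, hC⟩ := (isCompact_Icc (a := (0 : ℝ)) (b := 1)).exists_bound_of_continuousOn
    cD0.continuousOn
  have hK1 : 1 ≤ K := (h1 0).trans (hK _ (by simpa using hh))
  have hy : ∀ y, 0 < y → y < h → y * N ≤ Real.log K := fun y hy0 hyh => by
    have hε : ∀ ε : ℝ, 0 < ε → y * (N - ε * C) ≤ Real.log (K ^ 2 + ε) / 2 := fun ε hε => by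
      refine le_trans (mul_le_mul_of_nonneg_left ?_ hy0.le) (key ε hε y hy0 hyh)
      have : ∫ x in (0 : ℝ)..1, (D0 x - ε * C) = N - ε * C := by
        rw [intervalIntegral.integral_sub (cD0.intervalIntegrable _ _) (by simp), hD0]; simp
      rw [← this]
      refine intervalIntegral.integral_mono_on zero_le_one
        ((cD0.sub continuous_const).intervalIntegrable _ _) ?_ fun x hx => ?_
      · have c1 := slice cu 0 h00
        have c2 := slice cv 0 h00
        have c3 := slice cp 0 h00
        have c4 := slice cq 0 h00
        exact ((by fun_prop : Continuous fun x : ℝ => -(u 0 x * q 0 x) + v 0 x * p 0 x).div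
          (by fun_prop) fun x => by linarith [hq1 x]).intervalIntegrable _ _
      · have hCx := hC x hx
        rw [Real.norm_eq_abs] at hCx
        have hw := hq1 x
        set w := u 0 x ^ 2 + v 0 x ^ 2 with hwdef
        have e : (-(u 0 x * q 0 x) + v 0 x * p 0 x) / (w + ε) = D0 x - D0 x * (ε / (w + ε)) := by
          have : D0 x = (-(u 0 x * q 0 x) + v 0 x * p 0 x) / w := rfl
          rw [this]
          field_simp
          ring
        rw [e]
        have h5 : ε / (w + ε) ≤ ε := div_le_self hε.le (by linarith)
        have h6 : 0 ≤ ε / (w + ε) := by positivity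
        have h7 : D0 x * (ε / (w + ε)) ≤ |D0 x| * (ε / (w + ε)) :=
          mul_le_mul_of_nonneg_right (le_abs_self _) h6
        have h8 : |D0 x| * (ε / (w + ε)) ≤ C * ε := by gcongr; exact (abs_nonneg _).trans hCx
        linarith
    have t1 : Filter.Tendsto (fun ε : ℝ => y * (N - ε * C)) (nhdsWithin 0 (Set.Ioi 0))
        (nhds (y * N)) := by
      have : Continuous fun ε : ℝ => y * (N - ε * C) := by fun_prop
      simpa using (this.tendsto 0).mono_left nhdsWithin_le_nhds
    have t2 : Filter.Tendsto (fun ε : ℝ => Real.log (K ^ 2 + ε) / 2) (nhdsWithin 0 (Set.Ioi 0))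
        (nhds (Real.log K)) := by
      have : ContinuousAt (fun ε : ℝ => Real.log (K ^ 2 + ε) / 2) 0 :=
        ((continuousAt_const.add continuousAt_id).log (by simp; linarith)).div_const 2
      have h9 := this.tendsto.mono_left (nhdsWithin_le_nhds (s := Set.Ioi 0))
      simpa [Real.log_pow] using h9
    exact le_of_tendsto_of_tendsto t1 t2 (by filter_upwards [self_mem_nhdsWithin] with ε h using hε ε h)
  rw [← Real.le_log_iff_exp_le (by linarith)]
  have t : Filter.Tendsto (fun y : ℝ => y * N) (nhdsWithin h (Set.Iio h)) (nhds (h * N)) :=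
    ((continuous_id.mul continuous_const).tendsto h).mono_left nhdsWithin_le_nhds
  rw [mul_comm]
  refine le_of_tendsto t ?_
  filter_upwards [Ioo_mem_nhdsLT hh] with y h using hy y h.1 h.2

end Jensen

/-! ### Fourier coefficients of analytic functions -/

theorem toTorus_add {d : ℕ} (x y : Fin d → ℝ) : toTorus (x + y) = toTorus x + toTorus y := rfl

theorem toC_add {d : ℕ} (x y : Fin d → ℝ) : toC (x + y) = toC x + toC y := by
  ext j; simp [toC]

theorem toC_single {d : ℕ} (j : Fin d) : toC (Pi.single j 1) = Pi.single j 1 := by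
  ext i; by_cases h : i = j
  · subst h; simp [toC]
  · simp [toC, h]

theorem toC_mem_strip {d : ℕ} {h : ℝ} (hh : 0 < h) (x : Fin d → ℝ) : toC x ∈ strip d h :=
  fun j => by simpa [toC] using hh

theorem add_toC_mem_strip {d : ℕ} {h : ℝ} {z : Fin d → ℂ} (hz : z ∈ strip d h) (x : Fin d → ℝ) :
    z + toC x ∈ strip d h := fun j => by simpa [toC] using hz j

/-- The point `x + ζ s` of the complex line through `x` with direction `s`. -/
def lineC {d : ℕ} (x : Fin d → ℝ) (s : Fin d → ℤ) (ζ : ℂ) : Fin d → ℂ :=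
  fun j => (x j : ℂ) + ζ * (s j : ℂ)

theorem lineC_mem_strip {d : ℕ} {h : ℝ} (x : Fin d → ℝ) {s : Fin d → ℤ}
    (hs : ∀ j, |(s j : ℝ)| ≤ 1) {ζ : ℂ} (hζ : |ζ.im| < h) : lineC x s ζ ∈ strip d h := fun j => by
  have : (lineC x s ζ j).im = ζ.im * s j := by simp [lineC]
  rw [this, abs_mul]
  exact (mul_le_of_le_one_right (abs_nonneg _) (hs j)).trans_lt hζ

theorem lineC_add_one {d : ℕ} (x : Fin d → ℝ) (s : Fin d → ℤ) (ζ : ℂ) :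
    lineC x s (ζ + 1) = lineC x s ζ + toC (fun j => (s j : ℝ)) := by
  ext j; simp [lineC, toC]; ring

theorem lineC_ofReal {d : ℕ} (x : Fin d → ℝ) (s : Fin d → ℤ) (τ : ℝ) :
    lineC x s τ = toC (x + τ • fun j => (s j : ℝ)) := by
  ext j; simp [lineC, toC]

theorem differentiable_lineC {d : ℕ} (x : Fin d → ℝ) (s : Fin d → ℤ) :
    Differentiable ℂ (lineC x s) := by
  unfold lineC; fun_prop

theorem pairC_lineC {d : ℕ} (k : Fin d → ℤ) (x : Fin d → ℝ) (s : Fin d → ℤ) (ζ : ℂ) :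
    pairC k (lineC x s ζ) = (pair k x : ℝ) + ζ * ((∑ j, k j * s j : ℤ) : ℂ) := by
  simp only [pairC, lineC, pair]
  push_cast
  rw [Finset.mul_sum, ← Finset.sum_add_distrib]
  exact Finset.sum_congr rfl fun j _ => by ring

theorem periodic_strip_int_vec {d : ℕ} {h : ℝ} {E : Type*} {G : (Fin d → ℂ) → E}
    (hper : ∀ j, ∀ z ∈ strip d h, G (z + Pi.single j 1) = G z) {z : Fin d → ℂ} (hz : z ∈ strip d h)
    (k : Fin d → ℤ) : G (z + toC (fun j => (k j : ℝ))) = G z := by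
  have := periodic_int_vec (f := fun x => G (z + toC x)) (fun j x => by
    have := hper j _ (add_toC_mem_strip hz x)
    rwa [add_assoc, ← toC_single, ← toC_add] at this) k 0
  have h0 : toC (0 : Fin d → ℝ) = 0 := by ext j; simp [toC]
  simpa [h0] using this

/-- The direction in which a Fourier mode `e^{-2πi⟨k,·⟩}` decays the fastest. -/
def signVec {d : ℕ} (k : Fin d → ℤ) : Fin d → ℤ := fun j => -(k j).sign

theorem abs_signVec_le {d : ℕ} (k : Fin d → ℤ) (j : Fin d) : |(signVec k j : ℝ)| ≤ 1 := by
  rcases lt_trichotomy (k j) 0 with h | h | h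
  · simp [signVec, Int.sign_eq_neg_one_of_neg h]
  · simp [signVec, h]
  · simp [signVec, Int.sign_eq_one_of_pos h]

theorem sum_mul_signVec {d : ℕ} (k : Fin d → ℤ) :
    ((∑ j, k j * signVec k j : ℤ) : ℝ) = -len k := by
  simp only [signVec, len]
  push_cast
  rw [← Finset.sum_neg_distrib]
  refine Finset.sum_congr rfl fun j _ => ?_
  have := Int.mul_sign_self (k j)
  rw [mul_neg]
  congr 1
  rw [← Int.cast_abs, Int.abs_eq_natAbs]
  exact_mod_cast this

theorem integral_shift_strip {γ : ℂ → ℂ} {h y : ℝ}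
    (hγ : DifferentiableOn ℂ γ {z | |z.im| < h})
    (hper : ∀ z : ℂ, |z.im| < h → γ (z + 1) = γ z) (hy : |y| < h) :
    ∫ x in (0 : ℝ)..1, γ x = ∫ x in (0 : ℝ)..1, γ (x + y * Complex.I) := by
  have := Complex.integral_boundary_rect_eq_zero_of_differentiableOn γ 0 (1 + y * Complex.I)
    (hγ.mono fun z hz => by
      have hz2 := hz.2
      simp only [Complex.zero_im, Complex.add_im, Complex.one_im, Complex.mul_im, zero_add,
        Complex.ofReal_re, Complex.I_im, mul_one, Complex.ofReal_im, Complex.I_re, mul_zero,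
        add_zero, Set.mem_preimage] at hz2
      have : |z.im| ≤ |y| := by
        have := Set.abs_sub_left_of_mem_uIcc hz2
        simpa using this
      exact this.trans_lt hy)
  simp only [Complex.zero_re, Complex.zero_im, Complex.add_re, Complex.one_re, Complex.mul_re,
    Complex.ofReal_re, Complex.I_re, mul_zero, Complex.ofReal_im, Complex.I_im, mul_one, sub_self,
    add_zero, Complex.add_im, Complex.one_im, Complex.mul_im, zero_add, Complex.ofReal_zero,
    zero_mul, Complex.ofReal_one] at this
  have e : ∫ t in (0 : ℝ)..y, γ (1 + t * Complex.I) = ∫ t in (0 : ℝ)..y, γ (t * Complex.I) := by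
    refine intervalIntegral.integral_congr fun t ht => ?_
    have ht' : |t| ≤ |y| := by simpa using Set.abs_sub_left_of_mem_uIcc ht
    rw [add_comm]
    exact hper _ (by simpa using ht'.trans_lt hy)
  rw [e] at this
  linear_combination this

/-- The integral over the torus as an average of integrals over closed lines. -/
theorem integral_eq_integral_lines {d : ℕ} {P : UnitAddTorus (Fin d) → ℂ} (hP : Continuous P)
    (s : Fin d → ℝ) :
    ∫ x, P x = ∫ x, ∫ τ in (0 : ℝ)..1, P (x + toTorus (τ • s)) := by
  have hc : Continuous (toTorus (d := d)) := (isOpenQuotientMap_toTorus d).continuous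
  have hcont : Continuous fun p : UnitAddTorus (Fin d) × ℝ => P (p.1 + toTorus (p.2 • s)) := by
    fun_prop
  simp_rw [intervalIntegral.integral_of_le zero_le_one]
  rw [integral_integral_swap]
  · simp_rw [integral_add_right_eq_self (μ := (volume : Measure (UnitAddTorus (Fin d)))) P]
    simp
  · obtain ⟨C, hC⟩ := isCompact_univ.exists_bound_of_continuousOn hP.continuousOn
    refine Integrable.of_bound (C := C) hcont.aestronglyMeasurable ?_
    exact Filter.Eventually.of_forall fun p => hC _ trivial

/-- Exponential decay of the Fourier coefficients of a bounded analytic function on a strip. The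
contour of integration is shifted to its boundary along the lines of direction `signVec k`, over
which the torus integral is averaged. -/
theorem norm_mFourierCoeff_le {d : ℕ} {h M : ℝ} (hh : 0 < h) {G : (Fin d → ℂ) → ℂ}
    (hG : DifferentiableOn ℂ G (strip d h))
    (hper : ∀ j, ∀ z ∈ strip d h, G (z + Pi.single j 1) = G z)
    (hM : ∀ z ∈ strip d h, ‖G z‖ ≤ M) {g : UnitAddTorus (Fin d) → ℂ} (hg : Continuous g)
    (hgG : ∀ x, g (toTorus x) = G (toC x)) (k : Fin d → ℤ) :
    ‖UnitAddTorus.mFourierCoeff g k‖ ≤ M * Real.exp (-(2 * Real.pi * h) * len k) := by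
  set s := signVec k with hs
  have hM0 : 0 ≤ M := (norm_nonneg _).trans (hM _ (toC_mem_strip hh 0))
  have hbd : ∀ y, 0 < y → y < h →
      ‖UnitAddTorus.mFourierCoeff g k‖ ≤ M * Real.exp (-(2 * Real.pi * y) * len k) := by
    intro y hy0 hyh
    rw [UnitAddTorus.mFourierCoeff, integral_eq_integral_lines (by fun_prop) fun j => (s j : ℝ)]
    refine (norm_integral_le_of_norm_le_const
      (C := M * Real.exp (-(2 * Real.pi * y) * len k)) (Filter.Eventually.of_forall fun x => ?_)).trans
      (by simp)
    obtain ⟨x, rfl⟩ := (isOpenQuotientMap_toTorus d).surjective x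
    let γ : ℂ → ℂ := fun ζ =>
      Complex.exp (-(2 * Real.pi * Complex.I * pairC k (lineC x s ζ))) * G (lineC x s ζ)
    have hγ : DifferentiableOn ℂ γ {z | |z.im| < h} := by
      refine DifferentiableOn.mul ?_ (hG.comp (differentiable_lineC x s).differentiableOn
        fun ζ hζ => lineC_mem_strip x (abs_signVec_le k) hζ)
      simp only [pairC_lineC]
      fun_prop
    have hγper : ∀ z : ℂ, |z.im| < h → γ (z + 1) = γ z := fun z hz => by
      simp only [γ]
      rw [lineC_add_one, periodic_strip_int_vec hper
        (lineC_mem_strip x (abs_signVec_le k) hz), ← lineC_add_one]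
      congr 1
      rw [pairC_lineC, pairC_lineC, Complex.exp_eq_exp_iff_exists_int]
      exact ⟨-(∑ j, k j * s j), by push_cast; ring⟩
    have e : ∀ τ : ℝ, UnitAddTorus.mFourier (-k) (toTorus x + toTorus (τ • fun j => (s j : ℝ))) •
        g (toTorus x + toTorus (τ • fun j => (s j : ℝ))) = γ τ := fun τ => by
      rw [← toTorus_add, mFourier_toTorus, hgG, ← lineC_ofReal, smul_eq_mul]
      simp only [γ]
      congr 2
      rw [lineC_ofReal]
      simp [pair, pairC, toC, Finset.sum_neg_distrib]
    simp_rw [e]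
    rw [integral_shift_strip hγ hγper (y := y) (by rwa [abs_of_pos hy0])]
    refine (intervalIntegral.norm_integral_le_of_norm_le_const
      (C := M * Real.exp (-(2 * Real.pi * y) * len k)) fun τ _ => ?_).trans (by simp)
    simp only [γ]
    rw [norm_mul, mul_comm]
    have him : |((τ : ℂ) + y * Complex.I).im| < h := by simpa [abs_of_pos hy0] using hyh
    refine mul_le_mul (hM _ (lineC_mem_strip x (abs_signVec_le k) him)) ?_ (norm_nonneg _) hM0
    rw [Complex.norm_exp, pairC_lineC]
    have h1 := sum_mul_signVec k
    rw [← hs] at h1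
    have h2 : ((∑ j, k j * s j : ℤ) : ℂ) = ((-len k : ℝ) : ℂ) := by rw [← h1]; simp
    rw [h2]
    apply le_of_eq
    congr 1
    simp [Complex.mul_re, Complex.mul_im]
    ring
  have t : Filter.Tendsto (fun y : ℝ => M * Real.exp (-(2 * Real.pi * y) * len k))
      (nhdsWithin h (Set.Iio h)) (nhds (M * Real.exp (-(2 * Real.pi * h) * len k))) := by
    have : Continuous fun y : ℝ => M * Real.exp (-(2 * Real.pi * y) * len k) := by fun_prop
    exact (this.tendsto h).mono_left nhdsWithin_le_nhds
  refine ge_of_tendsto t ?_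
  filter_upwards [Ioo_mem_nhdsLT hh] with y h using hbd y h.1 h.2

open scoped Matrix.Norms.L2Operator

/-! ### Matrices and the coefficient that carries the degree -/

theorem opNorm_eq_norm (B : Matrix (Fin 2) (Fin 2) ℂ) : opNorm B = ‖B‖ := rfl

theorem norm_mulVec_le (B : Matrix (Fin 2) (Fin 2) ℂ) (v : Fin 2 → ℂ) :
    ‖WithLp.toLp 2 (B.mulVec v)‖ ≤ opNorm B * ‖WithLp.toLp 2 v‖ := by
  rw [← Matrix.toEuclideanCLM_toLp]
  exact ContinuousLinearMap.le_opNorm _ _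

theorem norm_sq_toLp (v : Fin 2 → ℂ) : ‖WithLp.toLp 2 v‖ ^ 2 = ‖v 0‖ ^ 2 + ‖v 1‖ ^ 2 := by
  rw [EuclideanSpace.norm_sq_eq]; simp

theorem opNorm_le_stripNorm {d : ℕ} {h : ℝ} {F : (Fin d → ℂ) → Matrix (Fin 2) (Fin 2) ℂ}
    (hF : BddAbove ((fun z => opNorm (F z)) '' strip d h)) {z : Fin d → ℂ} (hz : z ∈ strip d h) :
    opNorm (F z) ≤ stripNorm h F := le_csSup hF ⟨z, hz, rfl⟩

/-- The complex linear part of a real `2 × 2` matrix acting on `ℝ² = ℂ`, extended complex linearly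
to complex matrices. -/
noncomputable def linCoef (B : Matrix (Fin 2) (Fin 2) ℂ) : ℂ :=
  (B 0 0 + B 1 1 + Complex.I * (B 1 0 - B 0 1)) / 2

theorem linCoef_smul (a : ℂ) (B : Matrix (Fin 2) (Fin 2) ℂ) : linCoef (a • B) = a * linCoef B := by
  simp [linCoef]; ring

theorem linCoef_rot (z : ℂ) : linCoef (rot z) = Complex.exp (2 * Real.pi * z * Complex.I) := by
  rw [Complex.exp_mul_I]; simp [linCoef, rot]; ring

theorem norm_linCoef_le (B : Matrix (Fin 2) (Fin 2) ℂ) : ‖linCoef B‖ ≤ opNorm B := by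
  have h1 := norm_inner_le_norm (𝕜 := ℂ) (WithLp.toLp 2 ![1, -Complex.I])
    (WithLp.toLp 2 (B.mulVec ![1, -Complex.I]))
  have h2 := norm_mulVec_le B ![1, -Complex.I]
  have h3 : ‖WithLp.toLp 2 ![1, -Complex.I]‖ ^ 2 = 2 := by rw [norm_sq_toLp]; norm_num
  have h4 : inner ℂ (WithLp.toLp 2 ![1, -Complex.I])
    (WithLp.toLp 2 (B.mulVec ![1, -Complex.I])) = 2 * linCoef B := by
    simp [PiLp.inner_apply, Fin.sum_univ_two, linCoef]
    ring_nf
    simp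
  rw [h4, norm_mul] at h1
  simp only [Complex.norm_ofNat] at h1
  have h5 := mul_le_mul_of_nonneg_left h2 (norm_nonneg (WithLp.toLp 2 ![1, -Complex.I]))
  have h6 : ‖WithLp.toLp 2 ![1, -Complex.I]‖ * (opNorm B * ‖WithLp.toLp 2 ![1, -Complex.I]‖) =
    2 * opNorm B := by linear_combination opNorm B * h3
  linarith

theorem one_le_norm_linCoef {P : Matrix (Fin 2) (Fin 2) ℝ} (hP : P.det = 1) :
    1 ≤ ‖linCoef (matC P)‖ := by
  have h : linCoef (matC P) = (((P 0 0 + P 1 1) / 2 : ℝ) : ℂ) +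
      (((P 1 0 - P 0 1) / 2 : ℝ) : ℂ) * Complex.I := by
    simp [linCoef, matC]; ring
  have h2 : 1 ≤ ‖linCoef (matC P)‖ ^ 2 := by
    rw [h, Complex.sq_norm, Complex.normSq_add_mul_I]
    rw [Matrix.det_fin_two] at hP
    nlinarith [sq_nonneg (P 0 0 - P 1 1), sq_nonneg (P 1 0 + P 0 1)]
  nlinarith [norm_nonneg (linCoef (matC P))]

theorem pair_add {d : ℕ} (k : Fin d → ℤ) (x y : Fin d → ℝ) :
    pair k (x + y) = pair k x + pair k y := by
  simp [pair, mul_add, Finset.sum_add_distrib]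

theorem pair_single {d : ℕ} (k : Fin d → ℤ) (j : Fin d) : pair k (Pi.single j 1) = k j := by
  simp [pair, Pi.single_apply]

theorem continuous_pair {d : ℕ} (k : Fin d → ℤ) : Continuous (pair k) := by
  unfold pair; fun_prop

theorem pairC_add {d : ℕ} (k : Fin d → ℤ) (x y : Fin d → ℂ) :
    pairC k (x + y) = pairC k x + pairC k y := by
  simp [pairC, mul_add, Finset.sum_add_distrib]

theorem pairC_toC {d : ℕ} (k : Fin d → ℤ) (x : Fin d → ℝ) : pairC k (toC x) = (pair k x : ℝ) := by
  simp [pairC, pair, toC]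

theorem pairC_single {d : ℕ} (k : Fin d → ℤ) (j : Fin d) : pairC k (Pi.single j 1) = k j := by
  rw [← toC_single, pairC_toC, pair_single]; simp

section Degree

variable {d : ℕ} {h : ℝ} {B : (Fin d → ℂ) → Matrix (Fin 2) (Fin 2) ℂ} {n : Fin d → ℤ}

theorem HasDegree.exists_log (hdeg : HasDegree B n) :
    ∃ c : (Fin d → ℝ) → ℂ, Continuous c ∧ (∀ x, Complex.exp (c x) = linCoef (B (toC x))) ∧
      ∀ j x, c (x + Pi.single j 1) = c x + Real.pi * Complex.I * n j := by
  obtain ⟨H, hH, hdet, hper, h0, h1⟩ := hdeg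
  obtain ⟨c, hc, hexp, hT⟩ := exists_log_of_homotopy (Q := fun p => linCoef (matC (H p)))
    (by simp only [linCoef, matC, Matrix.map_apply]; fun_prop)
    (fun p => norm_pos_iff.1 (one_pos.trans_le (one_le_norm_linCoef (hdet p))))
    (c₁ := fun x => Real.pi * Complex.I * (pair n x : ℝ))
    (by have := continuous_pair n; fun_prop)
    (fun x => by rw [h1, linCoef_rot]; congr 1; push_cast; ring)
  refine ⟨c, hc, fun x => by rw [hexp, h0], fun j => ?_⟩
  have hshift : ∀ x : Fin d → ℝ, (Real.pi * Complex.I * (pair n (x + Pi.single j 1) : ℝ) : ℂ) =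
      Real.pi * Complex.I * (pair n x : ℝ) + Real.pi * Complex.I * n j := fun x => by
    rw [pair_add, pair_single]; push_cast; ring
  rcases hper j with hp | hp
  · exact hT (fun x => x + Pi.single j 1) 1 _ (fun s x => by rw [hp, one_mul]) hshift
  · refine hT (fun x => x + Pi.single j 1) (-1) _ (fun s x => ?_) hshift
    rw [hp, ← linCoef_smul]
    congr 1
    ext a b; simp [matC]

theorem IsAnalyticPSL.one_le_norm_linCoef (hB : IsAnalyticPSL h B) (x : Fin d → ℝ) :
    1 ≤ ‖linCoef (B (toC x))‖ := by
  obtain ⟨P, hP, hBP⟩ := hB.real x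
  rw [hBP]
  exact QPCocycle.one_le_norm_linCoef hP

/-- The sign in the periodicity of a `PSL(2,ℝ)`-valued map is determined by its degree. -/
theorem IsAnalyticPSL.shift (hh : 0 < h) (hB : IsAnalyticPSL h B) (hdeg : HasDegree B n) (j : Fin d)
    {z : Fin d → ℂ} (hz : z ∈ strip d h) :
    B (z + Pi.single j 1) = Complex.exp (Real.pi * Complex.I * n j) • B z := by
  obtain ⟨c, -, hexp, hc⟩ := hdeg.exists_log
  have h1 : linCoef (B (toC 0 + Pi.single j 1)) =
      Complex.exp (Real.pi * Complex.I * n j) * linCoef (B (toC 0)) := by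
    rw [← toC_single, ← toC_add, ← hexp, ← hexp, hc, Complex.exp_add, mul_comm]
  have h2 : linCoef (B (toC 0)) ≠ 0 := by rw [← hexp]; exact Complex.exp_ne_zero _
  rcases hB.periodic j with hp | hp
  · rw [hp _ (toC_mem_strip hh 0)] at h1
    rw [hp z hz, ← mul_right_cancel₀ h2 ((one_mul _).trans h1), one_smul]
  · have h3 : (-1) * linCoef (B (toC 0)) =
        Complex.exp (Real.pi * Complex.I * n j) * linCoef (B (toC 0)) := by
      rw [← h1, hp _ (toC_mem_strip hh 0), ← linCoef_smul, neg_one_smul]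
    rw [hp z hz, ← mul_right_cancel₀ h2 h3, neg_one_smul]

/-- The part of a `PSL(2,ℝ)`-valued map of degree `n` that is periodic, not only up to sign. -/
theorem IsAnalyticPSL.periodic_exp_smul (hh : 0 < h) (hB : IsAnalyticPSL h B)
    (hdeg : HasDegree B n) (j : Fin d) (z : Fin d → ℂ) (hz : z ∈ strip d h) :
    Complex.exp (-(Real.pi * Complex.I * pairC n (z + Pi.single j 1))) • B (z + Pi.single j 1) =
      Complex.exp (-(Real.pi * Complex.I * pairC n z)) • B z := by
  rw [hB.shift hh hdeg j hz, smul_smul, ← Complex.exp_add, pairC_add, pairC_single]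
  congr 2; ring

theorem IsAnalyticPSL.differentiableOn (hB : IsAnalyticPSL h B) (a b : Fin 2) :
    DifferentiableOn ℂ (fun z => B z a b) (strip d h) := (hB.analytic a b).differentiableOn

/-- A `PSL(2,ℝ)`-valued map of degree `n` grows at least like `e^{π h |n|}` on the strip of
width `h`: this is the bound of `exp_le_of_winding` on the line of direction `signVec n`. -/
theorem exp_le_stripNorm (hh : 0 < h) (hB : IsAnalyticPSL h B) (hdeg : HasDegree B n) :
    Real.exp (Real.pi * len n * h) ≤ stripNorm h B := by
  obtain ⟨c, hcc, hexp, hc⟩ := hdeg.exists_log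
  set s := signVec n
  have hs := abs_signVec_le n
  have hdiff : DifferentiableOn ℂ (fun z => linCoef (B z)) (strip d h) := by
    have := hB.differentiableOn
    unfold linCoef
    fun_prop
  have hper : ∀ z ∈ strip d h, ∀ k : Fin d → ℤ, linCoef (B (z + toC fun j => (k j : ℝ))) =
      Complex.exp (Real.pi * Complex.I * pairC n (toC fun j => (k j : ℝ))) * linCoef (B z) := by
    intro z hz k
    have h1 := periodic_strip_int_vec
      (G := fun z => Complex.exp (-(Real.pi * Complex.I * pairC n z)) • B z) (hB.periodic_exp_smul hh hdeg) hz k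
    have h2 := congr_arg linCoef h1
    rw [linCoef_smul, linCoef_smul, pairC_add, mul_add, neg_add, Complex.exp_add, mul_assoc] at h2
    have h3 := mul_left_cancel₀ (Complex.exp_ne_zero _) h2
    rw [← h3, ← mul_assoc, ← Complex.exp_add, add_neg_cancel, Complex.exp_zero, one_mul]
  have hpc := periodic_int_vec (f := fun x => c x - Real.pi * Complex.I * (pair n x : ℝ))
    (fun j x => by simp only [hc, pair_add, pair_single]; push_cast; ring) s 0
  refine exp_le_of_winding (f := fun ζ => linCoef (B (lineC 0 s ζ)))
    (σ := Complex.exp (Real.pi * Complex.I * pairC n (toC fun j => (s j : ℝ))))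
    (c := fun τ => c (τ • fun j => (s j : ℝ))) hh
    (hdiff.comp (differentiable_lineC 0 s).differentiableOn fun ζ hζ => lineC_mem_strip 0 hs hζ)
    ?_ (fun z hz => ?_) (fun z hz => ?_) (fun x => ?_) (by fun_prop) (fun x => ?_) ?_
  · rw [pairC_toC, Complex.norm_exp]; simp
  · rw [lineC_add_one, hper _ (lineC_mem_strip 0 hs hz)]
  · exact (norm_linCoef_le _).trans (opNorm_le_stripNorm hB.bounded (lineC_mem_strip 0 hs hz))
  · rw [lineC_ofReal]; exact hB.one_le_norm_linCoef _
  · rw [hexp, lineC_ofReal, zero_add]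
  · have e : (pair n fun j => (s j : ℝ)) = -len n := by
      rw [← sum_mul_signVec]; simp [pair, s]
    have e0 : pair n 0 = 0 := by simp [pair]
    rw [zero_add, e, e0] at hpc
    rw [one_smul, zero_smul]
    have : c (fun j => (s j : ℝ)) - c 0 = Real.pi * Complex.I * (-len n : ℝ) := by
      rw [Complex.ofReal_zero] at hpc
      linear_combination hpc
    rw [this]; simp

theorem one_le_stripNorm (hh : 0 < h) (hB : IsAnalyticPSL h B) : 1 ≤ stripNorm h B :=
  (hB.one_le_norm_linCoef 0).trans ((norm_linCoef_le _).trans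
    (opNorm_le_stripNorm hB.bounded (toC_mem_strip hh 0)))

end Degree

/-! ### The action on directions and its logarithm -/

theorem det_matC (P : Matrix (Fin 2) (Fin 2) ℝ) : (matC P).det = (P.det : ℝ) := by
  simp [Matrix.det_fin_two, matC]

theorem matC_one : matC 1 = 1 := by
  ext i j; simp [matC, Matrix.one_apply]; split_ifs <;> simp

theorem matC_mul (P Q : Matrix (Fin 2) (Fin 2) ℝ) : matC (P * Q) = matC P * matC Q :=
  Matrix.map_mul (f := Complex.ofRealHom)

theorem matC_smul (a : ℝ) (P : Matrix (Fin 2) (Fin 2) ℝ) : matC (a • P) = (a : ℂ) • matC P := by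
  ext i j; simp [matC]

theorem matC_injective : Function.Injective matC :=
  Matrix.map_injective Complex.ofReal_injective

theorem matC_exp (P : Matrix (Fin 2) (Fin 2) ℝ) :
    matC (NormedSpace.exp P) = NormedSpace.exp (matC P) := by
  let _ : NormedAlgebra ℚ (Matrix (Fin 2) (Fin 2) ℝ) := .restrictScalars ℚ ℝ _
  exact NormedSpace.map_exp (Complex.ofRealHom.mapMatrix (m := Fin 2))
    (by
      have : Continuous fun P : Matrix (Fin 2) (Fin 2) ℝ => P.map (fun x : ℝ => (x : ℂ)) :=
        continuous_id.matrix_map Complex.continuous_ofReal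
      exact this) P

theorem matC_mulVec_ofReal (P : Matrix (Fin 2) (Fin 2) ℝ) (w : Fin 2 → ℝ) :
    (matC P).mulVec (fun i => (w i : ℂ)) = fun i => (P.mulVec w i : ℂ) := by
  ext i
  simp [matC, Matrix.mulVec, dotProduct]

/-- A real linear functional `ℝ² → ℂ`, written in the coordinate `z = w₀ + i w₁` as
`c₁ z + c₂ z̄` and extended complex linearly to `ℂ²`. -/
noncomputable def zeta (c₁ c₂ : ℂ) (w : Fin 2 → ℂ) : ℂ :=
  c₁ * (w 0 + Complex.I * w 1) + c₂ * (w 0 - Complex.I * w 1)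

theorem zeta_smul (c₁ c₂ a : ℂ) (w : Fin 2 → ℂ) : zeta c₁ c₂ (a • w) = a * zeta c₁ c₂ w := by
  simp [zeta]; ring

theorem zeta_ne_zero {c₁ c₂ : ℂ} (hc : ‖c₂‖ < ‖c₁‖) {w : Fin 2 → ℝ} (hw : w ≠ 0) :
    zeta c₁ c₂ (fun i => (w i : ℂ)) ≠ 0 := by
  intro h
  have hconj : (w 0 : ℂ) - Complex.I * w 1 = (starRingEnd ℂ) ((w 0 : ℂ) + Complex.I * w 1) := by
    simp; ring
  have h1 : c₁ * ((w 0 : ℂ) + Complex.I * w 1) = -(c₂ * (starRingEnd ℂ) ((w 0 : ℂ) + Complex.I * w 1)) := by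
    rw [← hconj]; unfold zeta at h; linear_combination h
  have h2 := congr_arg norm h1
  rw [norm_neg, norm_mul, norm_mul, RCLike.norm_conj] at h2
  have h3 : ‖(w 0 : ℂ) + Complex.I * w 1‖ ≠ 0 := by
    rw [norm_ne_zero_iff]
    intro h4
    have hre := congr_arg Complex.re h4
    have him := congr_arg Complex.im h4
    simp at hre him
    exact hw (funext fun i => by fin_cases i <;> simp [hre, him])
  exact hc.ne' (mul_right_cancel₀ h3 h2)

/-- `unitVec` as a real vector. -/
noncomputable def unitVecR (y : ℝ) : Fin 2 → ℝ :=
  ![Real.cos (2 * Real.pi * y), Real.sin (2 * Real.pi * y)]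

theorem unitVec_eq (y : ℝ) : unitVec y = fun i => (unitVecR y i : ℂ) := by
  ext i; fin_cases i <;> simp [unitVec, unitVecR]

theorem unitVecR_ne_zero (y : ℝ) : unitVecR y ≠ 0 := by
  intro h
  have h0 := congr_fun h 0
  have h1 := congr_fun h 1
  simp only [unitVecR, Matrix.cons_val_zero, Matrix.cons_val_one, Pi.zero_apply] at h0 h1
  have := Real.cos_sq_add_sin_sq (2 * Real.pi * y)
  rw [h0, h1] at this
  norm_num at this

theorem continuous_unitVec : Continuous unitVec := by
  refine continuous_pi fun i => ?_
  fin_cases i <;> simp [unitVec] <;> fun_prop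

theorem unitVec_add_one (y : ℝ) : unitVec (y + 1) = unitVec y := by
  simp only [unitVec, mul_add, mul_one, Real.cos_add_two_pi, Real.sin_add_two_pi]

/-- The real rotation matrix by the angle `2πx`. -/
noncomputable def rotR (x : ℝ) : Matrix (Fin 2) (Fin 2) ℝ :=
  !![Real.cos (2 * Real.pi * x), -Real.sin (2 * Real.pi * x);
     Real.sin (2 * Real.pi * x), Real.cos (2 * Real.pi * x)]

theorem matC_rotR (x : ℝ) : matC (rotR x) = rot x := by
  ext i j; fin_cases i <;> fin_cases j <;> simp [matC, rotR, rot]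

theorem rotR_mul (x y : ℝ) : rotR x * rotR y = rotR (x + y) := by
  ext i j; fin_cases i <;> fin_cases j <;>
    simp [rotR, Matrix.mul_apply, Fin.sum_univ_two, mul_add, Real.cos_add, Real.sin_add] <;> ring

theorem rotR_zero : rotR 0 = 1 := by
  ext i j; fin_cases i <;> fin_cases j <;> simp [rotR]

theorem det_rotR (x : ℝ) : (rotR x).det = 1 := by
  simp [rotR, Matrix.det_fin_two]
  have := Real.cos_sq_add_sin_sq (2 * Real.pi * x)
  linarith

theorem adjugate_rotR (x : ℝ) : (rotR x).adjugate = rotR (-x) := by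
  ext i j; fin_cases i <;> fin_cases j <;> simp [rotR, Matrix.adjugate_fin_two]

theorem rotR_mulVec (x y : ℝ) : (rotR x).mulVec (unitVecR y) = unitVecR (x + y) := by
  ext i; fin_cases i <;>
    simp [rotR, unitVecR, mul_add, Real.cos_add, Real.sin_add] <;> ring

theorem rotR_sub_half (x : ℝ) (m : ℤ) :
    rotR (x - m / 2) = Real.cos (Real.pi * m) • rotR x := by
  have hs : Real.sin (Real.pi * m) = 0 := by rw [mul_comm]; exact Real.sin_int_mul_pi m
  have e : 2 * Real.pi * (x - m / 2) = 2 * Real.pi * x - Real.pi * m := by ring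
  ext i j; fin_cases i <;> fin_cases j <;>
    simp [rotR, e, Real.cos_sub, Real.sin_sub, hs] <;> ring

theorem continuous_rotR : Continuous rotR := by
  refine continuous_matrix fun i j => ?_
  fin_cases i <;> fin_cases j <;> simp [rotR] <;> fun_prop

theorem zeta_unitVec (c₁ c₂ : ℂ) (y : ℝ) : zeta c₁ c₂ (unitVec y) =
    c₁ * Complex.exp (2 * Real.pi * y * Complex.I) +
      c₂ * Complex.exp (-(2 * Real.pi * y) * Complex.I) := by
  rw [Complex.exp_mul_I, Complex.exp_mul_I]
  simp [zeta, unitVec]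
  ring

/-- `c` is a continuous logarithm of the function `(x, y) ↦ ζ(W(x) u_y)`, where `u_y` is the unit
vector of angle `2πy`, with the quasi-periods that it has when `W` is the inverse of a map of
degree `n`. -/
structure IsDirLog {d : ℕ} (W : (Fin d → ℝ) → Matrix (Fin 2) (Fin 2) ℂ) (c₁ c₂ : ℂ)
    (n : Fin d → ℤ) (c : (Fin d → ℝ) × ℝ → ℂ) : Prop where
  cont : Continuous c
  exp_eq : ∀ x y, Complex.exp (c (x, y)) = zeta c₁ c₂ ((W x).mulVec (unitVec y))
  shift_left : ∀ j x y, c (x + Pi.single j 1, y) = c (x, y) - Real.pi * Complex.I * n j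
  shift_right : ∀ x y, c (x, y + 1) = c (x, y) + 2 * Real.pi * Complex.I

section

variable {d : ℕ} {h : ℝ} {Bt Y : (Fin d → ℂ) → Matrix (Fin 2) (Fin 2) ℂ} {l l₀ : Fin d → ℤ}

theorem det_exp_ne_zero (P : Matrix (Fin 2) (Fin 2) ℝ) : (NormedSpace.exp P).det ≠ 0 :=
  ((Matrix.isUnit_iff_isUnit_det _).1 (Matrix.isUnit_exp P)).ne_zero

/-- The logarithm is carried along the homotopy which follows that of `B̃` to a rotation while it
shrinks `Y` to `0`; at its end the function is `ζ` of a unit vector, with an explicit logarithm because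
`|c₂| < |c₁|`. -/
theorem exists_isDirLog (hh : 0 < h) (hdeg : HasDegree Bt l₀) (hY : IsAnalyticSl h Y)
    {c₁ c₂ : ℂ} (hc : ‖c₂‖ < ‖c₁‖) :
    ∃ c, IsDirLog (fun x => (Bt (toC x) * rot (pairC l (toC x) / 2) * NormedSpace.exp (Y (toC x)))⁻¹)
      c₁ c₂ (l + l₀) c := by
  obtain ⟨H, hH, hdet, hper, h0, h1⟩ := hdeg
  let P : (Fin d → ℝ) → Matrix (Fin 2) (Fin 2) ℝ := fun x => (Y (toC x)).map Complex.re
  have hP : ∀ x, Y (toC x) = matC (P x) := fun x => by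
    obtain ⟨P', -, hP'⟩ := hY.real x
    ext i j; simp [P, hP', matC]
  have hPper : ∀ j x, P (x + Pi.single j 1) = P x := fun j x => by
    simp only [P]; rw [toC_add, toC_single, hY.periodic j _ (toC_mem_strip hh x)]
  have hPc : Continuous P := by
    have htoC : Continuous (toC (d := d)) := by unfold toC; fun_prop
    refine continuous_matrix fun i j => Complex.continuous_re.comp ?_
    exact (hY.analytic i j).continuousOn.comp_continuous htoC fun x => toC_mem_strip hh x
  -- the homotopy of inverses, through real matrices, from `B⁻¹` to a rotation
  let W : unitInterval → (Fin d → ℝ) → Matrix (Fin 2) (Fin 2) ℝ := fun s x =>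
    NormedSpace.exp (-(1 - (s : ℝ)) • P x) * rotR (-(pair l x / 2)) * (H (s, x)).adjugate
  have hWc : Continuous fun p : unitInterval × ((Fin d → ℝ) × ℝ) => W p.1 p.2.1 := by
    have hexp : Continuous (NormedSpace.exp : Matrix (Fin 2) (Fin 2) ℝ → _) := by
      let _ : NormedAlgebra ℚ (Matrix (Fin 2) (Fin 2) ℝ) := .restrictScalars ℚ ℝ _
      exact NormedSpace.exp_continuous
    have := continuous_rotR
    have := continuous_pair l
    have h3 : Continuous fun p : unitInterval × ((Fin d → ℝ) × ℝ) => (H (p.1, p.2.1)).adjugate :=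
      (by fun_prop : Continuous fun p : unitInterval × ((Fin d → ℝ) × ℝ) =>
        H (p.1, p.2.1)).matrix_adjugate
    have h4 : Continuous fun p : unitInterval × ((Fin d → ℝ) × ℝ) =>
        (-(1 - (p.1 : ℝ))) • P p.2.1 := by fun_prop
    have h5 : Continuous fun p : unitInterval × ((Fin d → ℝ) × ℝ) =>
        rotR (-(pair l p.2.1 / 2)) := by fun_prop
    exact ((hexp.comp h4).mul h5).mul h3
  have hWdet : ∀ s x, (W s x).det ≠ 0 := fun s x => by
    simp only [W, Matrix.det_mul, det_rotR, Matrix.det_adjugate, hdet]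
    simpa using det_exp_ne_zero _
  have hWreal : ∀ s x y, (matC (W s x)).mulVec (unitVec y) =
      fun i => (((W s x).mulVec (unitVecR y)) i : ℂ) := fun s x y => by
    rw [unitVec_eq, matC_mulVec_ofReal]
  have hWvec : ∀ s x y, (W s x).mulVec (unitVecR y) ≠ 0 := fun s x y h =>
    unitVecR_ne_zero y (Matrix.eq_zero_of_mulVec_eq_zero (hWdet s x) h)
  have hW0 : ∀ x, matC (W 0 x) =
      (Bt (toC x) * rot (pairC l (toC x) / 2) * NormedSpace.exp (Y (toC x)))⁻¹ := fun x => by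
    refine (Matrix.inv_eq_left_inv ?_).symm
    have e : (pairC l (toC x) / 2 : ℂ) = ((pair l x / 2 : ℝ) : ℂ) := by
      rw [pairC_toC]; push_cast; ring
    rw [← h0, e, ← matC_rotR, hP, ← matC_exp, ← matC_mul, ← matC_mul, ← matC_mul]
    have e2 : W 0 x * (H (0, x) * rotR (pair l x / 2) * NormedSpace.exp (P x)) = 1 := by
      simp only [W]
      have a1 : (H (0, x)).adjugate * H (0, x) = 1 := by
        rw [Matrix.adjugate_mul, hdet, one_smul]
      have a2 : rotR (-(pair l x / 2)) * rotR (pair l x / 2) = 1 := by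
        rw [rotR_mul, neg_add_cancel, rotR_zero]
      have a3 : NormedSpace.exp (-(1 - ((0 : unitInterval) : ℝ)) • P x) * NormedSpace.exp (P x) =
          1 := by
        rw [← Matrix.exp_add_of_commute _ _ ((Commute.refl (P x)).smul_left _)]
        simp
      calc _ = NormedSpace.exp (-(1 - ((0 : unitInterval) : ℝ)) • P x) *
            (rotR (-(pair l x / 2)) * ((H (0, x)).adjugate * H (0, x)) * rotR (pair l x / 2)) *
              NormedSpace.exp (P x) := by simp only [mul_assoc]
        _ = 1 := by rw [a1, mul_one, a2, mul_one, a3]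
    rw [e2, matC_one]
  have hW1 : ∀ x y, (matC (W 1 x)).mulVec (unitVec y) = unitVec (y - pair (l + l₀) x / 2) :=
    fun x y => by
    have hH1 : H (1, x) = rotR (pair l₀ x / 2) := matC_injective (by rw [h1, matC_rotR])
    rw [hWreal, unitVec_eq]
    simp only [W, hH1, adjugate_rotR]
    have e : -(1 - ((1 : unitInterval) : ℝ)) • P x = 0 := by simp
    rw [e, NormedSpace.exp_zero, one_mul, rotR_mul, rotR_mulVec]
    have e2 : pair (l + l₀) x = pair l x + pair l₀ x := by
      simp [pair, add_mul, Finset.sum_add_distrib]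
    rw [e2]
    have e3 : -(pair l x / 2) + -(pair l₀ x / 2) + y = y - (pair l x + pair l₀ x) / 2 := by ring
    rw [e3]
  have hc1 : c₁ ≠ 0 := norm_pos_iff.1 ((norm_nonneg _).trans_lt hc)
  let w : (Fin d → ℝ) × ℝ → ℂ := fun p =>
    (c₂ / c₁) * Complex.exp (-(4 * Real.pi * (p.2 - pair (l + l₀) p.1 / 2 : ℝ)) * Complex.I)
  have hw : ∀ p, 1 + w p ∈ Complex.slitPlane := fun p => by
    refine Complex.mem_slitPlane_of_norm_lt_one ?_
    have : (-(4 * Real.pi * (p.2 - pair (l + l₀) p.1 / 2 : ℝ)) * Complex.I : ℂ) =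
      ((-(4 * Real.pi * (p.2 - pair (l + l₀) p.1 / 2)) : ℝ) : ℂ) * Complex.I := by push_cast; ring
    simp only [w]
    rw [norm_mul, this, Complex.norm_exp_ofReal_mul_I, mul_one, norm_div]
    exact (div_lt_one (norm_pos_iff.2 hc1)).2 hc
  have hpc := continuous_pair (l + l₀)
  obtain ⟨c, hcc, hexp, hT⟩ := exists_log_of_homotopy
    (Q := fun p : unitInterval × ((Fin d → ℝ) × ℝ) =>
      zeta c₁ c₂ ((matC (W p.1 p.2.1)).mulVec (unitVec p.2.2)))
    (by
      have hu : Continuous fun p : unitInterval × ((Fin d → ℝ) × ℝ) => unitVec p.2.2 := by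
        exact continuous_unitVec.comp (continuous_snd.comp continuous_snd)
      have hm : Continuous fun p : unitInterval × ((Fin d → ℝ) × ℝ) => matC (W p.1 p.2.1) :=
        hWc.matrix_map Complex.continuous_ofReal
      have hv := hm.matrix_mulVec hu
      unfold zeta
      fun_prop)
    (fun p => by simp only [hWreal]; exact zeta_ne_zero hc (hWvec _ _ _))
    (c₁ := fun p => Complex.log c₁ +
      2 * Real.pi * (p.2 - pair (l + l₀) p.1 / 2 : ℝ) * Complex.I + Complex.log (1 + w p))
    (by
      have hwc : Continuous w := by simp only [w]; fun_prop
      have : Continuous fun p => Complex.log (1 + w p) :=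
        (continuous_const.add hwc).clog hw
      fun_prop)
    (fun p => by
      rw [hW1, zeta_unitVec, Complex.exp_add, Complex.exp_add, Complex.exp_log hc1,
        Complex.exp_log (Complex.slitPlane_ne_zero (hw p))]
      have : Complex.exp (-(2 * Real.pi * (p.2 - pair (l + l₀) p.1 / 2 : ℝ)) * Complex.I) =
          Complex.exp (2 * Real.pi * (p.2 - pair (l + l₀) p.1 / 2 : ℝ) * Complex.I) *
          Complex.exp (-(4 * Real.pi * (p.2 - pair (l + l₀) p.1 / 2 : ℝ)) * Complex.I) := by
        rw [← Complex.exp_add]; congr 1; ring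
      rw [this]
      simp only [w]
      field_simp)
  refine ⟨c, hcc, fun x y => by rw [hexp, hW0], fun j x y => ?_, fun x y => ?_⟩
  · have hshift : ∀ p : (Fin d → ℝ) × ℝ,
        w (p.1 + Pi.single j 1, p.2) = w p := fun p => by
      simp only [w]
      congr 1
      rw [pair_add, pair_single, Complex.exp_eq_exp_iff_exists_int]
      exact ⟨(l + l₀) j, by push_cast; ring⟩
    have hW' : ∃ ε : ℝ, ∀ s x, W s (x + Pi.single j 1) = ε • W s x := by
      rcases hper j with hp | hp
      · refine ⟨Real.cos (Real.pi * l j), fun s x => ?_⟩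
        have e : -(pair l (x + Pi.single j 1) / 2) = -(pair l x / 2) - l j / 2 := by
          rw [pair_add, pair_single]; ring
        simp only [W]
        rw [hp, hPper, e, rotR_sub_half]
        simp
      · refine ⟨-Real.cos (Real.pi * l j), fun s x => ?_⟩
        have e : -(pair l (x + Pi.single j 1) / 2) = -(pair l x / 2) - l j / 2 := by
          rw [pair_add, pair_single]; ring
        have e2 : (-H (s, x)).adjugate = -(H (s, x)).adjugate := by
          ext a b; fin_cases a <;> fin_cases b <;> simp [Matrix.adjugate_fin_two]
        simp only [W]
        rw [hp, hPper, e, rotR_sub_half, e2]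
        simp
    obtain ⟨ε, hε⟩ := hW'
    have := hT (fun p => (p.1 + Pi.single j 1, p.2)) ε (-(Real.pi * Complex.I * (l + l₀) j))
      (fun s p => by
        simp only [hε, matC_smul, Matrix.smul_mulVec, zeta_smul])
      (fun p => by
        simp only [hshift]
        rw [pair_add, pair_single]; push_cast; ring) (x, y)
    rw [sub_eq_add_neg]
    simpa using this
  · have hshift : ∀ p : (Fin d → ℝ) × ℝ, w (p.1, p.2 + 1) = w p := fun p => by
      simp only [w]
      congr 1
      rw [Complex.exp_eq_exp_iff_exists_int]
      exact ⟨-2, by push_cast; ring⟩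
    exact hT (fun p => (p.1, p.2 + 1)) 1 (2 * Real.pi * Complex.I)
      (fun s p => by simp only [unitVec_add_one, one_mul])
      (fun p => by
        simp only [hshift]
        push_cast; ring) (x, y)

end

/-! ### Rotation numbers: elliptic conjugates -/

theorem exists_im_eq_of_exp_eq_ofReal {w : ℂ} {t : ℝ} (h : Complex.exp w = t) :
    ∃ m : ℤ, w.im = Real.pi * m := by
  have h1 := congr_arg Complex.im h
  rw [Complex.exp_im, Complex.ofReal_im, mul_eq_zero] at h1
  obtain ⟨m, hm⟩ := Real.sin_eq_zero_iff.1 (h1.resolve_left (Real.exp_pos _).ne')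
  exact ⟨m, by rw [← hm, mul_comm]⟩

/-- If `e^w` is the real number `t` and `Im w = π m`, then `t` has the sign `(-1)^m`. -/
theorem mul_cos_pos_of_exp_eq_ofReal {w : ℂ} {t : ℝ} (h : Complex.exp w = t) {m : ℤ}
    (hm : w.im = Real.pi * m) : 0 < t * Real.cos (Real.pi * m) := by
  have h1 := congr_arg Complex.re h
  rw [Complex.exp_re, Complex.ofReal_re, hm] at h1
  have h2 : Real.sin (Real.pi * m) = 0 := by rw [mul_comm]; exact Real.sin_int_mul_pi m
  have h3 := Real.cos_sq_add_sin_sq (Real.pi * m)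
  rw [h2] at h3
  rw [← h1, mul_assoc, ← sq]
  have : Real.cos (Real.pi * m) ^ 2 = 1 := by linarith
  rw [this, mul_one]
  exact Real.exp_pos _

section Rotation

variable {d : ℕ} {α : Fin d → ℝ} {ψ : UnitAddTorus (Fin d) × UnitAddCircle → ℝ}
  {μ : Measure (UnitAddTorus (Fin d) × UnitAddCircle)}
  {W : (Fin d → ℝ) → Matrix (Fin 2) (Fin 2) ℂ} {c₁ c₂ : ℂ} {n : Fin d → ℤ}
  {c : (Fin d → ℝ) × ℝ → ℂ}

theorem skew_mk (x : Fin d → ℝ) (y : ℝ) : skew α ψ (toTorus x, (y : UnitAddCircle)) =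
    (toTorus (x + α), ((y + ψ (toTorus x, (y : UnitAddCircle)) : ℝ) : UnitAddCircle)) := rfl

theorem integral_comp_skew (hμ : MeasurePreserving (skew α ψ) μ μ)
    {g : UnitAddTorus (Fin d) × UnitAddCircle → ℝ} (hg : Measurable g) :
    ∫ p, g (skew α ψ p) ∂μ = ∫ p, g p ∂μ := by
  conv_rhs => rw [← hμ.map_eq]
  rw [integral_map hμ.measurable.aemeasurable hg.aestronglyMeasurable]

/-- If the argument of `ζ(W u_y)` increases along the orbits of the projective skew product by the
constant `φ` plus a coboundary, modulo `π`, then it does so up to one fixed multiple of `π`, and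
the integral of the lift `ψ` is determined by `φ` and by the degree. -/
theorem IsDirLog.integral_lift (hlog : IsDirLog W c₁ c₂ n c) (hψ : Continuous ψ)
    [IsProbabilityMeasure μ] (hμ : MeasurePreserving (skew α ψ) μ μ)
    {E : (Fin d → ℝ) × ℝ → ℝ} (hE : Continuous E)
    {g : UnitAddTorus (Fin d) × UnitAddCircle → ℝ} (hg : Measurable g) {C : ℝ}
    (hgC : ∀ p, |g p| ≤ C) {φ : ℝ}
    (hEg : ∀ x (y : ℝ), E (x, y) = g (skew α ψ (toTorus x, (y : UnitAddCircle))) -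
      g (toTorus x, (y : UnitAddCircle)) + φ)
    (hint : ∀ x (y : ℝ), ∃ m : ℤ,
      (c (x + α, y + ψ (toTorus x, (y : UnitAddCircle)))).im - (c (x, y)).im - E (x, y) =
        Real.pi * m) :
    ∃ N : ℤ, (∀ x (y : ℝ),
      (c (x + α, y + ψ (toTorus x, (y : UnitAddCircle)))).im - (c (x, y)).im - E (x, y) =
        Real.pi * N) ∧
      2 * Real.pi * ∫ p, ψ p ∂μ = Real.pi * pair n α + φ + Real.pi * N := by
  have hc := hlog.cont
  have htor : Continuous (toTorus (d := d)) := (isOpenQuotientMap_toTorus d).continuous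
  have hcirc : Continuous fun y : ℝ => (y : UnitAddCircle) := AddCircle.continuous_mk' 1
  obtain ⟨N, hN⟩ := exists_int_eq_const (X := (Fin d → ℝ) × ℝ)
    (g := fun p => ((c (p.1 + α, p.2 + ψ (toTorus p.1, (p.2 : UnitAddCircle)))).im -
      (c (p.1, p.2)).im - E (p.1, p.2)) / Real.pi) (by fun_prop)
    (fun p => by
      obtain ⟨m, hm⟩ := hint p.1 p.2
      exact ⟨m, by rw [hm]; field_simp⟩)
  have hN' : ∀ x (y : ℝ),
      (c (x + α, y + ψ (toTorus x, (y : UnitAddCircle)))).im - (c (x, y)).im - E (x, y) =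
        Real.pi * N := fun x y => by
    have := hN (x, y)
    simp only at this
    rw [div_eq_iff Real.pi_ne_zero] at this
    rw [this, mul_comm]
  refine ⟨N, hN', ?_⟩
  have hpc := continuous_pair n
  obtain ⟨κ, hκ⟩ := exists_descent_prod
    (f := fun p : (Fin d → ℝ) × ℝ => (c p).im - 2 * Real.pi * p.2 + Real.pi * pair n p.1)
    (by fun_prop)
    (fun j x y => by
      simp only [hlog.shift_left, pair_add, pair_single]
      simp
      ring)
    (fun x y => by
      simp only [hlog.shift_right]
      simp
      ring)
  have hpt : ∀ p, 2 * Real.pi * ψ p = (κ p - κ (skew α ψ p)) + (g (skew α ψ p) - g p) +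
      (Real.pi * pair n α + φ + Real.pi * N) := by
    rintro ⟨x, y⟩
    obtain ⟨x, rfl⟩ := (isOpenQuotientMap_toTorus d).surjective x
    obtain ⟨y, rfl⟩ := QuotientAddGroup.mk_surjective y
    have h1 := hN' x y
    have h2 := hEg x y
    have h3 := hκ x y
    have h4 := hκ (x + α) (y + ψ (toTorus x, (y : UnitAddCircle)))
    rw [← skew_mk] at h4
    simp only [pair_add] at h4
    change 2 * Real.pi * ψ (toTorus x, (y : UnitAddCircle)) =
      (κ (toTorus x, (y : UnitAddCircle)) - κ (skew α ψ (toTorus x, (y : UnitAddCircle)))) +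
      (g (skew α ψ (toTorus x, (y : UnitAddCircle))) - g (toTorus x, (y : UnitAddCircle))) + _
    rw [h3, h4]
    linarith
  have bdd : ∀ {G : UnitAddTorus (Fin d) × UnitAddCircle → ℝ} {C : ℝ}, Measurable G →
      (∀ p, |G p| ≤ C) → Integrable G μ := fun hG hC =>
    Integrable.of_bound hG.aestronglyMeasurable _ (Filter.Eventually.of_forall hC)
  obtain ⟨K, hK⟩ := isCompact_univ.exists_bound_of_continuousOn κ.continuous.continuousOn
  have i1 : Integrable κ μ := bdd κ.continuous.measurable fun p => hK p trivial
  have i2 : Integrable (fun p => κ (skew α ψ p)) μ :=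
    bdd (κ.continuous.measurable.comp hμ.measurable) fun p => hK _ trivial
  have i3 : Integrable g μ := bdd hg hgC
  have i4 : Integrable (fun p => g (skew α ψ p)) μ :=
    bdd (hg.comp hμ.measurable) fun p => hgC _
  rw [← integral_const_mul]
  simp_rw [hpt]
  have i5 : Integrable (fun p => κ p - κ (skew α ψ p)) μ := i1.sub i2
  have i6 : Integrable (fun p => g (skew α ψ p) - g p) μ := i4.sub i3
  have i7 : Integrable (fun p => κ p - κ (skew α ψ p) + (g (skew α ψ p) - g p)) μ := i5.add i6
  rw [integral_add i7 (integrable_const _), integral_add i5 i6, integral_sub i1 i2, integral_sub i4 i3,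
    integral_comp_skew hμ κ.continuous.measurable, integral_comp_skew hμ hg]
  simp

variable {S : (Fin d → ℝ) → Matrix (Fin 2) (Fin 2) ℂ} {B : (Fin d → ℝ) → Matrix (Fin 2) (Fin 2) ℂ}
  {A : Matrix (Fin 2) (Fin 2) ℂ}

/-- The logarithm of directions along an orbit of the skew product, when `B` conjugates the cocycle
to the constant `A` up to sign. -/
theorem IsDirLog.exists_exp_skew (hlog : IsDirLog (fun x => (B x)⁻¹) c₁ c₂ n c)
    (hψ : IsLift S ψ) (hB : ∀ x, IsUnit (B x).det) {x : Fin d → ℝ} {σ : ℝ}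
    (hσ : (B (x + α))⁻¹ * S x * B x = (σ : ℂ) • A) (y : ℝ) :
    ∃ r : ℝ, 0 < r ∧ Complex.exp (c (x + α, y + ψ (toTorus x, (y : UnitAddCircle)))) =
      ((σ / r : ℝ) : ℂ) * zeta c₁ c₂ (A.mulVec ((B x)⁻¹.mulVec (unitVec y))) := by
  obtain ⟨r, hr, hS⟩ := hψ.2 x y
  refine ⟨r, hr, ?_⟩
  have h1 : (r : ℂ) • (B (x + α))⁻¹.mulVec (unitVec (y + ψ (toTorus x, (y : UnitAddCircle)))) =
      (σ : ℂ) • A.mulVec ((B x)⁻¹.mulVec (unitVec y)) := by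
    rw [← Matrix.mulVec_smul, ← hS, Matrix.mulVec_mulVec, ← Matrix.smul_mulVec, ← hσ,
      Matrix.mulVec_mulVec, mul_assoc _ (B x), Matrix.mul_nonsing_inv _ (hB x), mul_one]
  have h2 := congr_arg (zeta c₁ c₂) h1
  rw [zeta_smul, zeta_smul, ← hlog.exp_eq] at h2
  have hr0 : (r : ℂ) ≠ 0 := by exact_mod_cast hr.ne'
  push_cast
  field_simp
  linear_combination h2

/-- The elliptic case: if `ζ` is an eigenfunctional of `A` with eigenvalue `e^{iφ}`, then `φ` and
the degree determine the rotation number modulo `ℤ`, including the sign of the conjugated cocycle. -/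
theorem rotationNumber_of_elliptic (hlog : IsDirLog (fun x => (B x)⁻¹) c₁ c₂ n c)
    (hB : ∀ x, IsUnit (B x).det) {ρ φ : ℝ}
    (hρ : IsFiberedRotationNumber α S ρ)
    (hconj : ∀ x, (B (x + α))⁻¹ * S x * B x = A ∨ (B (x + α))⁻¹ * S x * B x = -A)
    (hA : ∀ w, zeta c₁ c₂ (A.mulVec w) = Complex.exp (φ * Complex.I) * zeta c₁ c₂ w) :
    (∃ k : ℤ, 2 * ρ - pair n α = φ / Real.pi + k) ∧
    ∀ x, (B (x + α))⁻¹ * S x * B x =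
      Complex.exp (2 * Real.pi * Complex.I * (ρ - pair n α / 2 : ℝ)) •
        Complex.exp (-(φ * Complex.I)) • A := by
  obtain ⟨ψ, μ, m, hψ, hprob, hμ, -, hρm⟩ := hρ
  have hσ : ∀ x, ∃ σ : ℝ, |σ| = 1 ∧ (B (x + α))⁻¹ * S x * B x = (σ : ℂ) • A := fun x => by
    rcases hconj x with h | h
    · exact ⟨1, by simp, by simp [h]⟩
    · exact ⟨-1, by simp, by simp [h]⟩
  have hexp : ∀ x σ, (B (x + α))⁻¹ * S x * B x = ((σ : ℝ) : ℂ) • A → ∀ y : ℝ, ∃ r : ℝ, 0 < r ∧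
      Complex.exp (c (x + α, y + ψ (toTorus x, (y : UnitAddCircle))) - c (x, y) -
        φ * Complex.I) = ((σ / r : ℝ) : ℂ) := fun x σ h y => by
    obtain ⟨r, hr, hr2⟩ := hlog.exists_exp_skew hψ hB h y
    refine ⟨r, hr, ?_⟩
    rw [Complex.exp_sub, Complex.exp_sub, hr2, hA, ← hlog.exp_eq]
    have h1 := Complex.exp_ne_zero (c (x, y))
    have h2 := Complex.exp_ne_zero (φ * Complex.I)
    field_simp
  have him : ∀ x (y : ℝ), (c (x + α, y + ψ (toTorus x, (y : UnitAddCircle))) - c (x, y) -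
      φ * Complex.I).im =
      (c (x + α, y + ψ (toTorus x, (y : UnitAddCircle)))).im - (c (x, y)).im - φ := fun x y => by
    simp
  obtain ⟨N, hN, hint⟩ := hlog.integral_lift hψ.1 hμ (E := fun _ => φ) continuous_const
    (g := fun _ => 0) measurable_const (C := 0) (by simp) (φ := φ) (by simp) (fun x y => by
      obtain ⟨σ, -, h⟩ := hσ x
      obtain ⟨r, hr, h2⟩ := hexp x σ h y
      obtain ⟨m, hm⟩ := exists_im_eq_of_exp_eq_ofReal h2
      exact ⟨m, by rw [← him]; exact hm⟩)
  have hk : 2 * ρ - pair n α = φ / Real.pi + ((N + 2 * m : ℤ) : ℝ) := by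
    have h3 : 2 * (∫ p, ψ p ∂μ) = pair n α + φ / Real.pi + N := by
      field_simp
      linarith
    rw [hρm]; push_cast; linarith
  refine ⟨⟨_, hk⟩, fun x => ?_⟩
  obtain ⟨σ, hσ1, h⟩ := hσ x
  obtain ⟨r, hr, h2⟩ := hexp x σ h 0
  have h3 := mul_cos_pos_of_exp_eq_ofReal h2 (m := N) (by rw [him]; exact hN x 0)
  have h4 : σ = Real.cos (Real.pi * N) := by
    have h5 : 0 < σ * Real.cos (Real.pi * N) := by
      have : σ / r * Real.cos (Real.pi * N) = (σ * Real.cos (Real.pi * N)) / r := by ring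
      rw [this] at h3
      exact (div_pos_iff_of_pos_right hr).1 h3
    have h6 := Real.cos_sq_add_sin_sq (Real.pi * N)
    rw [mul_comm, Real.sin_int_mul_pi, mul_comm] at h6
    have h7 : Real.cos (Real.pi * N) = 1 ∨ Real.cos (Real.pi * N) = -1 :=
      mul_self_eq_one_iff.1 (by linarith)
    rcases (abs_eq zero_le_one).1 hσ1 with h8 | h8 <;> rcases h7 with h9 | h9 <;>
      rw [h8, h9] at h5 ⊢ <;> norm_num at h5
  rw [h, smul_smul, ← Complex.exp_add]
  congr 1
  have h5 : (2 * Real.pi * Complex.I * (ρ - pair n α / 2 : ℝ) + -(φ * Complex.I) : ℂ) =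
      ((Real.pi * N : ℝ) : ℂ) * Complex.I + m * (2 * Real.pi * Complex.I) := by
    have h6 : 2 * Real.pi * (ρ - pair n α / 2) - φ = Real.pi * N + m * (2 * Real.pi) := by
      have := congr_arg (fun t => Real.pi * t) hk
      push_cast at this
      field_simp at this
      linarith
    have h7 := congr_arg (fun t : ℝ => (t : ℂ) * Complex.I) h6
    push_cast at h7 ⊢
    linear_combination h7
  rw [h5, Complex.exp_add, Complex.exp_int_mul_two_pi_mul_I, mul_one, Complex.exp_mul_I,
    ← Complex.ofReal_cos, ← Complex.ofReal_sin, h4]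
  have h8 : Real.sin (Real.pi * N) = 0 := by rw [mul_comm]; exact Real.sin_int_mul_pi N
  simp [h8]

end Rotation

/-! ### Rotation numbers: conjugates with a real eigendirection -/

theorem arg_sq_of_re_pos {w : ℂ} (hw : 0 < w.re) : (w ^ 2).arg = 2 * w.arg := by
  have h := abs_lt.1 (Complex.abs_arg_lt_pi_div_two_iff.2 (Or.inl hw))
  have hw0 : w ≠ 0 := fun h => by simp [h] at hw
  rw [sq, Complex.arg_mul hw0 hw0 ⟨by linarith [h.1], by linarith [h.2]⟩, two_mul]

theorem arg_div_of_re_pos {w w' : ℂ} (hw : 0 < w.re) (hw' : 0 < w'.re) :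
    (w' / w).arg = w'.arg - w.arg := by
  have h := abs_lt.1 (Complex.abs_arg_lt_pi_div_two_iff.2 (Or.inl hw))
  have h' := abs_lt.1 (Complex.abs_arg_lt_pi_div_two_iff.2 (Or.inl hw'))
  have hw0 : w ≠ 0 := fun h => by simp [h] at hw
  have hw0' : w' ≠ 0 := fun h => by simp [h] at hw'
  have hinv : (w⁻¹).arg = -w.arg := by
    rw [Complex.arg_inv, if_neg (by linarith [h.2, Real.pi_pos])]
  rw [div_eq_mul_inv, Complex.arg_mul hw0' (inv_ne_zero hw0) (by
    rw [hinv]; exact ⟨by linarith [h.2, h'.1], by linarith [h.1, h'.2]⟩), hinv, sub_eq_add_neg]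

/-- When `z` and `z'` lie on the same open side of the real line, or on the same ray of it, the
angle between them is a difference of values of one (discontinuous) function of `z²`. -/
theorem arg_div_eq_sub {z z' : ℂ} {a : ℝ} (hz : z ≠ 0) (ha : 0 < a)
    (h : (z.im = 0 ∧ z' = a * z) ∨ 0 < z.im * z'.im) :
    z' / z ∈ Complex.slitPlane ∧ (z' / z).arg = (-z' ^ 2).arg / 2 - (-z ^ 2).arg / 2 := by
  rcases h with ⟨h1, h2⟩ | h
  · rw [h2, mul_div_cancel_right₀ _ hz]
    refine ⟨Complex.ofReal_mem_slitPlane.2 ha, ?_⟩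
    have e : -((a : ℂ) * z) ^ 2 = ((a ^ 2 : ℝ) : ℂ) * (-z ^ 2) := by push_cast; ring
    rw [Complex.arg_ofReal_of_nonneg ha.le, e, Complex.arg_real_mul _ (by positivity), sub_self]
  · refine ⟨?_, ?_⟩
    · rw [Complex.mem_slitPlane_iff]
      by_contra! hcon
      have e : z' = ((z' / z).re : ℂ) * z := by
        have : z' / z = ((z' / z).re : ℂ) := Complex.ext (by simp) (by simp [hcon.2])
        rw [← this, div_mul_cancel₀ _ hz]
      have e2 : z'.im = (z' / z).re * z.im := by
        conv_lhs => rw [e]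
        simp
      rw [e2] at h
      nlinarith [sq_nonneg z.im, hcon.1]
    · rcases pos_and_pos_or_neg_and_neg_of_mul_pos h with ⟨h1, h2⟩ | ⟨h1, h2⟩
      · have e1 : -z ^ 2 = (-Complex.I * z) ^ 2 := by rw [mul_pow, neg_sq, Complex.I_sq]; ring
        have e2 : -z' ^ 2 = (-Complex.I * z') ^ 2 := by rw [mul_pow, neg_sq, Complex.I_sq]; ring
        have r1 : 0 < (-Complex.I * z).re := by simpa using h1
        have r2 : 0 < (-Complex.I * z').re := by simpa using h2
        rw [e1, e2, arg_sq_of_re_pos r1, arg_sq_of_re_pos r2,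
          ← mul_div_mul_left z' z (neg_ne_zero.2 Complex.I_ne_zero), arg_div_of_re_pos r1 r2]
        ring
      · have e1 : -z ^ 2 = (Complex.I * z) ^ 2 := by rw [mul_pow, Complex.I_sq]; ring
        have e2 : -z' ^ 2 = (Complex.I * z') ^ 2 := by rw [mul_pow, Complex.I_sq]; ring
        have r1 : 0 < (Complex.I * z).re := by simpa using h1
        have r2 : 0 < (Complex.I * z').re := by simpa using h2
        rw [e1, e2, arg_sq_of_re_pos r1, arg_sq_of_re_pos r2,
          ← mul_div_mul_left z' z Complex.I_ne_zero, arg_div_of_re_pos r1 r2]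
        ring

/-- In the frame given by a real eigenvector `v` of `A ∈ SL(2,ℝ)`, the matrix `A` preserves the two
sides of the eigendirection. -/
theorem zeta_eigenvector {A : Matrix (Fin 2) (Fin 2) ℝ} (hA : A.det = 1) {v : Fin 2 → ℝ}
    (hv : v ≠ 0) {a : ℝ} (ha : 0 < a) (hAv : A.mulVec v = a • v) (w : Fin 2 → ℝ) :
    let z := zeta (v 0 - Complex.I * v 1) 0 (fun i => (w i : ℂ))
    let z' := zeta (v 0 - Complex.I * v 1) 0 (fun i => (A.mulVec w i : ℂ))
    (z.im = 0 ∧ z' = a * z) ∨ 0 < z.im * z'.im := by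
  intro z z'
  have hz : ∀ w : Fin 2 → ℝ, zeta (v 0 - Complex.I * v 1) 0 (fun i => (w i : ℂ)) =
      ((v 0 * w 0 + v 1 * w 1 : ℝ) : ℂ) + ((v 0 * w 1 - v 1 * w 0 : ℝ) : ℂ) * Complex.I :=
    fun w => by
    simp only [zeta]; push_cast; linear_combination (-(v 1 : ℂ) * w 1) * Complex.I_sq
  have him : ∀ w : Fin 2 → ℝ, (zeta (v 0 - Complex.I * v 1) 0 (fun i => (w i : ℂ))).im =
      v 0 * w 1 - v 1 * w 0 := fun w => by rw [hz]; simp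
  have hv0 : 0 < v 0 ^ 2 + v 1 ^ 2 := by
    by_contra! hcon
    refine hv (funext fun i => ?_)
    have h0 : v 0 ^ 2 = 0 := by nlinarith [sq_nonneg (v 0), sq_nonneg (v 1)]
    have h1 : v 1 ^ 2 = 0 := by nlinarith [sq_nonneg (v 0), sq_nonneg (v 1)]
    fin_cases i
    · exact pow_eq_zero_iff two_ne_zero |>.1 h0
    · exact pow_eq_zero_iff two_ne_zero |>.1 h1
  have a0 := congr_fun hAv 0
  have a1 := congr_fun hAv 1
  simp only [Matrix.mulVec, dotProduct, Fin.sum_univ_two, Pi.smul_apply, smul_eq_mul] at a0 a1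
  rw [Matrix.det_fin_two] at hA
  have w0 : A.mulVec w 0 = A 0 0 * w 0 + A 0 1 * w 1 := by
    simp [Matrix.mulVec, dotProduct, Fin.sum_univ_two]
  have w1 : A.mulVec w 1 = A 1 0 * w 0 + A 1 1 * w 1 := by
    simp [Matrix.mulVec, dotProduct, Fin.sum_univ_two]
  have hY : a * (v 0 * A.mulVec w 1 - v 1 * A.mulVec w 0) = v 0 * w 1 - v 1 * w 0 := by
    rw [w0, w1]
    linear_combination (v 0 * w 1 - v 1 * w 0) * hA - (A 1 0 * w 0 + A 1 1 * w 1) * a0 +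
      (A 0 0 * w 0 + A 0 1 * w 1) * a1
  by_cases h0 : v 0 * w 1 - v 1 * w 0 = 0
  · left
    refine ⟨by simp only [z]; rw [him, h0], ?_⟩
    have h1 : v 0 * A.mulVec w 1 - v 1 * A.mulVec w 0 = 0 := by
      rw [h0] at hY; exact (mul_eq_zero.1 hY).resolve_left ha.ne'
    have h2 : v 0 * A.mulVec w 0 + v 1 * A.mulVec w 1 = a * (v 0 * w 0 + v 1 * w 1) := by
      have e0 : (v 0 ^ 2 + v 1 ^ 2) * w 0 = (v 0 * w 0 + v 1 * w 1) * v 0 := by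
        linear_combination -v 1 * h0
      have e1 : (v 0 ^ 2 + v 1 ^ 2) * w 1 = (v 0 * w 0 + v 1 * w 1) * v 1 := by
        linear_combination v 0 * h0
      have : (v 0 ^ 2 + v 1 ^ 2) * (v 0 * A.mulVec w 0 + v 1 * A.mulVec w 1) =
          (v 0 ^ 2 + v 1 ^ 2) * (a * (v 0 * w 0 + v 1 * w 1)) := by
        rw [w0, w1]
        linear_combination (v 0 * A 0 0 + v 1 * A 1 0) * e0 + (v 0 * A 0 1 + v 1 * A 1 1) * e1 +
          (v 0 * w 0 + v 1 * w 1) * (v 0 * a0 + v 1 * a1)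
      exact mul_left_cancel₀ hv0.ne' this
    simp only [z, z']
    rw [hz, hz, h0, h1, h2]; push_cast; ring
  · right
    simp only [z, z']
    rw [him, him, ← hY]
    have : v 0 * A.mulVec w 1 - v 1 * A.mulVec w 0 ≠ 0 := fun h => h0 (by rw [← hY, h, mul_zero])
    have h3 : 0 < (v 0 * A.mulVec w 1 - v 1 * A.mulVec w 0) ^ 2 := by positivity
    nlinarith

section RealEigenvector

variable {d : ℕ} {α : Fin d → ℝ} {n : Fin d → ℤ} {c : (Fin d → ℝ) × ℝ → ℂ}

/-- The non-elliptic case: a cocycle conjugate to a constant with a real eigendirection has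
a rotation number that is rational with respect to `α`. The angle to the eigendirection is bounded,
so that its increments form a coboundary. -/
theorem rotationNumber_of_real_eigenvector {S B : (Fin d → ℝ) → Matrix (Fin 2) (Fin 2) ℂ}
    {A : Matrix (Fin 2) (Fin 2) ℝ} (hA : A.det = 1) {v : Fin 2 → ℝ}
    (hv : v ≠ 0) {a : ℝ} (ha : 0 < a) (hAv : A.mulVec v = a • v)
    (hlog : IsDirLog (fun x => (B x)⁻¹) (v 0 - Complex.I * v 1) 0 n c)
    (hB : ∀ x, ∃ P : Matrix (Fin 2) (Fin 2) ℝ, P.det = 1 ∧ B x = matC P) (hBc : Continuous B) {ρ : ℝ}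
    (hρ : IsFiberedRotationNumber α S ρ)
    (hconj : ∀ x, (B (x + α))⁻¹ * S x * B x = matC A ∨ (B (x + α))⁻¹ * S x * B x = -matC A) :
    ∃ k : ℤ, 2 * ρ = pair n α + k := by
  obtain ⟨ψ, μ, m, hψ, hprob, hμ, -, hρm⟩ := hρ
  have hdet : ∀ x, (B x).det = 1 := fun x => by
    obtain ⟨P, hP, hBP⟩ := hB x
    rw [hBP, det_matC, hP, Complex.ofReal_one]
  have hunit : ∀ x, IsUnit (B x).det := fun x => by rw [hdet]; exact isUnit_one
  -- directions are mapped by the real matrices `B⁻¹`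
  have hreal : ∀ x y, ∃ w : Fin 2 → ℝ,
      (B x)⁻¹.mulVec (unitVec y) = fun i => (w i : ℂ) := fun x y => by
    obtain ⟨P, hP, hBP⟩ := hB x
    have h1 : (B x)⁻¹ = matC P.adjugate := by
      refine Matrix.inv_eq_left_inv ?_
      rw [hBP, ← matC_mul, Matrix.adjugate_mul, hP, one_smul, matC_one]
    exact ⟨P.adjugate.mulVec (unitVecR y), by rw [h1, unitVec_eq, matC_mulVec_ofReal]⟩
  let z' : (Fin d → ℝ) × ℝ → ℂ := fun p =>
    zeta (v 0 - Complex.I * v 1) 0 ((matC A).mulVec ((B p.1)⁻¹.mulVec (unitVec p.2)))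
  have hzz : ∀ p, z' p / Complex.exp (c p) ∈ Complex.slitPlane ∧
      (z' p / Complex.exp (c p)).arg = (-z' p ^ 2).arg / 2 - (-(Complex.exp (c p)) ^ 2).arg / 2 := by
    rintro ⟨x, y⟩
    obtain ⟨w, hwe⟩ := hreal x y
    refine arg_div_eq_sub (Complex.exp_ne_zero _) ha ?_
    have := zeta_eigenvector hA hv ha hAv w
    rw [hlog.exp_eq]
    simp only [z', hwe, matC_mulVec_ofReal]
    exact this
  have hz'c : Continuous z' := by
    have hinv : Continuous fun p : (Fin d → ℝ) × ℝ => (B p.1)⁻¹ := by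
      simp_rw [Matrix.inv_def, hdet, Ring.inverse_one, one_smul]
      exact (hBc.comp continuous_fst).matrix_adjugate
    have hv := (continuous_const (y := matC A)).matrix_mulVec
      (hinv.matrix_mulVec (continuous_unitVec.comp continuous_snd))
    simp only [z', zeta]
    exact (continuous_const.mul (((continuous_apply 0).comp hv).add
      (continuous_const.mul ((continuous_apply 1).comp hv)))).add
      (continuous_const.mul (((continuous_apply 0).comp hv).sub
      (continuous_const.mul ((continuous_apply 1).comp hv))))
  have hσ : ∀ x, ∃ σ : ℝ, |σ| = 1 ∧ (B (x + α))⁻¹ * S x * B x = (σ : ℂ) • matC A := fun x => by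
    rcases hconj x with h | h
    · exact ⟨1, by simp, by simp [h]⟩
    · exact ⟨-1, by simp, by simp [h]⟩
  obtain ⟨q, hq⟩ := exists_descent_prod (f := fun p => -(Complex.exp (c p)) ^ 2)
    (by have := hlog.cont; fun_prop)
    (fun j x y => by
      simp only [hlog.shift_left, ← Complex.exp_nat_mul]
      congr 1
      rw [Complex.exp_eq_exp_iff_exists_int]
      exact ⟨-n j, by push_cast; ring⟩)
    (fun x y => by
      simp only [hlog.shift_right, ← Complex.exp_nat_mul]
      congr 1
      rw [Complex.exp_eq_exp_iff_exists_int]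
      exact ⟨2, by push_cast; ring⟩)
  obtain ⟨N, -, hint⟩ := hlog.integral_lift hψ.1 hμ
    (E := fun p => (z' p / Complex.exp (c p)).arg)
    (by
      have h1 : Continuous fun p => z' p / Complex.exp (c p) :=
        hz'c.div (Complex.continuous_exp.comp hlog.cont) fun p => Complex.exp_ne_zero _
      exact continuous_iff_continuousAt.2 fun p =>
        (Complex.continuousAt_arg (hzz p).1).comp (f := fun p => z' p / Complex.exp (c p)) h1.continuousAt)
    (g := fun p => (q p).arg / 2)
    ((Complex.measurable_arg.comp q.continuous.measurable).div_const 2) (C := Real.pi / 2)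
    (fun p => by
      rw [abs_div, abs_two]
      gcongr
      exact Complex.abs_arg_le_pi _) (φ := 0)
    (fun x y => by
      obtain ⟨σ, hσ1, h⟩ := hσ x
      obtain ⟨r, hr, hr2⟩ := hlog.exists_exp_skew hψ hunit h y
      have hσ2 : σ ^ 2 = 1 := by rw [← sq_abs, hσ1, one_pow]
      have e : -(((σ / r : ℝ) : ℂ) * z' (x, y)) ^ 2 =
          (((σ / r) ^ 2 : ℝ) : ℂ) * (-z' (x, y) ^ 2) := by push_cast; ring
      have hpos : 0 < (σ / r) ^ 2 := by rw [div_pow, hσ2]; positivity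
      rw [(hzz (x, y)).2, add_zero, skew_mk, hq, hq, hr2]
      change _ = (-(((σ / r : ℝ) : ℂ) * z' (x, y)) ^ 2).arg / 2 - _
      rw [e, Complex.arg_real_mul _ hpos])
    (fun x y => by
      obtain ⟨σ, hσ1, h⟩ := hσ x
      obtain ⟨r, hr, hr2⟩ := hlog.exists_exp_skew hψ hunit h y
      have hslit := Complex.slitPlane_ne_zero (hzz (x, y)).1
      have hz0 : z' (x, y) ≠ 0 := fun h0 => hslit (by rw [h0, zero_div])
      have h2 : Complex.exp (c (x + α, y + ψ (toTorus x, (y : UnitAddCircle))) - c (x, y) -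
          Complex.log (z' (x, y) / Complex.exp (c (x, y)))) = ((σ / r : ℝ) : ℂ) := by
        rw [Complex.exp_sub, Complex.exp_sub, hr2, Complex.exp_log hslit]
        change ((σ / r : ℝ) : ℂ) * z' (x, y) / _ / _ = _
        have := Complex.exp_ne_zero (c (x, y))
        field_simp
      obtain ⟨m, hm⟩ := exists_im_eq_of_exp_eq_ofReal h2
      exact ⟨m, by rw [← hm]; simp [Complex.log_im]⟩)
  refine ⟨N + 2 * m, ?_⟩
  have h3 : 2 * (∫ p, ψ p ∂μ) = pair n α + N := by
    have : Real.pi * (2 * (∫ p, ψ p ∂μ)) = Real.pi * (pair n α + N) := by linarith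
    exact mul_left_cancel₀ Real.pi_ne_zero this
  rw [hρm]; push_cast; linarith

end RealEigenvector

/-! ### Exponentials -/

theorem exp_mulVec_eigenvector {X : Matrix (Fin 2) (Fin 2) ℂ} {v : Fin 2 → ℂ} {a : ℂ}
    (h : X.mulVec v = a • v) : (NormedSpace.exp X).mulVec v = Complex.exp a • v := by
  have hpow : ∀ k : ℕ, (X ^ k).mulVec v = a ^ k • v := fun k => by
    induction k with
    | zero => simp
    | succ k ih => rw [pow_succ', ← Matrix.mulVec_mulVec, ih, Matrix.mulVec_smul, h, smul_smul,
        ← pow_succ]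
  have h1 := (NormedSpace.exp_series_hasSum_exp' (𝕂 := ℂ) X).map
    ((Matrix.mulVec.addMonoidHomLeft v : Matrix (Fin 2) (Fin 2) ℂ →+ (Fin 2 → ℂ)))
    (by exact continuous_id.matrix_mulVec continuous_const)
  have h2 := (NormedSpace.exp_series_hasSum_exp' (𝕂 := ℂ) a).smul_const v
  rw [← Complex.exp_eq_exp_ℂ] at h2
  refine h1.unique (h2.congr_fun fun k => ?_)
  change (((k.factorial : ℂ)⁻¹) • X ^ k).mulVec v = _
  rw [Matrix.smul_mulVec, hpow, smul_smul, smul_eq_mul]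

theorem opNorm_exp_sub_one_le (X : Matrix (Fin 2) (Fin 2) ℂ) :
    opNorm (NormedSpace.exp X - 1) ≤ Real.exp (opNorm X) - 1 := by
  rw [opNorm_eq_norm, opNorm_eq_norm]
  have h1 := (hasSum_nat_add_iff' 1).2 (NormedSpace.exp_series_hasSum_exp' (𝕂 := ℂ) X)
  have h2 := (hasSum_nat_add_iff' 1).2 (NormedSpace.exp_series_hasSum_exp' (𝕂 := ℝ) ‖X‖)
  rw [← Real.exp_eq_exp_ℝ] at h2
  simp only [Finset.range_one, Finset.sum_singleton, Nat.factorial_zero, Nat.cast_one, inv_one,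
    pow_zero, one_smul] at h1 h2
  refine h1.norm_le_of_bounded h2 fun k => ?_
  rw [norm_smul, norm_inv, smul_eq_mul]
  gcongr
  · simp
  · exact norm_pow_le' _ (Nat.succ_pos k)

theorem opNorm_one : opNorm 1 = 1 := by
  rw [opNorm_eq_norm]; exact CStarRing.norm_one

theorem opNorm_exp_le (X : Matrix (Fin 2) (Fin 2) ℂ) :
    opNorm (NormedSpace.exp X) ≤ Real.exp (opNorm X) := by
  have h1 := opNorm_exp_sub_one_le X
  have h2 := opNorm_one
  rw [opNorm_eq_norm] at *
  have h3 := norm_add_le (NormedSpace.exp X - 1) 1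
  rw [sub_add_cancel] at h3
  linarith

/-! ### Conjugation by the Cayley matrix -/

/-- The real matrix `M⁻¹ (it, ν; ν̄, -it) M`. -/
noncomputable def su11Real (t : ℝ) (ν : ℂ) : Matrix (Fin 2) (Fin 2) ℝ :=
  !![ν.re, t - ν.im; -t - ν.im, -ν.re]

theorem cayleyM_mul : !![Complex.I, Complex.I; -1, 1] * cayleyM = 1 := by
  have : (2 * Complex.I) ≠ 0 := by simp
  ext i j
  fin_cases i <;> fin_cases j <;> simp [cayleyM, Matrix.mul_apply, Fin.sum_univ_two]
  all_goals
    field_simp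
    norm_num

theorem cayleyM_inv : cayleyM⁻¹ = !![Complex.I, Complex.I; -1, 1] :=
  Matrix.inv_eq_left_inv cayleyM_mul

theorem matC_su11Real (t : ℝ) (ν : ℂ) :
    matC (su11Real t ν) = cayleyM⁻¹ * su11 t ν * cayleyM := by
  obtain ⟨a, b⟩ := ν
  have h : (2 * Complex.I) ≠ 0 := by simp
  have hc : (starRingEnd ℂ) ⟨a, b⟩ = a - b * Complex.I := by
    apply Complex.ext <;> simp
  have hν : (⟨a, b⟩ : ℂ) = a + b * Complex.I := by apply Complex.ext <;> simp
  rw [cayleyM_inv]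
  ext i j
  fin_cases i <;> fin_cases j <;>
    simp [matC, su11Real, su11, cayleyM, Matrix.mul_apply, Fin.sum_univ_two, hc]
  all_goals
    rw [hν]
    field_simp
    ring_nf
    simp [Complex.I_sq]
    try ring

theorem eq_exp_su11Real {A : Matrix (Fin 2) (Fin 2) ℝ} {t : ℝ} {ν : ℂ}
    (hA : matC A = cayleyM⁻¹ * NormedSpace.exp (su11 t ν) * cayleyM) :
    A = NormedSpace.exp (su11Real t ν) := by
  let _ : NormedAlgebra ℚ ℂ := .restrictScalars ℚ ℝ _
  refine matC_injective ?_
  rw [matC_exp, matC_su11Real, hA]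
  refine (Matrix.exp_conj' _ _ ?_).symm
  rw [Matrix.isUnit_iff_isUnit_det]
  exact Matrix.isUnit_det_of_left_inverse cayleyM_mul

/-- Parabolic and hyperbolic elements: `su11Real t ν` has the real eigenvalue `√(|ν|² - t²)`. -/
theorem exists_real_eigenvector {t : ℝ} {ν : ℂ} (h : t ^ 2 ≤ ‖ν‖ ^ 2) :
    ∃ (v : Fin 2 → ℝ) (a : ℝ), v ≠ 0 ∧ 0 < a ∧
      (NormedSpace.exp (su11Real t ν)).mulVec v = a • v := by
  set q := Real.sqrt (‖ν‖ ^ 2 - t ^ 2) with hq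
  have hq2 : q ^ 2 = ‖ν‖ ^ 2 - t ^ 2 := Real.sq_sqrt (by linarith)
  rw [sq_norm_re_im] at hq2
  obtain ⟨v, hv, hXv⟩ := (Matrix.exists_mulVec_eq_zero_iff
    (M := su11Real t ν - q • (1 : Matrix (Fin 2) (Fin 2) ℝ))).2 (by
      simp [Matrix.det_fin_two, su11Real]
      linear_combination hq2)
  refine ⟨v, Real.exp q, hv, Real.exp_pos _, ?_⟩
  rw [Matrix.sub_mulVec, Matrix.smul_mulVec, Matrix.one_mulVec, sub_eq_zero] at hXv
  have h1 : (matC (su11Real t ν)).mulVec (fun i => (v i : ℂ)) = (q : ℂ) • fun i => (v i : ℂ) := by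
    rw [matC_mulVec_ofReal, hXv]; ext i; simp
  have h2 := exp_mulVec_eigenvector h1
  rw [← matC_exp, matC_mulVec_ofReal] at h2
  ext i
  have := congr_fun h2 i
  simp only [Pi.smul_apply, smul_eq_mul, ← Complex.ofReal_exp] at this ⊢
  exact_mod_cast this

/-- The vector `p (1, -i) + r (1, i)`, in terms of the eigenvectors of the rotations. -/
noncomputable def rotVec (p r : ℂ) : Fin 2 → ℂ := ![p + r, -Complex.I * p + Complex.I * r]

/-- The spectral data of an elliptic element: the eigenvalue `e^{iφ}` for which the eigenvector is
dominated by the first eigenvector of the rotations, and the corresponding eigenfunctional. -/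
theorem exists_elliptic_data {t : ℝ} {ν : ℂ} (h : ‖ν‖ ^ 2 < t ^ 2) :
    ∃ (φ : ℝ) (p r c₁ c₂ : ℂ), φ ≠ 0 ∧ p ≠ 0 ∧ 2 * |φ| * ‖r‖ ≤ ‖ν‖ * ‖p‖ ∧ ‖c₂‖ < ‖c₁‖ ∧
      (matC (NormedSpace.exp (su11Real t ν))).mulVec (rotVec p r) =
        Complex.exp (φ * Complex.I) • rotVec p r ∧
      ∀ w, zeta c₁ c₂ ((matC (NormedSpace.exp (su11Real t ν))).mulVec w) =
        Complex.exp (φ * Complex.I) * zeta c₁ c₂ w := by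
  -- the sign of `φ` is opposite to that of `t`, so that `|φ - t| = |φ| + |t|`
  obtain ⟨φ, hφ0, hφ2, hφt⟩ : ∃ φ : ℝ, φ ≠ 0 ∧ φ ^ 2 = t ^ 2 - ‖ν‖ ^ 2 ∧ φ * t ≤ 0 := by
    have hs : 0 < Real.sqrt (t ^ 2 - ‖ν‖ ^ 2) := Real.sqrt_pos.2 (by linarith)
    have hs2 : Real.sqrt (t ^ 2 - ‖ν‖ ^ 2) ^ 2 = t ^ 2 - ‖ν‖ ^ 2 := Real.sq_sqrt (by linarith)
    rcases le_total 0 t with ht | ht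
    · exact ⟨-Real.sqrt (t ^ 2 - ‖ν‖ ^ 2), neg_ne_zero.2 hs.ne',
        by rw [neg_sq, hs2], by nlinarith⟩
    · exact ⟨Real.sqrt (t ^ 2 - ‖ν‖ ^ 2), hs.ne', hs2, by nlinarith⟩
  have hφpos : 0 < |φ| := abs_pos.2 hφ0
  have hnorm : ‖Complex.I * (φ - t)‖ = |φ - t| := by
    rw [norm_mul, Complex.norm_I, one_mul, ← Complex.ofReal_sub, Complex.norm_real,
      Real.norm_eq_abs]
  have habs : 0 < |φ - t| := abs_pos.2 (sub_ne_zero.2 fun hh => by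
    rw [hh] at hφt hφ0
    nlinarith [mul_self_pos.2 hφ0])
  have h2φ : 2 * |φ| ≤ |φ - t| := by
    refine abs_le_of_sq_le_sq' ?_ habs.le |>.2
    rw [mul_pow, sq_abs, sq_abs]
    nlinarith [norm_nonneg ν, sq_nonneg ‖ν‖, abs_nonneg φ, sq_abs φ, sq_nonneg (φ + t)]
  have hν : ‖ν‖ < |φ - t| := by
    refine abs_lt_of_sq_lt_sq (a := ‖ν‖) ?_ habs.le |>.trans_le' (le_abs_self _)
    rw [sq_abs]
    nlinarith [sq_nonneg φ, (sq_pos_of_ne_zero hφ0 : 0 < φ ^ 2)]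
  have hsq : (φ : ℂ) ^ 2 = t ^ 2 - (ν.re ^ 2 + ν.im ^ 2) := by
    rw [sq_norm_re_im] at hφ2; exact_mod_cast hφ2
  have hνe : ν = ν.re + ν.im * Complex.I := (Complex.re_add_im ν).symm
  have hνc : (starRingEnd ℂ) ν = ν.re - ν.im * Complex.I := by apply Complex.ext <;> simp
  refine ⟨φ, Complex.I * (φ - t), ν, Complex.I * (φ - t), (starRingEnd ℂ) ν, hφ0,
    norm_pos_iff.1 (hnorm ▸ habs), ?_, ?_, ?_, ?_⟩
  · rw [hnorm, mul_comm ‖ν‖]; gcongr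
  · rw [hnorm, RCLike.norm_conj]; exact hν
  · rw [matC_exp]
    refine exp_mulVec_eigenvector ?_
    ext i
    fin_cases i <;>
      simp [matC, su11Real, rotVec, Matrix.mulVec, dotProduct, Fin.sum_univ_two]
    all_goals
      have hI := Complex.I_sq
      generalize ν.re = a at *
      generalize ν.im = b at *
      rw [hνe]
      grind
  · intro w
    have hT : (matC (su11Real t ν)).transpose.mulVec
        ![Complex.I * (φ - t) + (starRingEnd ℂ) ν,
          Complex.I * (Complex.I * (φ - t) - (starRingEnd ℂ) ν)] = (φ * Complex.I) •
        ![Complex.I * (φ - t) + (starRingEnd ℂ) ν,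
          Complex.I * (Complex.I * (φ - t) - (starRingEnd ℂ) ν)] := by
      rw [hνc]
      ext i
      fin_cases i <;>
        simp [matC, su11Real, Matrix.mulVec, dotProduct, Fin.sum_univ_two]
      all_goals
        have hI := Complex.I_sq
        generalize ν.re = a at *
        generalize ν.im = b at *
        grind
    have h1 := exp_mulVec_eigenvector hT
    let _ : NormedAlgebra ℚ ℂ := .restrictScalars ℚ ℝ _
    rw [Matrix.exp_transpose, ← matC_exp, Matrix.mulVec_transpose] at h1
    have hz : ∀ w, zeta (Complex.I * (φ - t)) ((starRingEnd ℂ) ν) w =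
        ![Complex.I * (φ - t) + (starRingEnd ℂ) ν,
          Complex.I * (Complex.I * (φ - t) - (starRingEnd ℂ) ν)] ⬝ᵥ w := fun w => by
      simp [zeta, dotProduct, Fin.sum_univ_two]; ring
    rw [hz, hz, Matrix.dotProduct_mulVec, h1, smul_dotProduct, smul_eq_mul]

/-! ### Projections to the eigenvectors of the rotations -/

/-- A `2 × 2` matrix of determinant one has the same norm as its inverse. -/
theorem norm_le_opNorm_mul_of_det_eq_one {B : Matrix (Fin 2) (Fin 2) ℂ} (hB : B.det = 1)
    (v : Fin 2 → ℂ) : ‖WithLp.toLp 2 v‖ ≤ opNorm B * ‖WithLp.toLp 2 (B.mulVec v)‖ := by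
  -- `w` is orthogonal to `v`, with `det (v, w) = |v|²` and `|w| = |v|`
  let w : Fin 2 → ℂ := ![-(starRingEnd ℂ) (v 1), (starRingEnd ℂ) (v 0)]
  have hw : ‖WithLp.toLp 2 w‖ = ‖WithLp.toLp 2 v‖ := by
    have : ‖WithLp.toLp 2 w‖ ^ 2 = ‖WithLp.toLp 2 v‖ ^ 2 := by
      rw [norm_sq_toLp, norm_sq_toLp]; simp [w, add_comm]
    exact (sq_eq_sq₀ (norm_nonneg _) (norm_nonneg _)).1 this
  have hdet : ∀ a b : Fin 2 → ℂ, ‖a 0 * b 1 - a 1 * b 0‖ ≤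
      ‖WithLp.toLp 2 a‖ * ‖WithLp.toLp 2 b‖ := fun a b => by
    have h1 : ‖a 0 * b 1 - a 1 * b 0‖ ≤ ‖a 0‖ * ‖b 1‖ + ‖a 1‖ * ‖b 0‖ := by
      rw [← norm_mul, ← norm_mul]; exact norm_sub_le _ _
    refine h1.trans (abs_le_of_sq_le_sq' ?_ (by positivity)).2
    rw [mul_pow, norm_sq_toLp, norm_sq_toLp]
    nlinarith [sq_nonneg (‖a 0‖ * ‖b 0‖ - ‖a 1‖ * ‖b 1‖)]
  have h1 := hdet (B.mulVec v) (B.mulVec w)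
  have h2 : B.mulVec v 0 * B.mulVec w 1 - B.mulVec v 1 * B.mulVec w 0 =
      ((‖WithLp.toLp 2 v‖ ^ 2 : ℝ) : ℂ) := by
    rw [norm_sq_toLp]
    push_cast
    rw [← Complex.conj_mul', ← Complex.conj_mul']
    rw [Matrix.det_fin_two] at hB
    simp only [Matrix.mulVec, dotProduct, Fin.sum_univ_two, w, Matrix.cons_val_zero,
      Matrix.cons_val_one]
    linear_combination ((starRingEnd ℂ) (v 0) * v 0 + (starRingEnd ℂ) (v 1) * v 1) * hB
  rw [h2, Complex.norm_real, Real.norm_of_nonneg (by positivity)] at h1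
  have h3 := norm_mulVec_le B w
  rw [hw] at h3
  rcases (norm_nonneg (WithLp.toLp 2 v)).eq_or_lt with h0 | h0
  · rw [← h0]; exact mul_nonneg (norm_nonneg _) (norm_nonneg _)
  · have h4 := h1.trans (mul_le_mul_of_nonneg_left h3 (norm_nonneg _))
    refine le_of_mul_le_mul_right ?_ h0
    nlinarith

theorem opNorm_rot_ofReal (x : ℝ) : opNorm (rot x) = 1 := by
  have h1 : star (rot x) * rot x = 1 := by
    have : star (rot x) = matC (rotR (-x)) := by
      rw [← matC_rotR]
      ext i j; fin_cases i <;> fin_cases j <;>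
        simp [matC, rotR, Matrix.star_apply, Complex.conj_ofNat, ← Complex.cos_conj, ← Complex.sin_conj]
    rw [this, ← matC_rotR, ← matC_mul, rotR_mul, neg_add_cancel, rotR_zero, matC_one]
  have h2 := CStarRing.norm_star_mul_self (x := rot x)
  rw [h1, CStarRing.norm_one] at h2
  rw [opNorm_eq_norm]
  nlinarith [norm_nonneg (rot (x : ℂ))]

theorem opNorm_mul_le (A B : Matrix (Fin 2) (Fin 2) ℂ) : opNorm (A * B) ≤ opNorm A * opNorm B := by
  simp only [opNorm_eq_norm]; exact norm_mul_le A B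

/-- The orthogonal projection of `ℂ²` to the eigenvector `(1, -i)` of the rotations. -/
noncomputable def projPos : Matrix (Fin 2) (Fin 2) ℂ := (1 / 2 : ℂ) • !![1, Complex.I; -Complex.I, 1]

/-- The orthogonal projection of `ℂ²` to the eigenvector `(1, i)` of the rotations. -/
noncomputable def projNeg : Matrix (Fin 2) (Fin 2) ℂ := (1 / 2 : ℂ) • !![1, -Complex.I; Complex.I, 1]

theorem rot_eq (z : ℂ) : rot z = Complex.exp (2 * Real.pi * z * Complex.I) • projPos +
    Complex.exp (-(2 * Real.pi * z * Complex.I)) • projNeg := by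
  rw [← neg_mul, Complex.exp_mul_I, Complex.exp_mul_I]
  have hI := Complex.I_sq
  ext i j
  fin_cases i <;> fin_cases j <;> simp [rot, projPos, projNeg] <;> grind

theorem opNorm_le_one_of_proj {P : Matrix (Fin 2) (Fin 2) ℂ} (hP : star P * P = P) :
    opNorm P ≤ 1 := by
  have h2 := CStarRing.norm_star_mul_self (x := P)
  rw [hP] at h2
  rw [opNorm_eq_norm]
  nlinarith [norm_nonneg P]

theorem opNorm_projPos : opNorm projPos ≤ 1 := by
  refine opNorm_le_one_of_proj ?_
  have hI := Complex.I_sq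
  ext i j
  fin_cases i <;> fin_cases j <;>
    simp [projPos, Matrix.mul_apply, Fin.sum_univ_two, Matrix.star_apply, Complex.conj_ofNat] <;> grind

theorem opNorm_projNeg : opNorm projNeg ≤ 1 := by
  refine opNorm_le_one_of_proj ?_
  have hI := Complex.I_sq
  ext i j
  fin_cases i <;> fin_cases j <;>
    simp [projNeg, Matrix.mul_apply, Fin.sum_univ_two, Matrix.star_apply, Complex.conj_ofNat] <;> grind

theorem projNeg_rotVec (p r : ℂ) : projNeg.mulVec (rotVec p r) = rotVec 0 r := by
  have hI := Complex.I_sq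
  ext i
  fin_cases i <;> simp [projNeg, rotVec, Matrix.mulVec, dotProduct,
    Fin.sum_univ_two] <;> grind

theorem norm_sq_rotVec (p r : ℂ) : ‖WithLp.toLp 2 (rotVec p r)‖ ^ 2 = 2 * (‖p‖ ^ 2 + ‖r‖ ^ 2) := by
  rw [norm_sq_toLp]
  simp only [sq_norm_re_im, rotVec, Matrix.cons_val_zero, Matrix.cons_val_one]
  simp
  ring

theorem differentiableOn_exp_entry {d : ℕ} {s : Set (Fin d → ℂ)}
    {Y : (Fin d → ℂ) → Matrix (Fin 2) (Fin 2) ℂ}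
    (hY : ∀ a b, DifferentiableOn ℂ (fun z => Y z a b) s) (a b : Fin 2) :
    DifferentiableOn ℂ (fun z => NormedSpace.exp (Y z) a b) s := by
  have h1 : DifferentiableOn ℂ Y s := by
    have : Y = fun z => ∑ i, ∑ j, Y z i j • (Matrix.single i j 1 : Matrix (Fin 2) (Fin 2) ℂ) := by
      funext z
      conv_lhs => rw [Matrix.matrix_eq_sum_single (Y z)]
      simp [Matrix.smul_single]
    rw [this]
    fun_prop
  have h2 : DifferentiableOn ℂ (fun z => NormedSpace.exp (Y z)) s :=
    fun z hz => ((NormedSpace.exp_analytic (𝕂 := ℂ) (Y z)).differentiableAt).comp_differentiableWithinAt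
      z (h1 z hz)
  let L : Matrix (Fin 2) (Fin 2) ℂ →L[ℂ] ℂ :=
    LinearMap.toContinuousLinearMap (Matrix.entryLinearMap ℂ ℂ a b)
  exact L.differentiable.comp_differentiableOn h2

/-! ### Fourier coefficients and Aubry duality -/

theorem mFourierCoeff_translate {d : ℕ} (g : UnitAddTorus (Fin d) → ℂ) (a : Fin d → ℝ)
    (k : Fin d → ℤ) : UnitAddTorus.mFourierCoeff (fun x => g (x + toTorus a)) k =
      Complex.exp (2 * Real.pi * Complex.I * (pair k a : ℝ)) * UnitAddTorus.mFourierCoeff g k := by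
  simp only [UnitAddTorus.mFourierCoeff, smul_eq_mul]
  rw [← integral_add_right_eq_self (μ := (volume : Measure (UnitAddTorus (Fin d))))
    (fun x => UnitAddTorus.mFourier (-k) x * g x) (toTorus a), ← integral_const_mul]
  congr 1; ext x
  obtain ⟨x, rfl⟩ := (isOpenQuotientMap_toTorus d).surjective x
  rw [← toTorus_add, mFourier_toTorus, mFourier_toTorus, ← mul_assoc, ← Complex.exp_add, pair_add]
  congr 2
  simp [pair, Finset.sum_neg_distrib]
  ring

/-- The Fourier coefficients of a product of continuous functions are given by an unconditionally
convergent convolution: this is Parseval's identity for `conj (e_{-k} f)` and `g`. -/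
theorem hasSum_convolution {d : ℕ} (f g : C(UnitAddTorus (Fin d), ℂ)) (k : Fin d → ℤ) :
    HasSum (fun j => UnitAddTorus.mFourierCoeff g j * UnitAddTorus.mFourierCoeff f (k - j))
      (UnitAddTorus.mFourierCoeff (fun x => g x * f x) k) := by
  let F : C(UnitAddTorus (Fin d), ℂ) := star (UnitAddTorus.mFourier (-k) * f)
  have h := UnitAddTorus.hasSum_prod_mFourierCoeff (F.toLp 2 volume ℂ) (g.toLp 2 volume ℂ)
  simp only [UnitAddTorus.mFourierCoeff_toLp] at h
  have h1 : ∫ t, (starRingEnd ℂ) (F.toLp 2 volume ℂ t) * (g.toLp 2 volume ℂ t) =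
      UnitAddTorus.mFourierCoeff (fun x => g x * f x) k := by
    rw [UnitAddTorus.mFourierCoeff]
    refine integral_congr_ae ?_
    filter_upwards [ContinuousMap.coeFn_toLp (p := 2) (𝕜 := ℂ) volume F,
      ContinuousMap.coeFn_toLp (p := 2) (𝕜 := ℂ) volume g] with x hx hx'
    rw [hx, hx']
    simp [F]
    ring
  rw [h1] at h
  refine h.congr_fun fun j => ?_
  rw [mul_comm]
  congr 1
  simp only [UnitAddTorus.mFourierCoeff]
  rw [← integral_conj]
  congr 1; ext x
  have e : UnitAddTorus.mFourier (-(k - j)) x =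
      UnitAddTorus.mFourier j x * UnitAddTorus.mFourier (-k) x := by
    rw [← UnitAddTorus.mFourier_add]; congr 2; abel
  simp only [F, ContinuousMap.star_apply, ContinuousMap.mul_apply, smul_eq_mul, e, map_mul,
    UnitAddTorus.mFourier_neg, Complex.conj_conj, RCLike.star_def]
  ring

theorem mFourierCoeff_sub {d : ℕ} {f g : UnitAddTorus (Fin d) → ℂ} (hf : Continuous f)
    (hg : Continuous g) (k : Fin d → ℤ) : UnitAddTorus.mFourierCoeff (fun x => f x - g x) k =
      UnitAddTorus.mFourierCoeff f k - UnitAddTorus.mFourierCoeff g k := by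
  have hi : ∀ {f : UnitAddTorus (Fin d) → ℂ}, Continuous f →
      Integrable (fun x => UnitAddTorus.mFourier (-k) x * f x) := fun hf =>
    ((map_continuous _).mul hf).integrable_of_hasCompactSupport (HasCompactSupport.of_compactSpace _)
  simp only [UnitAddTorus.mFourierCoeff, smul_eq_mul, mul_sub]
  exact integral_sub (hi hf) (hi hg)

theorem mFourierCoeff_add {d : ℕ} {f g : UnitAddTorus (Fin d) → ℂ} (hf : Continuous f)
    (hg : Continuous g) (k : Fin d → ℤ) : UnitAddTorus.mFourierCoeff (fun x => f x + g x) k =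
      UnitAddTorus.mFourierCoeff f k + UnitAddTorus.mFourierCoeff g k := by
  have hi : ∀ {f : UnitAddTorus (Fin d) → ℂ}, Continuous f →
      Integrable (fun x => UnitAddTorus.mFourier (-k) x * f x) := fun hf =>
    ((map_continuous _).mul hf).integrable_of_hasCompactSupport (HasCompactSupport.of_compactSpace _)
  simp only [UnitAddTorus.mFourierCoeff, smul_eq_mul, mul_add]
  exact integral_add (hi hf) (hi hg)

theorem mFourierCoeff_const_mul {d : ℕ} (f : UnitAddTorus (Fin d) → ℂ) (c : ℂ) (k : Fin d → ℤ) :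
    UnitAddTorus.mFourierCoeff (fun x => c * f x) k = c * UnitAddTorus.mFourierCoeff f k := by
  simp only [UnitAddTorus.mFourierCoeff, smul_eq_mul, ← integral_const_mul]
  congr 1; ext x; ring

theorem mFourierCoeff_mFourier_mul {d : ℕ} (f : UnitAddTorus (Fin d) → ℂ) (l k : Fin d → ℤ) :
    UnitAddTorus.mFourierCoeff (fun x => UnitAddTorus.mFourier (-l) x * f x) k =
      UnitAddTorus.mFourierCoeff f (k + l) := by
  simp only [UnitAddTorus.mFourierCoeff, smul_eq_mul]
  congr 1; ext x
  rw [neg_add, UnitAddTorus.mFourier_add]; ring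

/-- Aubry duality: if `(c₀, c₁)` is a Bloch wave of the Schrödinger cocycle, with Floquet exponent
`ρ`, then the Fourier coefficients of `c₀` satisfy the eigenvalue equation of the dual long-range
operator. -/
theorem longRange_eq_of_bloch {d : ℕ} {α : Fin d → ℝ} {h : ℝ} (hh : 0 < h)
    {V : (Fin d → ℂ) → ℂ} (hV : IsAnalyticReal h V) {lam : ℝ} (hlam : lam ≠ 0) {E ρ : ℝ}
    (c₀ c₁ : C(UnitAddTorus (Fin d), ℂ))
    (h0 : ∀ x, c₀ (toTorus x) = Complex.exp (2 * Real.pi * Complex.I * ρ) * c₁ (toTorus (x + α)))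
    (h1 : ∀ x, (E - (lam : ℂ)⁻¹ * V (toC x)) * c₀ (toTorus x) - c₁ (toTorus x) =
      Complex.exp (2 * Real.pi * Complex.I * ρ) * c₀ (toTorus (x + α))) (k : Fin d → ℤ) :
    (∑' j, fourierCoef V j * UnitAddTorus.mFourierCoeff c₀ (k - j)) +
      2 * (lam : ℂ) * ((Real.cos (2 * Real.pi * (ρ + pair k α)) : ℝ) : ℂ) *
        UnitAddTorus.mFourierCoeff c₀ k = ((lam * E : ℝ) : ℂ) * UnitAddTorus.mFourierCoeff c₀ k := by
  have hlam' : (lam : ℂ) ≠ 0 := Complex.ofReal_ne_zero.2 hlam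
  have hcV : Continuous fun x : Fin d → ℝ => V (toC x) :=
    hV.analytic.continuousOn.comp_continuous (by unfold toC; fun_prop) (toC_mem_strip hh)
  obtain ⟨g, hg⟩ := exists_descent hcV fun j x => by
    rw [toC_add, toC_single]; exact hV.periodic j _ (toC_mem_strip hh x)
  have hsum := (hasSum_convolution c₀ g k).tsum_eq
  simp only [← fourierCoef_eq hg] at hsum
  rw [hsum]
  set w := Complex.exp (2 * Real.pi * Complex.I * ((ρ + pair k α : ℝ) : ℂ)) with hw
  have hw' : w = Complex.exp (2 * Real.pi * Complex.I * ρ) *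
      Complex.exp (2 * Real.pi * Complex.I * (pair k α : ℝ)) := by
    rw [hw, ← Complex.exp_add]; push_cast; ring_nf
  have hw0 : w ≠ 0 := Complex.exp_ne_zero _
  have hcos : 2 * ((Real.cos (2 * Real.pi * (ρ + pair k α)) : ℝ) : ℂ) = w + w⁻¹ := by
    rw [hw, ← Complex.exp_neg, Complex.ofReal_cos, Complex.two_cos]
    push_cast; ring_nf
  have e0 : UnitAddTorus.mFourierCoeff c₀ k = w * UnitAddTorus.mFourierCoeff c₁ k := by
    rw [hw', mul_assoc, ← mFourierCoeff_translate, ← mFourierCoeff_const_mul]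
    congr 1; ext x
    obtain ⟨x, rfl⟩ := (isOpenQuotientMap_toTorus d).surjective x
    rw [h0, toTorus_add]
  have e1 : E * UnitAddTorus.mFourierCoeff c₀ k -
      (lam : ℂ)⁻¹ * UnitAddTorus.mFourierCoeff (fun x => g x * c₀ x) k -
        UnitAddTorus.mFourierCoeff c₁ k = w * UnitAddTorus.mFourierCoeff c₀ k := by
    rw [hw', mul_assoc, ← mFourierCoeff_translate, ← mFourierCoeff_const_mul,
      ← mFourierCoeff_const_mul, ← mFourierCoeff_const_mul, ← mFourierCoeff_sub (by fun_prop)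
      (by fun_prop), ← mFourierCoeff_sub (by fun_prop) (by fun_prop)]
    congr 1; ext x
    obtain ⟨x, rfl⟩ := (isOpenQuotientMap_toTorus d).surjective x
    rw [← toTorus_add, ← h1, hg]; ring
  have e2 : UnitAddTorus.mFourierCoeff c₁ k = w⁻¹ * UnitAddTorus.mFourierCoeff c₀ k := by
    rw [e0, inv_mul_cancel_left₀ hw0]
  rw [e2] at e1
  have e3 : (lam : ℂ) * (lam : ℂ)⁻¹ = 1 := mul_inv_cancel₀ hlam'
  rw [Complex.ofReal_mul lam E]
  linear_combination (lam * UnitAddTorus.mFourierCoeff c₀ k) * hcos - lam * e1 -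
    UnitAddTorus.mFourierCoeff (fun x => g x * c₀ x) k * e3

theorem norm_sq_toLp_eq_integral {d : ℕ} (c : C(UnitAddTorus (Fin d), ℂ)) :
    ‖ContinuousMap.toLp 2 volume ℂ c‖ ^ 2 = ∫ x, ‖c x‖ ^ 2 := by
  have h1 := ContinuousMap.inner_toLp (𝕜 := ℂ) (volume : Measure (UnitAddTorus (Fin d))) c c
  rw [inner_self_eq_norm_sq_to_K] at h1
  have h2 : ∀ x, c x * (starRingEnd ℂ) (c x) = ((‖c x‖ ^ 2 : ℝ) : ℂ) := fun x => by
    rw [Complex.mul_conj']; push_cast; rfl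
  simp only [h2, integral_complex_ofReal] at h1
  exact Complex.ofReal_injective (by simpa using h1)

/-- If `|c₀(x)| = |c₁(x + α)|` everywhere, then `c₀` carries half of the `L²` mass of
`(c₀, c₁)`. -/
theorem le_norm_sq_toLp {d : ℕ} {α : Fin d → ℝ} {δ : ℝ} {c₀ c₁ : C(UnitAddTorus (Fin d), ℂ)}
    (h0 : ∀ x, ‖c₀ (toTorus x)‖ = ‖c₁ (toTorus (x + α))‖)
    (hδ : ∀ x, δ ≤ ‖c₀ (toTorus x)‖ ^ 2 + ‖c₁ (toTorus x)‖ ^ 2) :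
    δ ≤ 2 * ‖ContinuousMap.toLp 2 volume ℂ c₀‖ ^ 2 := by
  have hi : ∀ c : C(UnitAddTorus (Fin d), ℂ), Integrable fun x => ‖c x‖ ^ 2 := fun c =>
    (show Continuous fun x => ‖c x‖ ^ 2 by fun_prop).integrable_of_hasCompactSupport
      (HasCompactSupport.of_compactSpace _)
  have h1 : ∫ x, ‖c₀ x‖ ^ 2 = ∫ x, ‖c₁ x‖ ^ 2 := by
    rw [← integral_add_right_eq_self (μ := (volume : Measure (UnitAddTorus (Fin d))))
      (fun x => ‖c₁ x‖ ^ 2) (toTorus α)]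
    congr 1; ext x
    obtain ⟨x, rfl⟩ := (isOpenQuotientMap_toTorus d).surjective x
    rw [h0, toTorus_add]
  rw [norm_sq_toLp_eq_integral]
  calc δ = ∫ _x : UnitAddTorus (Fin d), δ := by simp
    _ ≤ ∫ x, (‖c₀ x‖ ^ 2 + ‖c₁ x‖ ^ 2) := by
        refine integral_mono (integrable_const _) ((hi _).add (hi _)) fun x => ?_
        obtain ⟨x, rfl⟩ := (isOpenQuotientMap_toTorus d).surjective x
        exact hδ x
    _ = 2 * ∫ x, ‖c₀ x‖ ^ 2 := by rw [integral_add (hi _) (hi _), ← h1]; ring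

/-- The entries of `e^{-πi⟨l₀,z⟩} B̃(z) P e^{Y(z)} v`, where `deg B̃ = l₀`, are functions on the
torus whose Fourier coefficients decay exponentially. -/
theorem exists_component {d : ℕ} {h : ℝ} (hh : 0 < h)
    {Bt Y : (Fin d → ℂ) → Matrix (Fin 2) (Fin 2) ℂ} {l₀ : Fin d → ℤ} (hBt : IsAnalyticPSL h Bt)
    (hdeg : HasDegree Bt l₀) (hY : IsAnalyticSl h Y) (P : Matrix (Fin 2) (Fin 2) ℂ)
    (v : Fin 2 → ℂ) {M : ℝ}
    (hM : ∀ z ∈ strip d h, ‖WithLp.toLp 2 (P.mulVec ((NormedSpace.exp (Y z)).mulVec v))‖ ≤ M)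
    (i : Fin 2) :
    ∃ g : C(UnitAddTorus (Fin d), ℂ),
      (∀ x, g (toTorus x) = Complex.exp (-(Real.pi * Complex.I * pairC l₀ (toC x))) *
        (Bt (toC x)).mulVec (P.mulVec ((NormedSpace.exp (Y (toC x))).mulVec v)) i) ∧
      ∀ k, ‖UnitAddTorus.mFourierCoeff g k‖ ≤
        stripNorm h Bt ^ 2 * M * Real.exp (-(2 * Real.pi * h) * len k) := by
  let G : (Fin d → ℂ) → ℂ := fun z => Complex.exp (-(Real.pi * Complex.I * pairC l₀ z)) *
    (Bt z).mulVec (P.mulVec ((NormedSpace.exp (Y z)).mulVec v)) i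
  have hexp := differentiableOn_exp_entry fun a b => (hY.analytic a b).differentiableOn
  have hbt := hBt.differentiableOn
  have hpair : Differentiable ℂ (pairC l₀) := by unfold pairC; fun_prop
  have hGd : DifferentiableOn ℂ G (strip d h) := by
    simp only [G, Matrix.mulVec, dotProduct]
    fun_prop
  have hGp : ∀ j, ∀ z ∈ strip d h, G (z + Pi.single j 1) = G z := fun j z hz => by
    have := congrArg (fun A : Matrix (Fin 2) (Fin 2) ℂ =>
      A.mulVec (P.mulVec ((NormedSpace.exp (Y z)).mulVec v)) i)
      (hBt.periodic_exp_smul hh hdeg j z hz)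
    simpa only [G, hY.periodic j z hz, Matrix.smul_mulVec, Pi.smul_apply, smul_eq_mul] using this
  have hGb : ∀ z ∈ strip d h, ‖G z‖ ≤ stripNorm h Bt ^ 2 * M := fun z hz => by
    have h1 : ‖Complex.exp (-(Real.pi * Complex.I * pairC l₀ z))‖ ≤ stripNorm h Bt := by
      refine le_trans ?_ (exp_le_stripNorm hh hBt hdeg)
      rw [Complex.norm_exp]
      refine Real.exp_le_exp.2 ?_
      have e : (-(Real.pi * Complex.I * pairC l₀ z)).re = Real.pi * ∑ j, (l₀ j : ℝ) * (z j).im := by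
        simp [pairC, Complex.im_sum]
      rw [e, mul_assoc]
      refine mul_le_mul_of_nonneg_left ?_ Real.pi_pos.le
      rw [len, Finset.sum_mul]
      refine Finset.sum_le_sum fun j _ => ?_
      refine (le_abs_self _).trans ?_
      rw [abs_mul]
      exact mul_le_mul_of_nonneg_left (hz j).le (abs_nonneg _)
    have h2 : ‖(Bt z).mulVec (P.mulVec ((NormedSpace.exp (Y z)).mulVec v)) i‖ ≤
        stripNorm h Bt * M :=
      (PiLp.norm_apply_le (WithLp.toLp 2 _) i).trans ((norm_mulVec_le _ _).trans
        (mul_le_mul (opNorm_le_stripNorm hBt.bounded hz) (hM z hz) (norm_nonneg _)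
          (zero_le_one.trans (one_le_stripNorm hh hBt))))
    rw [norm_mul, sq, mul_assoc (stripNorm h Bt)]
    exact mul_le_mul h1 h2 (norm_nonneg _) ((norm_nonneg _).trans h1)
  obtain ⟨g, hg⟩ := exists_descent (f := fun x : Fin d → ℝ => G (toC x))
    (hGd.continuousOn.comp_continuous (by unfold toC; fun_prop) (toC_mem_strip hh)) fun j x => by
      simp only [toC_add, toC_single]; exact hGp j _ (toC_mem_strip hh x)
  exact ⟨g, hg, norm_mFourierCoeff_le hh hGd hGp hGb g.continuous hg⟩

/-- A Bloch wave `b = B̃ R_{⟨l,·⟩/2} e^Y v` of the Schrödinger cocycle yields a good eigenfunction of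
the dual operator: its Fourier coefficients, normalized. The component of `e^Y v` along `(1, -i)`
produces the peak at `0`, the component along `(1, i)` the one at `-l`. -/
theorem hasGoodEigenfunction_of_bloch {d : ℕ} {α : Fin d → ℝ} {h h' : ℝ} (hh' : 0 < h')
    (hh : h' < h) {V : (Fin d → ℂ) → ℂ} (hV : IsAnalyticReal h V) {lam : ℝ} (hlam : lam ≠ 0)
    {E ρ : ℝ} {Bt Y : (Fin d → ℂ) → Matrix (Fin 2) (Fin 2) ℂ} {l l₀ : Fin d → ℤ}
    (hBt : IsAnalyticPSL h' Bt) (hdeg : HasDegree Bt l₀) (hY : IsAnalyticSl h' Y)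
    (hYnorm : stripNorm h' Y ≤ 1 / 2)
    {v : Fin 2 → ℂ} (hv : 0 < ‖WithLp.toLp 2 v‖) {b : (Fin d → ℝ) → Fin 2 → ℂ}
    (hb : ∀ x, b x = (Bt (toC x)).mulVec ((rot (pairC l (toC x) / 2)).mulVec
      ((NormedSpace.exp (Y (toC x))).mulVec v)))
    (hdet : ∀ x, (Bt (toC x) * rot (pairC l (toC x) / 2) * NormedSpace.exp (Y (toC x))).det = 1)
    (hbloch : ∀ x, (schrodinger V lam E x).mulVec (b x) =
      Complex.exp (2 * Real.pi * Complex.I * (ρ - pair (l + l₀) α / 2 : ℝ)) • b (x + α))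
    {C' : ℝ} (hC' : ∀ z ∈ strip d h', ‖WithLp.toLp 2
      (projNeg.mulVec ((NormedSpace.exp (Y z)).mulVec v))‖ ≤
        Real.exp (1 / 2) * C' * ‖WithLp.toLp 2 v‖) :
    HasGoodEigenfunction V lam α ρ (lam * E) (2 * Real.pi * h') l (8 * stripNorm h' Bt ^ 4) C' := by
  set K := stripNorm h' Bt with hK
  have hK1 : 1 ≤ K := one_le_stripNorm hh' hBt
  have hexpY : ∀ z ∈ strip d h', opNorm (NormedSpace.exp (Y z)) ≤ Real.exp (1 / 2) := fun z hz =>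
    (opNorm_exp_le _).trans (Real.exp_le_exp.2 ((opNorm_le_stripNorm hY.bounded hz).trans hYnorm))
  have hpos : ∀ z ∈ strip d h', ‖WithLp.toLp 2
      (projPos.mulVec ((NormedSpace.exp (Y z)).mulVec v))‖ ≤
        Real.exp (1 / 2) * ‖WithLp.toLp 2 v‖ := fun z hz =>
    calc _ ≤ 1 * (Real.exp (1 / 2) * ‖WithLp.toLp 2 v‖) :=
          (norm_mulVec_le _ _).trans (mul_le_mul opNorm_projPos ((norm_mulVec_le _ _).trans
            (mul_le_mul_of_nonneg_right (hexpY z hz) (norm_nonneg _))) (norm_nonneg _) zero_le_one)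
      _ = _ := one_mul _
  choose gp hgp hgp' using exists_component hh' hBt hdeg hY projPos v hpos
  choose gn hgn hgn' using exists_component hh' hBt hdeg hY projNeg v hC'
  let c : Fin 2 → C(UnitAddTorus (Fin d), ℂ) := fun i => gp i + UnitAddTorus.mFourier (-l) * gn i
  have hc : ∀ i x, c i (toTorus x) =
      Complex.exp (-(Real.pi * Complex.I * (pair (l + l₀) x : ℝ))) * b x i := fun i x => by
    have e1 : Complex.exp (-(Real.pi * Complex.I * (pair (l + l₀) x : ℝ))) *
        Complex.exp (2 * Real.pi * (pairC l (toC x) / 2) * Complex.I) =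
        Complex.exp (-(Real.pi * Complex.I * pairC l₀ (toC x))) := by
      rw [← Complex.exp_add, pairC_toC, pairC_toC]
      congr 1
      simp only [pair, Pi.add_apply, Int.cast_add, add_mul, Finset.sum_add_distrib]
      push_cast; ring
    have e2 : Complex.exp (-(Real.pi * Complex.I * (pair (l + l₀) x : ℝ))) *
        Complex.exp (-(2 * Real.pi * (pairC l (toC x) / 2) * Complex.I)) =
        Complex.exp (2 * Real.pi * Complex.I * (pair (-l) x : ℝ)) *
          Complex.exp (-(Real.pi * Complex.I * pairC l₀ (toC x))) := by
      rw [← Complex.exp_add, ← Complex.exp_add, pairC_toC, pairC_toC]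
      congr 1
      simp only [pair, Pi.add_apply, Pi.neg_apply, Int.cast_add, Int.cast_neg, add_mul, neg_mul,
        Finset.sum_add_distrib, Finset.sum_neg_distrib]
      push_cast; ring
    rw [hb, rot_eq, Matrix.add_mulVec, Matrix.mulVec_add, Matrix.smul_mulVec, Matrix.smul_mulVec,
      Matrix.mulVec_smul, Matrix.mulVec_smul, Pi.add_apply, Pi.smul_apply, Pi.smul_apply,
      smul_eq_mul, smul_eq_mul, mul_add, ← mul_assoc, ← mul_assoc, e1, e2]
    simp only [c, ContinuousMap.add_apply, ContinuousMap.mul_apply, hgp, hgn, mFourier_toTorus]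
    ring
  have hcoef : ∀ k, ‖UnitAddTorus.mFourierCoeff (c 0) k‖ ≤ K ^ 2 * Real.exp (1 / 2) *
      ‖WithLp.toLp 2 v‖ * (Real.exp (-(2 * Real.pi * h') * len k) +
        C' * Real.exp (-(2 * Real.pi * h') * len (k + l))) := fun k => by
    have e : UnitAddTorus.mFourierCoeff (c 0) k =
        UnitAddTorus.mFourierCoeff (gp 0) k + UnitAddTorus.mFourierCoeff (gn 0) (k + l) := by
      rw [← mFourierCoeff_mFourier_mul, ← mFourierCoeff_add (by fun_prop) (by fun_prop)]; rfl
    rw [e]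
    refine (norm_add_le _ _).trans ((add_le_add (hgp' 0 k) (hgn' 0 (k + l))).trans_eq ?_)
    ring
  have hshift : ∀ i x, (schrodinger V lam E x).mulVec (fun i => c i (toTorus x)) i =
      Complex.exp (2 * Real.pi * Complex.I * ρ) * c i (toTorus (x + α)) := fun i x => by
    have e : (fun i => c i (toTorus x)) =
        Complex.exp (-(Real.pi * Complex.I * (pair (l + l₀) x : ℝ))) • b x := by
      ext i; rw [hc]; rfl
    rw [e, Matrix.mulVec_smul, hbloch, hc, Pi.smul_apply, Pi.smul_apply, smul_eq_mul, smul_eq_mul,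
      ← mul_assoc, ← mul_assoc, ← Complex.exp_add, ← Complex.exp_add]
    congr 2
    have hp : pair (l + l₀) (x + α) = pair (l + l₀) x + pair (l + l₀) α := by
      simp [pair, mul_add, Finset.sum_add_distrib]
    rw [hp]; push_cast; ring
  have h0 : ∀ x, c 0 (toTorus x) =
      Complex.exp (2 * Real.pi * Complex.I * ρ) * c 1 (toTorus (x + α)) := fun x => by
    rw [← hshift]; simp [schrodinger, Matrix.mulVec, dotProduct, Fin.sum_univ_two]
  have h1 : ∀ x, (E - (lam : ℂ)⁻¹ * V (toC x)) * c 0 (toTorus x) - c 1 (toTorus x) =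
      Complex.exp (2 * Real.pi * Complex.I * ρ) * c 0 (toTorus (x + α)) := fun x => by
    rw [← hshift]; simp [schrodinger, Matrix.mulVec, dotProduct, Fin.sum_univ_two, sub_eq_add_neg]
  have hunit : ∀ r : ℝ, ‖Complex.exp (2 * Real.pi * Complex.I * r)‖ = 1 := fun r => by
    rw [show 2 * Real.pi * Complex.I * r = ((2 * Real.pi * r : ℝ) : ℂ) * Complex.I by
      push_cast; ring, Complex.norm_exp_ofReal_mul_I]
  set N := ‖ContinuousMap.toLp 2 volume ℂ (c 0)‖ with hN
  -- `|b(x)| ≥ |v| / ‖B(x)‖` because `det B(x) = 1`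
  have hlow : ∀ x, ‖WithLp.toLp 2 v‖ ≤ K * Real.exp (1 / 2) * ‖WithLp.toLp 2 (b x)‖ := fun x => by
    have hz := toC_mem_strip (d := d) hh' x
    have e := norm_le_opNorm_mul_of_det_eq_one (hdet x) v
    rw [← Matrix.mulVec_mulVec, ← Matrix.mulVec_mulVec, ← hb] at e
    refine e.trans (mul_le_mul_of_nonneg_right ?_ (norm_nonneg _))
    refine (opNorm_mul_le _ _).trans (mul_le_mul ?_ (hexpY _ hz) (norm_nonneg _) (by linarith))
    refine (opNorm_mul_le _ _).trans ?_
    have e2 : pairC l (toC x) / 2 = ((pair l x / 2 : ℝ) : ℂ) := by rw [pairC_toC]; push_cast; rfl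
    rw [e2, opNorm_rot_ofReal, mul_one]
    exact opNorm_le_stripNorm hBt.bounded hz
  have hKe : 0 < K * Real.exp (1 / 2) := by positivity
  have hNv : ‖WithLp.toLp 2 v‖ ^ 2 ≤ 2 * (K * Real.exp (1 / 2) * N) ^ 2 := by
    have := le_norm_sq_toLp (c₀ := c 0) (c₁ := c 1) (α := α)
      (δ := (‖WithLp.toLp 2 v‖ / (K * Real.exp (1 / 2))) ^ 2)
      (fun x => by rw [h0, norm_mul, hunit, one_mul]) (fun x => by
        have e : ‖c 0 (toTorus x)‖ ^ 2 + ‖c 1 (toTorus x)‖ ^ 2 = ‖WithLp.toLp 2 (b x)‖ ^ 2 := by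
          have e1 : ‖Complex.exp (-(Real.pi * Complex.I * (pair (l + l₀) x : ℝ)))‖ = 1 := by
            rw [show -(Real.pi * Complex.I * (pair (l + l₀) x : ℝ)) =
              ((-(Real.pi * pair (l + l₀) x) : ℝ) : ℂ) * Complex.I by push_cast; ring,
              Complex.norm_exp_ofReal_mul_I]
          rw [hc, hc, norm_mul, norm_mul, e1, one_mul, one_mul, norm_sq_toLp]
        rw [e]
        refine pow_le_pow_left₀ (by positivity) ?_ 2
        rw [div_le_iff₀ hKe, mul_comm]
        exact hlow x)
    rw [← hN, div_pow, div_le_iff₀ (by positivity)] at this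
    rw [mul_pow _ N]
    linarith
  have hN0 : 0 < N := by
    refine lt_of_le_of_ne (norm_nonneg _) fun h => ?_
    rw [← h] at hNv
    have := pow_pos hv 2
    linarith
  have hNinv : N⁻¹ * (K ^ 2 * Real.exp (1 / 2) * ‖WithLp.toLp 2 v‖) ≤ 8 * K ^ 4 := by
    rw [inv_mul_le_iff₀ hN0]
    have e1 : ‖WithLp.toLp 2 v‖ ≤ 2 * (K * Real.exp (1 / 2) * N) :=
      (abs_le_of_sq_le_sq' (by nlinarith [sq_nonneg (K * Real.exp (1 / 2) * N)])
        (by positivity)).2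
    have e2 : Real.exp (1 / 2) * Real.exp (1 / 2) ≤ 4 := by
      rw [← Real.exp_add]
      norm_num
      exact Real.exp_one_lt_d9.le.trans (by norm_num)
    calc K ^ 2 * Real.exp (1 / 2) * ‖WithLp.toLp 2 v‖
        ≤ K ^ 2 * Real.exp (1 / 2) * (2 * (K * Real.exp (1 / 2) * N)) := by gcongr
      _ = 2 * (Real.exp (1 / 2) * Real.exp (1 / 2)) * K ^ 3 * N := by ring
      _ ≤ 2 * 4 * K ^ 4 * N := by
          have := pow_le_pow_right₀ hK1 (show 3 ≤ 4 by norm_num)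
          gcongr
      _ = N * (8 * K ^ 4) := by ring
  let u : lp (fun _ : Fin d → ℤ => ℂ) 2 :=
    ((N⁻¹ : ℝ) : ℂ) • UnitAddTorus.mFourierBasis.repr (ContinuousMap.toLp 2 volume ℂ (c 0))
  have hu : ∀ k, u k = ((N⁻¹ : ℝ) : ℂ) * UnitAddTorus.mFourierCoeff (c 0) k := fun k => by
    simp only [u, lp.coeFn_smul, Pi.smul_apply, smul_eq_mul, UnitAddTorus.mFourierBasis_repr,
      UnitAddTorus.mFourierCoeff_toLp]
  refine ⟨u, ⟨?_, fun k => ?_⟩, fun k => ?_⟩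
  · rw [norm_smul, LinearIsometryEquiv.norm_map, Complex.norm_real, norm_inv, hN, norm_norm,
      inv_mul_cancel₀ (hN ▸ hN0.ne')]
  · have := longRange_eq_of_bloch (hh'.trans hh) hV hlam (c 0) (c 1) h0 h1 k
    rw [longRange, hu]
    simp only [hu, mul_left_comm _ ((N⁻¹ : ℝ) : ℂ), tsum_mul_left]
    rw [← this]; ring
  · rw [hu, norm_mul, Complex.norm_real, Real.norm_of_nonneg (inv_nonneg.2 hN0.le)]
    have hC0 : 0 ≤ Real.exp (-(2 * Real.pi * h') * len k) +
        C' * Real.exp (-(2 * Real.pi * h') * len (k + l)) := by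
      have h2 : 0 < K ^ 2 * Real.exp (1 / 2) * ‖WithLp.toLp 2 v‖ := by positivity
      exact nonneg_of_mul_nonneg_right ((norm_nonneg _).trans (hcoef k)) h2
    calc _ ≤ N⁻¹ * (K ^ 2 * Real.exp (1 / 2) * ‖WithLp.toLp 2 v‖ * _) :=
          mul_le_mul_of_nonneg_left (hcoef k) (inv_nonneg.2 hN0.le)
      _ = N⁻¹ * (K ^ 2 * Real.exp (1 / 2) * ‖WithLp.toLp 2 v‖) * _ := by ring
      _ ≤ _ := mul_le_mul_of_nonneg_right hNinv hC0

/-! ### The size of the second peak -/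

theorem distZ_le_of_eq {x y : ℝ} {k : ℤ} (h : x = y + k) : distZ x ≤ |y| := by
  refine (round_le x k).trans_eq ?_
  rw [h, add_sub_cancel_right]

theorem distZ_pos {x : ℝ} (h : ∀ k : ℤ, x ≠ k) : 0 < distZ x :=
  abs_pos.2 (sub_ne_zero.2 (h _))

/-- If `v = p (1, -i) + r (1, i)` with `|r| ≤ |ν| |p| / (2|φ|)`, then the `(1, i)`-component of
`e^Y v` is small relative to `v` as soon as `Y` and `ν` are. -/
theorem norm_projNeg_exp_le {X : Matrix (Fin 2) (Fin 2) ℂ} {y φ a : ℝ} (hX : opNorm X ≤ y)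
    (hy : y ≤ 1 / 2) {p r : ℂ} (hφ : 0 < φ) (ha : 0 ≤ a) (hr : 2 * φ * ‖r‖ ≤ a * ‖p‖) :
    ‖WithLp.toLp 2 (projNeg.mulVec ((NormedSpace.exp X).mulVec (rotVec p r)))‖ ≤
      Real.exp (1 / 2) * min 1 (y + a / (2 * φ)) * ‖WithLp.toLp 2 (rotVec p r)‖ := by
  set v := rotVec p r with hv
  have hy0 : 0 ≤ y := (norm_nonneg _).trans hX
  have hproj : ∀ w, ‖WithLp.toLp 2 (projNeg.mulVec w)‖ ≤ ‖WithLp.toLp 2 w‖ := fun w =>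
    (norm_mulVec_le _ _).trans (mul_le_of_le_one_left (norm_nonneg _) opNorm_projNeg)
  have h1 : ‖WithLp.toLp 2 (projNeg.mulVec ((NormedSpace.exp X).mulVec v))‖ ≤
      Real.exp (1 / 2) * 1 * ‖WithLp.toLp 2 v‖ := by
    rw [mul_one]
    refine (hproj _).trans ((norm_mulVec_le _ _).trans ?_)
    exact mul_le_mul_of_nonneg_right ((opNorm_exp_le X).trans (Real.exp_le_exp.2 (hX.trans hy)))
      (norm_nonneg _)
  have h2 : ‖WithLp.toLp 2 (projNeg.mulVec ((NormedSpace.exp X).mulVec v))‖ ≤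
      Real.exp (1 / 2) * (y + a / (2 * φ)) * ‖WithLp.toLp 2 v‖ := by
    have e : projNeg.mulVec ((NormedSpace.exp X).mulVec v) =
        projNeg.mulVec ((NormedSpace.exp X - 1).mulVec v) + rotVec 0 r := by
      rw [← projNeg_rotVec p r, ← hv, ← Matrix.mulVec_add, Matrix.sub_mulVec, Matrix.one_mulVec,
        sub_add_cancel]
    have e1 : ‖WithLp.toLp 2 (rotVec 0 r)‖ ≤ a / (2 * φ) * ‖WithLp.toLp 2 v‖ := by
      rw [div_mul_eq_mul_div, le_div_iff₀ (by positivity)]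
      refine (abs_le_of_sq_le_sq' ?_ (by positivity)).2
      rw [mul_pow, mul_pow a, norm_sq_rotVec, hv, norm_sq_rotVec]
      have := pow_le_pow_left₀ (by positivity) hr 2
      rw [norm_zero]
      nlinarith [sq_nonneg (a * ‖r‖)]
    have e2 : Real.exp y - 1 ≤ Real.exp (1 / 2) * y := by
      have h3 : Real.exp y - 1 ≤ Real.exp y * y := by
        have := mul_le_mul_of_nonneg_left (Real.add_one_le_exp (-y)) (Real.exp_pos y).le
        rw [← Real.exp_add, add_neg_cancel, Real.exp_zero] at this
        linarith
      exact h3.trans (mul_le_mul_of_nonneg_right (Real.exp_le_exp.2 hy) hy0)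
    have e3 : opNorm (NormedSpace.exp X - 1) ≤ Real.exp (1 / 2) * y :=
      (opNorm_exp_sub_one_le X).trans ((sub_le_sub_right (Real.exp_le_exp.2 hX) 1).trans e2)
    have e4 : a / (2 * φ) ≤ Real.exp (1 / 2) * (a / (2 * φ)) :=
      le_mul_of_one_le_left (by positivity) (Real.one_le_exp (by norm_num))
    rw [e]
    calc _ ≤ ‖WithLp.toLp 2 (projNeg.mulVec ((NormedSpace.exp X - 1).mulVec v))‖ +
          ‖WithLp.toLp 2 (rotVec 0 r)‖ := norm_add_le (WithLp.toLp 2 _) (WithLp.toLp 2 _)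
      _ ≤ Real.exp (1 / 2) * y * ‖WithLp.toLp 2 v‖ +
          Real.exp (1 / 2) * (a / (2 * φ)) * ‖WithLp.toLp 2 v‖ :=
        add_le_add ((hproj _).trans ((norm_mulVec_le _ _).trans
          (mul_le_mul_of_nonneg_right e3 (norm_nonneg _))))
          (e1.trans (mul_le_mul_of_nonneg_right e4 (norm_nonneg _)))
      _ = _ := by ring
  rcases min_choice 1 (y + a / (2 * φ)) with h | h <;> rw [h] <;> assumption

end QPCocycle

open QPCocycle in
theorem proposition4p1 {d : ℕ} (α : Fin d → ℝ) (h h' : ℝ) (hh' : 0 < h') (hh : h' < h)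
    (V : (Fin d → ℂ) → ℂ) (hV : QPCocycle.IsAnalyticReal h V)
    (lam : ℝ) (hlam : lam ≠ 0) (E ρ : ℝ)
    (hρ : QPCocycle.IsFiberedRotationNumber α (QPCocycle.schrodinger V lam E) ρ)
    (hirr : ¬ QPCocycle.IsRationalWrt α ρ)
    (B Bt Y : (Fin d → ℂ) → Matrix (Fin 2) (Fin 2) ℂ)
    (A : Matrix.SpecialLinearGroup (Fin 2) ℝ) (t : ℝ) (ν : ℂ) (l l₀ : Fin d → ℤ)
    (hB : QPCocycle.IsAnalyticPSL h' B)
    (hconj : ∀ θ : Fin d → ℝ,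
      (B (QPCocycle.toC (θ + α)))⁻¹ * QPCocycle.schrodinger V lam E θ * B (QPCocycle.toC θ)
          = QPCocycle.matC A.1 ∨
      (B (QPCocycle.toC (θ + α)))⁻¹ * QPCocycle.schrodinger V lam E θ * B (QPCocycle.toC θ)
          = -QPCocycle.matC A.1)
    (hA : QPCocycle.matC A.1 =
      QPCocycle.cayleyM⁻¹ * NormedSpace.exp (QPCocycle.su11 t ν) * QPCocycle.cayleyM)
    (hBt : QPCocycle.IsAnalyticPSL h' Bt) (hdeg : QPCocycle.HasDegree Bt l₀)
    (hY : QPCocycle.IsAnalyticSl h' Y)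
    (hfac : ∀ z ∈ QPCocycle.strip d h',
      B z = Bt z * QPCocycle.rot (QPCocycle.pairC l z / 2) * NormedSpace.exp (Y z))
    (hYnorm : QPCocycle.stripNorm h' Y ≤ 1 / 2) :
    QPCocycle.HasGoodEigenfunction V lam α ρ (lam * E) (2 * Real.pi * h') l
        (8 * QPCocycle.stripNorm h' Bt ^ 4)
        (min 1 (QPCocycle.stripNorm h' Y +
          2 * ‖ν‖ / QPCocycle.distZ (2 * ρ - QPCocycle.pair l α - QPCocycle.pair l₀ α))) ∨
    QPCocycle.HasGoodEigenfunction V lam α ρ (lam * E) (2 * Real.pi * h') (-l)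
        (8 * QPCocycle.stripNorm h' Bt ^ 4)
        (min 1 (QPCocycle.stripNorm h' Y +
          2 * ‖ν‖ / QPCocycle.distZ (2 * ρ - QPCocycle.pair l α - QPCocycle.pair l₀ α))) := by
  have hAexp := eq_exp_su11Real hA
  have hBfac : ∀ x, B (toC x) =
      Bt (toC x) * rot (pairC l (toC x) / 2) * NormedSpace.exp (Y (toC x)) := fun x =>
    hfac _ (toC_mem_strip hh' x)
  have hdet : ∀ x, (B (toC x)).det = 1 := fun x => by
    obtain ⟨P, hP, hBP⟩ := hB.real x
    rw [hBP, det_matC, hP, Complex.ofReal_one]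
  have hlog : ∀ {c₁ c₂ : ℂ}, ‖c₂‖ < ‖c₁‖ →
      ∃ c, IsDirLog (fun x => (B (toC x))⁻¹) c₁ c₂ (l + l₀) c := fun hc => by
    simpa only [hBfac] using exists_isDirLog (l := l) hh' hdeg hY hc
  left
  rcases le_or_gt (t ^ 2) (‖ν‖ ^ 2) with hle | hlt
  · -- a real eigenvector of `A` makes the rotation number rational with respect to `α`
    obtain ⟨v, a, hv, ha, hAv⟩ := exists_real_eigenvector hle
    have hv' : (v 0 : ℂ) - Complex.I * v 1 ≠ 0 := fun h => hv <| by
      have h0 := congrArg Complex.re h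
      have h1 := congrArg Complex.im h
      simp at h0 h1
      ext i; fin_cases i <;> simp [h0, h1]
    obtain ⟨c, hc⟩ := hlog (c₁ := (v 0 : ℂ) - Complex.I * v 1) (c₂ := 0)
      (by rwa [norm_zero, norm_pos_iff])
    have hBc : Continuous fun x : Fin d → ℝ => B (toC x) := by
      refine continuous_matrix fun i j => ?_
      exact (hB.analytic i j).continuousOn.comp_continuous (by unfold toC; fun_prop)
        (toC_mem_strip hh')
    obtain ⟨k, hk⟩ := rotationNumber_of_real_eigenvector (B := fun x => B (toC x)) A.2 hv ha
      (hAexp ▸ hAv) hc hB.real hBc hρ hconj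
    exact (hirr ⟨_, k, hk⟩).elim
  · obtain ⟨φ, p, r, c₁, c₂, hφ, hp, hr, hc, hev, hzeta⟩ := exists_elliptic_data hlt
    rw [← hAexp] at hev hzeta
    obtain ⟨c, hc⟩ := hlog hc
    obtain ⟨⟨k, hk⟩, hS⟩ := rotationNumber_of_elliptic (B := fun x => B (toC x)) hc
      (fun x => by rw [hdet]; exact isUnit_one) hρ hconj hzeta
    have hpair : pair (l + l₀) α = pair l α + pair l₀ α := by
      simp [pair, add_mul, Finset.sum_add_distrib]
    have hD : 2 * ρ - pair l α - pair l₀ α = φ / Real.pi + k := by rw [← hk, hpair]; ring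
    have hDpos : 0 < distZ (2 * ρ - pair l α - pair l₀ α) := distZ_pos fun m hm =>
      hirr ⟨l + l₀, m, by rw [hpair]; linarith⟩
    have hφ0 : 0 < |φ| := abs_pos.2 hφ
    have hνD : ‖ν‖ / (2 * |φ|) ≤ 2 * ‖ν‖ / distZ (2 * ρ - pair l α - pair l₀ α) := by
      rw [div_le_div_iff₀ (by positivity) hDpos]
      have h1 : distZ (2 * ρ - pair l α - pair l₀ α) ≤ |φ| := by
        refine (distZ_le_of_eq hD).trans ?_
        rw [abs_div, abs_of_pos Real.pi_pos]
        exact div_le_self hφ0.le (by linarith [Real.pi_gt_three])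
      nlinarith [mul_le_mul_of_nonneg_left h1 (norm_nonneg ν),
        mul_nonneg (norm_nonneg ν) hφ0.le]
    have hv : 0 < ‖WithLp.toLp 2 (rotVec p r)‖ := by
      have h1 := norm_sq_rotVec p r
      have h2 : 0 < ‖p‖ := norm_pos_iff.2 hp
      refine lt_of_le_of_ne (norm_nonneg _) fun h => ?_
      rw [← h] at h1
      nlinarith [sq_nonneg ‖r‖]
    refine hasGoodEigenfunction_of_bloch hh' hh hV hlam hBt hdeg hY hYnorm hv
      (b := fun x => (B (toC x)).mulVec (rotVec p r))
      (fun x => by rw [hBfac, ← Matrix.mulVec_mulVec, ← Matrix.mulVec_mulVec])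
      (fun x => by rw [← hBfac, hdet]) (fun x => ?_) (fun z hz => ?_)
    · have h1 := congrArg (fun M : Matrix (Fin 2) (Fin 2) ℂ =>
        (B (toC (x + α))).mulVec (M.mulVec (rotVec p r))) (hS x)
      simp only [Matrix.smul_mulVec, hev, Matrix.mulVec_smul, smul_smul] at h1
      rw [mul_assoc (Complex.exp _), ← Complex.exp_add, neg_add_cancel, Complex.exp_zero,
        mul_one] at h1
      rw [← h1]
      simp only [Matrix.mulVec_mulVec, mul_assoc]
      rw [Matrix.mul_nonsing_inv_cancel_left _ _ (by rw [hdet]; exact isUnit_one)]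
    · refine (norm_projNeg_exp_le (opNorm_le_stripNorm hY.bounded hz) hYnorm hφ0
        (norm_nonneg _) hr).trans ?_
      gcongr
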